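/- Let $W$ be a compact smooth manifold of dimension $n\ge 3$ with boundary $M=\partial W$, and let $\bar g_t$, $t\in[0,T)$, be a family of Riemannian metrics on $W$, smooth on $W\times[0,T)$, which solves the Ricci flow with boundary conditions $$\partial_t\bar g_t=-2\,\mathrm{Ric}_{\bar g_t},\qquad H_{\bar g_t}\equiv 0\ \text{on } M,\qquad \bar g_t|_M\in[\bar g_0|_M],$$ where $H_{\bar g_t}$ is the mean curvature of $M$ and $[\,\cdot\,]$ denotes the conformal class. Put $g_t=\bar g_t|_M$, let $d\sigma_{\bar g_t}$ and $d\sigma_{g_t}$ be the Riemannian volume measures of $W$ and $M$, and let $\nu_t$ be the outward unit normal of $M$ with respect to $\bar g_t$. For $p>1$ let $$\mathsf Y_p(W,\bar g)=\inf_{v}\ \frac{\int_W\left(\frac{4(n-1)}{n-2}|\nabla_{\bar g} v|^2+R_{\bar g}v^2\right)d\sigma_{\bar g}}{\left(\int_W v^{p+1}\,d\sigma_{\bar g}\right)^{2/(p+1)}},$$ where the infimum is over all smooth positive functions $v$ on $W$ with $\partial_\nu v\equiv 0$ on $M$. Let $p\in(1,\frac{n+2}{n-2}]$ and let $u(t)$,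 $t\in[0,T)$, be a $C^1$-family of smooth positive functions on $W$ (each $u(t)$ is smooth, and $t\mapsto u(t)$ is a $C^1$ map into $C^2(W)$) such that for every $t\in[0,T)$ $$-\tfrac{4(n-1)}{n-2}\Delta_{\bar g_t}u(t)+R_{\bar g_t}u(t)=\mathsf Y_p(W,\bar g_t)\,u(t)^p\ \text{ on } W,\qquad \int_W u(t)^{p+1}d\sigma_{\bar g_t}=1,\qquad \partial_{\nu_t}u(t)=0\ \text{ on } M.$$ Then $t\mapsto\mathsf Y_p(W,\bar g_t)$ is differentiable on $[0,T)$ (from the right at $t=0$), and with $u=u(t)$, $h=\frac{\partial u}{\partial t}$, and $\overline{\mathrm{Ric}}$, $\overline{\mathrm{Ric}}^0$, $\bar R$, $\bar\nabla$, $\bar\Delta$ the Ricci tensor, traceless Ricci tensor, scalar curvature, gradient and Laplace–Beltrami operator of $\bar g_t$, $$\begin{aligned}\frac{d}{dt}\mathsf Y_p(W,\bar g_t)=&\int_W\left(\tfrac{8(n-1)}{n-2}\overline{\mathrm{Ric}}^0(\bar\nabla u,\bar\nabla u)+2|\overline{\mathrm{Ric}}^0|^2u^2\right)d\sigma_{\bar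 g_t}\\&+\left(\tfrac2n-\tfrac{p-1}{p+1}\right)\int_W\left(\tfrac{4(n-1)}{n-2}\bar R|\bar\nabla u|^2+\bar R^2u^2\right)d\sigma_{\bar g_t}\\&+\int_W\left(u^2\bar\Delta\bar R-\tfrac{4(n-1)}{(p+1)(n-2)}\bar R\,\bar\Delta u^2\right)d\sigma_{\bar g_t}\\&-\tfrac{8(n-1)}{n-2}\int_M\left(2u\,\overline{\mathrm{Ric}}(\bar\nabla u,\nu_t)+u\,\partial_{\nu_t}h\right)d\sigma_{g_t}.\end{aligned}$$ Moreover, let $t\in[0,T)$ and $x\in M$, and let $e_1,\dots,e_{n-1},\nu_t$ be a $\bar g_t$-orthonormal basis of $T_xW$ (for example $e_i=\partial_i$ for local coordinates with $(\bar g_t)_{ij}(x)=\delta_{ij}$ and $\nu_t(x)=\partial_n$). Then at $x$ $$\partial_t\nu_t=2\sum_{i=1}^{n-1}\overline{\mathrm{Ric}}(e_i,\nu_t)\,e_i+\overline{\mathrm{Ric}}(\nu_t,\nu_t)\,\nu_t,\qquad \partial_{\nu_t}h=-2\sum_{i=1}^{n-1}\overline{\mathrm{Ric}}(e_i,\nu_t)\,e_i(u),\qquad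 \overline{\mathrm{Ric}}(\bar\nabla u,\nu_t)=\sum_{i=1}^{n-1}\overline{\mathrm{Ric}}(e_i,\nu_t)\,e_i(u).$$ -/

import Mathlib

open Set Filter Topology MeasureTheory Bundle
open scoped Manifold ContDiff

noncomputable section

namespace BoundaryRicci

/-! ### Coordinate formulas on the closed half-space `{y | 0 ≤ y 0}` of `ℝⁿ` -/

/-- The model space `ℝⁿ` with its Euclidean norm. -/
abbrev Coord (n : ℕ) : Type := EuclideanSpace ℝ (Fin n)

/-- The `i`-th standard basis vector of `ℝⁿ`. -/
def basisVec {n : ℕ} (i : Fin n) : Coord n := EuclideanSpace.single i 1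

/-- The partial derivative `∂ᵢ f` at `y`, taken within the closed half-space (one-sided in the
normal direction at points with `y 0 = 0`). -/
def pd {n : ℕ} [NeZero n] (i : Fin n) (f : Coord n → ℝ) (y : Coord n) : ℝ :=
  fderivWithin ℝ f (range (𝓡∂ n)) y (basisVec i)

/-- The Christoffel symbol `Γᵏᵢⱼ = ½ ∑ₗ Gᵏˡ (∂ᵢ Gⱼₗ + ∂ⱼ Gᵢₗ - ∂ₗ Gᵢⱼ)` of a field of matrices. -/
def christoffel {n : ℕ} [NeZero n] (G : Coord n → Matrix (Fin n) (Fin n) ℝ)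
    (k i j : Fin n) (y : Coord n) : ℝ :=
  (1 / 2) * ∑ l, (G y)⁻¹ k l *
    (pd i (fun z => G z j l) y + pd j (fun z => G z i l) y - pd l (fun z => G z i j) y)

/-- The Ricci tensor in coordinates,
`Rᵢⱼ = ∂ₖ Γᵏᵢⱼ - ∂ⱼ Γᵏᵢₖ + Γᵏₖₗ Γˡᵢⱼ - Γᵏⱼₗ Γˡᵢₖ` (summed over `k`, `l`). -/
def ricciCoord {n : ℕ} [NeZero n] (G : Coord n → Matrix (Fin n) (Fin n) ℝ)
    (i j : Fin n) (y : Coord n) : ℝ :=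
  ∑ k, (pd k (christoffel G k i j) y - pd j (christoffel G k i k) y
    + ∑ l, (christoffel G k k l y * christoffel G l i j y
      - christoffel G k j l y * christoffel G l i k y))

/-- The Laplace–Beltrami operator in coordinates,
`Δf = (det G)^(-1/2) ∂ᵢ ((det G)^(1/2) Gⁱʲ ∂ⱼ f)`. -/
def laplaceCoord {n : ℕ} [NeZero n] (G : Coord n → Matrix (Fin n) (Fin n) ℝ)
    (f : Coord n → ℝ) (y : Coord n) : ℝ :=
  (√(G y).det)⁻¹ * ∑ i, pd i (fun z => √(G z).det * ∑ j, (G z)⁻¹ i j * pd j f z) y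

/-- The indices of the coordinates that are tangential to the boundary `{y | y 0 = 0}`. -/
abbrev TangIdx (n : ℕ) [NeZero n] : Type := {i : Fin n // i ≠ 0}

/-- The tangential block of a matrix. -/
def tangBlock {n : ℕ} [NeZero n] (A : Matrix (Fin n) (Fin n) ℝ) :
    Matrix (TangIdx n) (TangIdx n) ℝ :=
  A.submatrix Subtype.val Subtype.val

/-- The inclusion `ℝⁿ⁻¹ → {y | y 0 = 0}`. -/
def bdryIncl {n : ℕ} [NeZero n] (z : TangIdx n → ℝ) : Coord n :=
  WithLp.toLp 2 (fun i => if h : i ≠ 0 then z ⟨i, h⟩ else 0)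

/-! ### Riemannian geometry of a manifold with boundary -/

section Manifold

variable {n : ℕ} [NeZero n] {W : Type*} [TopologicalSpace W]
  [ChartedSpace (EuclideanHalfSpace n) W] [IsManifold (𝓡∂ n) ∞ W]

variable (n W) in
/-- Smooth Riemannian metrics on the manifold with boundary `W`. -/
abbrev RMetric : Type _ :=
  ContMDiffRiemannianMetric (𝓡∂ n) ∞ (Coord n) (fun x : W => TangentSpace (𝓡∂ n) x)

/-- The matrix of the metric at `x`, in the basis of `T_x W` given by the preferred chart at
`x` (Mathlib identifies `T_x W` with `ℝⁿ` through this chart). -/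
def metricMat (g : RMetric n W) (x : W) : Matrix (Fin n) (Fin n) ℝ :=
  Matrix.of fun i j =>
    g.inner x (basisVec i : TangentSpace (𝓡∂ n) x) (basisVec j : TangentSpace (𝓡∂ n) x)

/-- The coefficients `g(∂ᵢ, ∂ⱼ)` of the metric in the chart around `x₀`, as functions on the
target of this chart. -/
def metricCoord (g : RMetric n W) (x₀ : W) (y : Coord n) : Matrix (Fin n) (Fin n) ℝ :=
  Matrix.of fun i j =>
    g.inner ((extChartAt (𝓡∂ n) x₀).symm y)
      (mfderivWithin 𝓘(ℝ, Coord n) (𝓡∂ n) (extChartAt (𝓡∂ n) x₀).symm (range (𝓡∂ n)) y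
        (basisVec i))
      (mfderivWithin 𝓘(ℝ, Coord n) (𝓡∂ n) (extChartAt (𝓡∂ n) x₀).symm (range (𝓡∂ n)) y
        (basisVec j))

/-- The Ricci tensor `Ric(v, w)` at `x`, computed in the preferred chart at `x`. -/
def ric (g : RMetric n W) (x : W) (v w : Coord n) : ℝ :=
  ∑ i, ∑ j, ricciCoord (metricCoord g x) i j (extChartAt (𝓡∂ n) x x) * v i * w j

/-- The scalar curvature, the trace of the Ricci tensor. -/
def scal (g : RMetric n W) (x : W) : ℝ :=
  ∑ i, ∑ j, (metricMat g x)⁻¹ i j * ric g x (basisVec i) (basisVec j)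

/-- The traceless Ricci tensor `Ric⁰ = Ric - (R / n) g`. -/
def ric0 (g : RMetric n W) (x : W) (v w : Coord n) : ℝ :=
  ric g x v w - scal g x / n *
    g.inner x (v : TangentSpace (𝓡∂ n) x) (w : TangentSpace (𝓡∂ n) x)

/-- `|Ric⁰|² = gⁱᵏ gʲˡ Ric⁰ᵢⱼ Ric⁰ₖₗ`. -/
def ric0NormSq (g : RMetric n W) (x : W) : ℝ :=
  ∑ i, ∑ j, ∑ k, ∑ l, (metricMat g x)⁻¹ i k * (metricMat g x)⁻¹ j l *
    ric0 g x (basisVec i) (basisVec j) * ric0 g x (basisVec k) (basisVec l)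

/-- The derivative `df(v)` of a function in the direction of a tangent vector at `x`. -/
def dirDeriv (f : W → ℝ) (x : W) (v : Coord n) : ℝ :=
  mfderiv (𝓡∂ n) 𝓘(ℝ, ℝ) f x (v : TangentSpace (𝓡∂ n) x)

/-- The gradient, `(∇f)ⁱ = gⁱʲ ∂ⱼ f`. -/
def grad (g : RMetric n W) (f : W → ℝ) (x : W) : Coord n :=
  WithLp.toLp 2 (fun i => ∑ j, (metricMat g x)⁻¹ i j * dirDeriv f x (basisVec j))

/-- `|∇f|²`. -/
def gradNormSq (g : RMetric n W) (f : W → ℝ) (x : W) : ℝ :=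
  g.inner x (grad g f x : TangentSpace (𝓡∂ n) x) (grad g f x : TangentSpace (𝓡∂ n) x)

/-- The Laplace–Beltrami operator (the sign for which it is `∑ ∂ᵢ²` on `ℝⁿ`). -/
def laplace (g : RMetric n W) (f : W → ℝ) (x : W) : ℝ :=
  laplaceCoord (metricCoord g x) (f ∘ (extChartAt (𝓡∂ n) x).symm) (extChartAt (𝓡∂ n) x x)

/-- The outward unit normal vector at a boundary point. In a boundary chart the manifold is
`{y | 0 ≤ y 0}`, so `νⁱ = - gⁱ⁰ / √g⁰⁰`. -/
def outNormal (g : RMetric n W) (x : W) : Coord n :=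
  WithLp.toLp 2 (fun i => -((metricMat g x)⁻¹ i 0 / √((metricMat g x)⁻¹ 0 0)))

/-- The derivative `∂_ν f` in the direction of the outward unit normal. -/
def normalDeriv (g : RMetric n W) (f : W → ℝ) (x : W) : ℝ :=
  dirDeriv f x (outNormal g x)

/-- The mean curvature of the boundary with respect to the outward unit normal: the trace over
the tangential directions of the second fundamental form
`A(∂ᵢ, ∂ⱼ) = g(∇ᵢ ν, ∂ⱼ) = - g(ν, ∇ᵢ ∂ⱼ) = Γ⁰ᵢⱼ / √g⁰⁰`. -/
def meanCurvature (g : RMetric n W) (x : W) : ℝ :=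
  ∑ i, ∑ j, (tangBlock (metricMat g x))⁻¹ i j *
    (christoffel (metricCoord g x) 0 i j (extChartAt (𝓡∂ n) x x) / √((metricMat g x)⁻¹ 0 0))

/-! ### Volume and the Yamabe constants -/

/-- The measure with density `√(det gᵢⱼ)` in the chart around `x₀`, carried by the domain of
this chart. -/
def localVolume [MeasurableSpace W] (g : RMetric n W) (x₀ : W) : Measure W :=
  ((volume.restrict (extChartAt (𝓡∂ n) x₀).target).withDensity
    (fun y => ENNReal.ofReal √(metricCoord g x₀ y).det)).map (extChartAt (𝓡∂ n) x₀).symm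

/-- The Riemannian volume measure `dσ_ḡ` of `W`. By the change of variables formula the local
volumes are the restrictions of one measure to the chart domains; that measure is their
supremum, that is, the least measure which dominates all of them. -/
def volumeMeasure [MeasurableSpace W] (g : RMetric n W) : Measure W := ⨆ x₀ : W, localVolume g x₀

/-- The measure with density `√(det gᵢⱼ)_{i, j ≠ 0}` on the boundary part of the chart around
`x₀`: the volume of the metric which `g` induces on `∂W`. -/
def localBdryVolume [MeasurableSpace W] (g : RMetric n W) (x₀ : W) : Measure W :=
  (((volume : Measure (TangIdx n → ℝ)).restrict
      (bdryIncl ⁻¹' (extChartAt (𝓡∂ n) x₀).target)).withDensity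
    (fun z => ENNReal.ofReal √(tangBlock (metricCoord g x₀ (bdryIncl z))).det)).map
      ((extChartAt (𝓡∂ n) x₀).symm ∘ bdryIncl)

/-- The Riemannian volume measure `dσ_g` of the boundary `M = ∂W` with the induced metric, as a
measure on `W` carried by `∂W`. -/
def bdryMeasure [MeasurableSpace W] (g : RMetric n W) : Measure W := ⨆ x₀ : W, localBdryVolume g x₀

/-- The numerator of the Yamabe quotient, `∫_W (4(n-1)/(n-2) |∇v|² + R v²)`. -/
def yamabeEnergy [MeasurableSpace W] (g : RMetric n W) (v : W → ℝ) : ℝ :=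
  ∫ x, (4 * ((n : ℝ) - 1) / ((n : ℝ) - 2) * gradNormSq g v x + scal g x * v x ^ 2)
    ∂(volumeMeasure g)

/-- The constant `Y_p(W, g)`: the infimum of
`∫_W (4(n-1)/(n-2) |∇v|² + R v²) / (∫_W v^(p+1))^(2/(p+1))` over all smooth positive functions
`v` on `W` with `∂_ν v = 0` on `∂W`. -/
def yamabeConst [MeasurableSpace W] (p : ℝ) (g : RMetric n W) : ℝ :=
  sInf {r : ℝ | ∃ v : W → ℝ, ContMDiff (𝓡∂ n) 𝓘(ℝ, ℝ) ∞ v ∧ (∀ x, 0 < v x) ∧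
    (∀ x ∈ (𝓡∂ n).boundary W, normalDeriv g v x = 0) ∧
    r = yamabeEnergy g v / (∫ x, v x ^ (p + 1) ∂(volumeMeasure g)) ^ (2 / (p + 1))}


/-! ### Time-dependent objects on `[0, T)` -/

/-- A solution of the Ricci flow on `[0, T)` with boundary conditions: the family `g` is smooth in
space and time on `W × [0, T)`, `∂ₜ g = -2 Ric`, the mean curvature of the boundary vanishes, and
the metric induced on the boundary stays in the conformal class of the one induced by `g 0`. -/
structure IsBoundaryRicciFlow (T : ℝ) (g : ℝ → RMetric n W) : Prop where
  smooth : ∀ (x₀ : W) (i j : Fin n),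
    ContDiffOn ℝ ∞ (fun q : ℝ × Coord n => metricCoord (g q.1) x₀ q.2 i j)
      (Ico 0 T ×ˢ (extChartAt (𝓡∂ n) x₀).target)
  evolution : ∀ t ∈ Ico 0 T, ∀ (x : W) (v w : Coord n),
    HasDerivWithinAt
      (fun s => (g s).inner x (v : TangentSpace (𝓡∂ n) x) (w : TangentSpace (𝓡∂ n) x))
      (-2 * ric (g t) x v w) (Ico 0 T) t
  minimal : ∀ t ∈ Ico 0 T, ∀ x ∈ (𝓡∂ n).boundary W, meanCurvature (g t) x = 0
  conformal : ∀ t ∈ Ico 0 T, ∃ f : W → ℝ, ContMDiff (𝓡∂ n) 𝓘(ℝ, ℝ) ∞ f ∧ (∀ x, 0 < f x) ∧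
    ∀ x ∈ (𝓡∂ n).boundary W, ∀ v w : Coord n, v 0 = 0 → w 0 = 0 →
      (g t).inner x (v : TangentSpace (𝓡∂ n) x) (w : TangentSpace (𝓡∂ n) x)
        = f x * (g 0).inner x (v : TangentSpace (𝓡∂ n) x) (w : TangentSpace (𝓡∂ n) x)

/-- The time derivative `∂ₜ u` of a family of functions on `[0, T)`, one-sided at `0`. -/
def timeDeriv (T : ℝ) (u : ℝ → W → ℝ) (t : ℝ) (x : W) : ℝ :=
  derivWithin (fun s => u s x) (Ico 0 T) t

/-- The partial derivatives of order at most `k` of the functions `u t` in charts are jointly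
continuous on `W × [0, T)`. -/
def ContinuousInC (T : ℝ) (k : ℕ) (u : ℝ → W → ℝ) : Prop :=
  (∀ t ∈ Ico 0 T, ContMDiff (𝓡∂ n) 𝓘(ℝ, ℝ) k (u t)) ∧
  ∀ (x₀ : W), ∀ l ≤ k,
    ContinuousOn (fun q : ℝ × Coord n =>
        iteratedFDerivWithin ℝ l (u q.1 ∘ (extChartAt (𝓡∂ n) x₀).symm)
          (extChartAt (𝓡∂ n) x₀).target q.2)
      (Ico 0 T ×ˢ (extChartAt (𝓡∂ n) x₀).target)

/-- `u` is a `C¹` family of smooth functions on `W`, `t ∈ [0, T)`: each `u t` is smooth, and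
`t ↦ u t` is continuously differentiable as a map into `C²(W)`, the derivatives entering the second
order equations that `u t` solves (in particular this holds if it is `C¹` as a map into
`C^∞(W)`). -/
structure IsC1Family (T : ℝ) (u : ℝ → W → ℝ) : Prop where
  smooth : ∀ t ∈ Ico 0 T, ContMDiff (𝓡∂ n) 𝓘(ℝ, ℝ) ∞ (u t)
  differentiable : ∀ t ∈ Ico 0 T, ∀ x : W,
    DifferentiableWithinAt ℝ (fun s => u s x) (Ico 0 T) t
  continuous : ContinuousInC (n := n) T 2 u
  continuous_deriv : ContinuousInC (n := n) T 2 (timeDeriv T u)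

end Manifold

end BoundaryRicci

end

open BoundaryRicci

set_option linter.unusedSectionVars false

noncomputable section

/-! ### Matrix calculus over a commutative ring with derivations -/

namespace DiffAlg

open Matrix

section

variable {ι A : Type*} [Fintype ι] [DecidableEq ι] [CommRing A] [Algebra ℝ A]

/-! Write a = 4(n-1)/(n-2), Y(t) for the constant in the equation of u(t), and h = ∂ₜu. Pairing the
equation with u and integrating by parts, with ∂_ν u = 0 and the normalization of u, gives Y = ∫
(a|∇u|² + R u²) (`eq_integral_of_solution`). Thus Y_p enters only through the equation, and its
differentiability follows from that of an explicit integral.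

Along the flow the volume form evolves by -R, and ∂ₜR = ΔR + 2|Ric|² and ∂ₜ|∇u|² = 2 Ric(∇u,∇u) +
2⟨∇h,∇u⟩. In the derivative of the integral the terms in h are 2a⟨∇h,∇u⟩ + 2Ruh. Green's formula,
which has no boundary term because ∂_ν u = 0, and the equation turn them into 2Y∫uᵖh.
Differentiating ∫uᵖ⁺¹ = 1 gives (p+1)∫uᵖh = ∫R uᵖ⁺¹, so h disappears. The equation once more, Δu² =
2uΔu + 2|∇u|² and the splitting of Ric into traceless part and trace give the interior terms
(`hasDerivWithinAt_of_solution`).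

For the boundary, differentiate du(ν) = 0 in time. Since ν is the normalized raised covector -dy⁰,
one finds ∂ₜν = 2 Ric(ν) - Ric(ν,ν)ν (`hasDerivWithinAt_outNormal`), hence ∂_ν h = -2 Ric(∇u,ν)
(`normalDeriv_timeDeriv`). The integrand of the boundary integral in the theorem is therefore zero
at every point of M, and the interior terms alone are the derivative.

The evolution of R is pure algebra: it holds in any commutative ℝ-algebra with commuting
derivations, with connections treated as matrix-valued forms (`scalar_evolution`). It rests on the
contracted second Bianchi identity and on Palatini's formula for the variation of the Ricci tensor.
The same language shows that the Ricci tensor and the Laplacian do not depend on coordinates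
(`coordChange`). This is needed because the curvature of W is defined at each point in the preferred
chart of that point, and this chart jumps from point to point. The algebra is applied to smooth
functions on relatively open subsets of the half-space, and of its product with [0,T).

The analytic ingredients are the gluing of the local volumes (`volumeMeasure_apply`), the divergence
theorem on the half-space with a partition of unity (`green`), differentiation under the integral
(`hasDerivWithinAt_integral`), and the exchange of ∂ₜ with space derivatives, one-sided at t = 0 and
at the boundary (`hasDerivWithinAt_pd`). -/

lemma map_derivation_mul (D : Derivation ℝ A A) (M N : Matrix ι ι A) :
    (M * N).map D = M.map D * N + M * N.map D := by
  ext i j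
  simp only [Matrix.map_apply, Matrix.mul_apply, map_sum, Derivation.leibniz, smul_eq_mul,
    Matrix.add_apply, ← Finset.sum_add_distrib]
  exact Finset.sum_congr rfl fun k _ => by ring

lemma map_derivation_add (D : Derivation ℝ A A) (M N : Matrix ι ι A) :
    (M + N).map D = M.map D + N.map D := by
  ext i j; simp

lemma map_derivation_sub (D : Derivation ℝ A A) (M N : Matrix ι ι A) :
    (M - N).map D = M.map D - N.map D := by
  ext i j; simp

lemma map_derivation_one (D : Derivation ℝ A A) : (1 : Matrix ι ι A).map D = 0 := by
  ext i j
  by_cases h : i = j <;> simp [h]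

lemma map_derivation_transpose (D : Derivation ℝ A A) (M : Matrix ι ι A) :
    Mᵀ.map D = (M.map D)ᵀ := rfl

/-- The derivative of the inverse of a matrix. -/
lemma map_derivation_inv (D : Derivation ℝ A A) {G Q : Matrix ι ι A} (h : Q * G = 1) :
    Q.map D = -(Q * G.map D * Q) := by
  have h' : G * Q = 1 := mul_eq_one_comm.mp h
  have h1 := congrArg (fun M => M.map D) h
  simp only [map_derivation_mul, map_derivation_one] at h1
  have h2 : (Q.map D * G + Q * G.map D) * Q = 0 := by rw [h1, zero_mul]
  rw [add_mul, mul_assoc, h', mul_one] at h2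
  exact eq_neg_of_add_eq_zero_left h2

/-- The Leibniz rule for a product over a finite set. -/
lemma derivation_prod {κ : Type*} [DecidableEq κ] (D : Derivation ℝ A A) (s : Finset κ)
    (f : κ → A) : D (∏ i ∈ s, f i) = ∑ i ∈ s, D (f i) * ∏ j ∈ s.erase i, f j := by
  induction s using Finset.induction_on with
  | empty => simp
  | insert a s ha ih =>
    rw [Finset.prod_insert ha, Derivation.leibniz, ih, Finset.sum_insert ha,
      Finset.erase_insert ha, smul_eq_mul, smul_eq_mul, Finset.mul_sum, add_comm, mul_comm]
    congr 1
    refine Finset.sum_congr rfl fun i hi => ?_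
    have : a ≠ i := fun h => ha (h ▸ hi)
    rw [Finset.erase_insert_of_ne this, Finset.prod_insert (by simp [ha])]
    ring

/-- Jacobi's formula. -/
lemma derivation_det (D : Derivation ℝ A A) (G : Matrix ι ι A) :
    D G.det = (G.adjugate * G.map D).trace := by
  have key : ∀ i : ι, (G.adjugate * G.map D) i i = (G.updateCol i (fun k => D (G k i))).det := by
    intro i
    rw [← Matrix.cramer_apply, Matrix.cramer_eq_adjugate_mulVec]
    rfl
  rw [Matrix.trace]
  simp only [Matrix.diag_apply, key, Matrix.det_apply, map_sum]
  rw [Finset.sum_comm]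
  refine Finset.sum_congr rfl fun σ _ => ?_
  rw [← Finset.smul_sum]
  have : D ((Equiv.Perm.sign σ) • ∏ i, G (σ i) i)
      = (Equiv.Perm.sign σ) • D (∏ i, G (σ i) i) := by
    rcases Int.units_eq_one_or (Equiv.Perm.sign σ) with h | h <;> simp [h]
  rw [this, derivation_prod]
  congr 1
  refine Finset.sum_congr rfl fun i _ => ?_
  rw [← Finset.mul_prod_erase Finset.univ _ (Finset.mem_univ i), Matrix.updateCol_self]
  congr 1
  exact Finset.prod_congr rfl fun j hj => by rw [Matrix.updateCol_ne (Finset.ne_of_mem_erase hj)]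

/-- The derivative of a square root of the determinant. -/
lemma derivation_sqrt_det (D : Derivation ℝ A A) {G Q : Matrix ι ι A} (hQ : Q * G = 1)
    {r s : A} (hr : r * r = G.det) (hrs : r * s = 1) :
    (2 : ℝ) • D r = r * (Q * G.map D).trace := by
  have hadj : G.adjugate = G.det • Q := by
    have h' : G * Q = 1 := mul_eq_one_comm.mp hQ
    calc G.adjugate = G.adjugate * (G * Q) := by rw [h', mul_one]
      _ = _ := by rw [← mul_assoc, Matrix.adjugate_mul, smul_mul_assoc, one_mul]
  have h := derivation_det D G
  rw [hadj, smul_mul_assoc, Matrix.trace_smul, ← hr, Derivation.leibniz] at h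
  simp only [smul_eq_mul] at h
  -- Jacobi's formula reads 2r·Dr = r²·tr(Q·DG); one factor r is cancelled with its inverse s, since
  -- the ring need not be a field.
  have h2 : s * (r * D r + r * D r) = s * (r * r * (Q * G.map D).trace) := by rw [h]
  rw [two_smul]
  linear_combination h2 + (r * (Q * G.map D).trace - D r - D r) * hrs

end

/-! ### The Levi-Civita connection in a differential algebra -/

section Christoffel

variable {ι A : Type*} [Fintype ι] [DecidableEq ι] [CommRing A] [Algebra ℝ A]
  (d : ι → Derivation ℝ A A)

/-- The Christoffel symbols of the metric `G` with inverse `Q`, as matrices `(Γᵢ)ᵏⱼ = Γᵏᵢⱼ`. -/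
def chr (G Q : Matrix ι ι A) (i : ι) : Matrix ι ι A :=
  Matrix.of fun k j => (1 / 2 : ℝ) • ∑ l, Q k l * (d i (G j l) + d j (G i l) - d l (G i j))

/-- The curvature `∂ᵢΓⱼ - ∂ⱼΓᵢ + [Γᵢ, Γⱼ]` of a connection. -/
def curv (Γ : ι → Matrix ι ι A) (i j : ι) : Matrix ι ι A :=
  (Γ j).map (d i) - (Γ i).map (d j) + Γ i * Γ j - Γ j * Γ i

/-- The Ricci tensor of a connection. -/
def ricci (Γ : ι → Matrix ι ι A) : Matrix ι ι A :=
  Matrix.of fun i j => ∑ k, curv d Γ k j k i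

/-- The Laplace operator with density `r` (with inverse `s`) and inverse metric `Q`. -/
def lap (r s : A) (Q : Matrix ι ι A) (f : A) : A :=
  s * ∑ i, d i (r * ∑ j, Q i j * d j f)

variable {d}

lemma chr_symm {G Q : Matrix ι ι A} (hG : Gᵀ = G) (i j k : ι) :
    chr d G Q i k j = chr d G Q j k i := by
  have h : ∀ a b, G a b = G b a := fun a b => congrFun (congrFun hG b) a
  simp only [chr, Matrix.of_apply]
  congr 1
  exact Finset.sum_congr rfl fun l _ => by rw [h i j]; ring

/-- Lowering the upper index removes the inverse metric and leaves the Christoffel symbols of the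
first kind. -/
lemma mul_chr {G Q : Matrix ι ι A} (hQ : Q * G = 1) (i k j : ι) :
    (G * chr d G Q i) k j = (1 / 2 : ℝ) • (d i (G j k) + d j (G i k) - d k (G i j)) := by
  have hQ' : G * Q = 1 := mul_eq_one_comm.mp hQ
  have : chr d G Q i = (1 / 2 : ℝ) • (Q * Matrix.of fun l j =>
      (d i (G j l) + d j (G i l) - d l (G i j))) := by
    ext a b; simp [chr, Matrix.mul_apply]
  rw [this, mul_smul_comm, ← mul_assoc, hQ', one_mul]
  simp

/-- The Christoffel symbols are compatible with the metric. -/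
lemma chr_compat {G Q : Matrix ι ι A} (hG : Gᵀ = G) (hQ : Q * G = 1) (i : ι) :
    G.map (d i) = (chr d G Q i)ᵀ * G + G * chr d G Q i := by
  have h : ∀ a b, G a b = G b a := fun a b => congrFun (congrFun hG b) a
  have h1 : (chr d G Q i)ᵀ * G = (G * chr d G Q i)ᵀ := by rw [Matrix.transpose_mul, hG]
  ext a b
  rw [h1, Matrix.add_apply, Matrix.transpose_apply, mul_chr hQ, mul_chr hQ, ← smul_add,
    Matrix.map_apply, h b a, h i a, h i b]
  have : (d i (G a b) + d a (G b i) - d b (G a i) + (d i (G a b) + d b (G a i) - d a (G b i)))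
    = (2 : ℝ) • d i (G a b) := by rw [two_smul]; ring
  rw [this, smul_smul]
  norm_num

/-- The Christoffel symbols are the only symmetric symbols compatible with the metric. -/
lemma eq_chr {G Q : Matrix ι ι A} (hG : Gᵀ = G) (hQ : Q * G = 1) {Γ : ι → Matrix ι ι A}
    (hs : ∀ i j k, Γ i k j = Γ j k i) (hc : ∀ i, G.map (d i) = (Γ i)ᵀ * G + G * Γ i) :
    Γ = chr d G Q := by
  have h : ∀ a b, G a b = G b a := fun a b => congrFun (congrFun hG b) a
  have key : ∀ i a b, d i (G a b) = (G * Γ i) b a + (G * Γ i) a b := by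
    intro i a b
    have := congrFun (congrFun (hc i) a) b
    have h1 : (Γ i)ᵀ * G = (G * Γ i)ᵀ := by rw [Matrix.transpose_mul, hG]
    rwa [h1] at this
  have hs' : ∀ i j k, (G * Γ i) k j = (G * Γ j) k i := by
    intro i j k
    simp only [Matrix.mul_apply, hs i j]
  funext i
  -- Koszul's argument: compatibility expresses the three derivatives of G by lowered symbols, and
  -- symmetry in the lower indices cancels all of them except twice the wanted one.
  have : G * Γ i = G * chr d G Q i := by
    ext k j
    rw [mul_chr hQ, key, key, key, hs' j i k, hs' k j i, hs' k i j]
    have : ((G * Γ i) k j + (G * Γ i) j k + ((G * Γ i) k j + (G * Γ j) i k)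
        - ((G * Γ i) j k + (G * Γ j) i k)) = (2 : ℝ) • (G * Γ i) k j := by rw [two_smul]; ring
    rw [this, smul_smul]
    norm_num
  calc Γ i = Q * (G * Γ i) := by rw [← mul_assoc, hQ, one_mul]
    _ = chr d G Q i := by rw [this, ← mul_assoc, hQ, one_mul]

end Christoffel

/-- A metric in a differential algebra with commuting derivations, with its inverse, a square root
of its determinant and the inverse of this square root. -/
structure IsMetric {ι A : Type*} [Fintype ι] [DecidableEq ι] [CommRing A] [Algebra ℝ A]
    (d : ι → Derivation ℝ A A) (G Q : Matrix ι ι A) (r s : A) : Prop where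
  comm : ∀ i j a, d i (d j a) = d j (d i a)
  symm : Gᵀ = G
  inv_mul : Q * G = 1
  sq : r * r = G.det
  mul_inv : r * s = 1

namespace IsMetric

variable {ι A : Type*} [Fintype ι] [DecidableEq ι] [CommRing A] [Algebra ℝ A]
  {d : ι → Derivation ℝ A A} {G Q : Matrix ι ι A} {r s : A}

lemma mul_inv' (h : IsMetric d G Q r s) : G * Q = 1 := mul_eq_one_comm.mp h.inv_mul

lemma inv_symm (h : IsMetric d G Q r s) : Qᵀ = Q := by
  have : Qᵀ * G = 1 := by
    rw [← Matrix.transpose_one, ← h.mul_inv', Matrix.transpose_mul, h.symm]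
  calc Qᵀ = Qᵀ * (G * Q) := by rw [h.mul_inv', mul_one]
    _ = Q := by rw [← mul_assoc, this, one_mul]

/-- The inverse metric is parallel. This lets an index be raised under a covariant derivative in the
identities below. -/
lemma deriv_inv (h : IsMetric d G Q r s) (i : ι) :
    Q.map (d i) = -(chr d G Q i * Q + Q * (chr d G Q i)ᵀ) := by
  rw [map_derivation_inv _ h.inv_mul, chr_compat h.symm h.inv_mul]
  congr 1
  rw [mul_add, add_mul, ← mul_assoc Q G, h.inv_mul, one_mul, mul_assoc, mul_assoc, h.mul_inv',
    mul_one, add_comm]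

lemma trace_chr (h : IsMetric d G Q r s) (i : ι) :
    (Q * G.map (d i)).trace = (2 : ℝ) • (chr d G Q i).trace := by
  rw [chr_compat h.symm h.inv_mul, mul_add, Matrix.trace_add, ← mul_assoc Q G, h.inv_mul, one_mul,
    Matrix.trace_mul_comm, mul_assoc, h.mul_inv', mul_one, Matrix.trace_transpose, two_smul]

/-- The trace of the connection form is the logarithmic derivative of the volume density, which
makes divergences with respect to the density covariant. -/
lemma deriv_sqrt (h : IsMetric d G Q r s) (i : ι) : d i r = r * (chr d G Q i).trace := by
  have := derivation_sqrt_det (d i) h.inv_mul h.sq h.mul_inv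
  rw [h.trace_chr, mul_smul_comm] at this
  have h2 := congrArg (fun z => (1 / 2 : ℝ) • z) this
  simpa [smul_smul] using h2

/-- The Laplace operator as the trace of the Hessian. -/
lemma lap_eq (h : IsMetric d G Q r s) (f : A) :
    lap d r s Q f = ∑ i, ∑ j, Q i j * (d i (d j f) - ∑ k, chr d G Q i k j * d k f) := by
  set Γ := chr d G Q with hΓ
  have hs : ∀ i j k, Γ i k j = Γ j k i := chr_symm h.symm
  have hQ : ∀ i a b, d i (Q a b) = -(∑ c, Γ i a c * Q c b + ∑ c, Q a c * Γ i b c) := by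
    intro i a b
    have := congrFun (congrFun (h.deriv_inv i) a) b
    simpa [Matrix.mul_apply] using this
  have hexp : ∀ i, d i (r * ∑ j, Q i j * d j f) = r * (∑ j, (Γ i).trace * (Q i j * d j f)
      + ∑ j, Q i j * d i (d j f) - ∑ j, ∑ c, Γ i i c * Q c j * d j f
      - ∑ j, ∑ c, Q i c * Γ i j c * d j f) := by
    intro i
    rw [Derivation.leibniz, h.deriv_sqrt]
    have e : d i (∑ j, Q i j * d j f) = ∑ j, Q i j * d i (d j f) - ∑ j, ∑ c, Γ i i c * Q c j * d j f
        - ∑ j, ∑ c, Q i c * Γ i j c * d j f := by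
      rw [map_sum, ← Finset.sum_sub_distrib, ← Finset.sum_sub_distrib]
      refine Finset.sum_congr rfl fun j _ => ?_
      rw [Derivation.leibniz, hQ, ← Finset.sum_mul, ← Finset.sum_mul, smul_eq_mul, smul_eq_mul]
      ring
    rw [e, ← Finset.mul_sum, smul_eq_mul, smul_eq_mul]
    ring
  rw [lap, Finset.sum_congr rfl fun i _ => hexp i, ← Finset.mul_sum, ← mul_assoc, mul_comm s r,
    h.mul_inv, one_mul]
  simp only [Finset.sum_sub_distrib, Finset.sum_add_distrib, mul_sub, Finset.mul_sum]
  -- The trace coming from the density cancels one of the two terms coming from the derivative of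
  -- the inverse metric, by symmetry of the lower indices; the other term is the correction in the
  -- Hessian.
  have e1 : ∑ i, ∑ j, (Γ i).trace * (Q i j * d j f)
      = ∑ i, ∑ j, ∑ c, Γ i i c * Q c j * d j f := by
    simp only [Matrix.trace, Matrix.diag_apply, Finset.sum_mul]
    rw [Finset.sum_comm_cycle]
    refine Finset.sum_congr rfl fun i _ => ?_
    rw [Finset.sum_comm]
    refine Finset.sum_congr rfl fun j _ => Finset.sum_congr rfl fun k _ => ?_
    rw [hs k i i]
    ring
  have e2 : ∑ i, ∑ j, ∑ c, Q i c * Γ i j c * d j f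
      = ∑ i, ∑ j, ∑ k, Q i j * (Γ i k j * d k f) := by
    refine Finset.sum_congr rfl fun i _ => ?_
    rw [Finset.sum_comm]
    simp only [mul_assoc]
  rw [e1, e2]
  ring

end IsMetric

end DiffAlg

/-! ### Symmetries of the curvature and Bianchi identities -/

namespace DiffAlg

open Matrix

namespace IsMetric

variable {ι A : Type*} [Fintype ι] [DecidableEq ι] [CommRing A] [Algebra ℝ A]
  {d : ι → Derivation ℝ A A} {G Q : Matrix ι ι A} {r s : A}

lemma map_comm {d : ι → Derivation ℝ A A} (hd : ∀ i j a, d i (d j a) = d j (d i a))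
    (M : Matrix ι ι A) (i j : ι) : (M.map (d j)).map (d i) = (M.map (d i)).map (d j) := by
  ext a b; exact hd i j _

/-- The second Bianchi identity. -/
lemma bianchi (hd : ∀ i j a, d i (d j a) = d j (d i a)) (Γ : ι → Matrix ι ι A) (m i j : ι) :
    ((curv d Γ i j).map (d m) + Γ m * curv d Γ i j - curv d Γ i j * Γ m)
      + ((curv d Γ j m).map (d i) + Γ i * curv d Γ j m - curv d Γ j m * Γ i)
      + ((curv d Γ m i).map (d j) + Γ j * curv d Γ m i - curv d Γ m i * Γ j) = 0 := by
  simp only [curv, map_derivation_add, map_derivation_sub, map_derivation_mul]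
  rw [map_comm hd (Γ j) m i, map_comm hd (Γ i) m j, map_comm hd (Γ m) i j]
  noncomm_ring

lemma curv_swap (Γ : ι → Matrix ι ι A) (i j : ι) : curv d Γ i j = -curv d Γ j i := by
  simp only [curv]; abel

/-- The curvature of the Levi-Civita connection is skew with respect to the metric. -/
lemma curv_skew (h : IsMetric d G Q r s) (i j : ι) :
    curv d (chr d G Q) i j * Q + Q * (curv d (chr d G Q) i j)ᵀ = 0 := by
  set Γ := chr d G Q with hΓ
  have hc : ∀ i, G.map (d i) = (Γ i)ᵀ * G + G * Γ i := chr_compat h.symm h.inv_mul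
  -- Expanding ∂ᵢ∂ⱼG = ∂ⱼ∂ᵢG by metric compatibility, the first-order terms cancel and what is left
  -- is the symmetric part of the lowered curvature.
  have h1 := map_comm h.comm G i j
  rw [hc, hc] at h1
  simp only [map_derivation_add, map_derivation_mul, map_derivation_transpose, hc] at h1
  have h2 : (curv d Γ i j)ᵀ * G + G * curv d Γ i j = 0 := by
    simp only [curv, Matrix.transpose_add, Matrix.transpose_sub, Matrix.transpose_mul]
    rw [← sub_eq_zero] at h1
    rw [← h1]
    noncomm_ring
  have h3 : Q * ((curv d Γ i j)ᵀ * G + G * curv d Γ i j) * Q = 0 := by rw [h2]; simp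
  rw [mul_add, add_mul, mul_assoc Q, mul_assoc _ G Q, h.mul_inv', mul_one, ← mul_assoc Q G,
    h.inv_mul, one_mul] at h3
  rw [add_comm]; exact h3

/-- The Ricci tensor with its first index raised. -/
lemma inv_mul_ricci (h : IsMetric d G Q r s) (a m : ι) :
    (Q * ricci d (chr d G Q)) a m = ∑ k, (curv d (chr d G Q) k m * Q) k a := by
  have hQ : ∀ a b, Q a b = Q b a := fun a b => congrFun (congrFun h.inv_symm b) a
  simp only [Matrix.mul_apply, ricci, Matrix.of_apply, Finset.mul_sum]
  rw [Finset.sum_comm]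
  exact Finset.sum_congr rfl fun k _ => Finset.sum_congr rfl fun l _ => by rw [hQ a l, mul_comm]

lemma sum_skew_mul_symm (x y : ι → ι → A) (hx : ∀ i j, x i j = -x j i)
    (hy : ∀ i j, y i j = y j i) : ∑ i, ∑ j, x i j * y i j = 0 := by
  have h1 : ∑ i, ∑ j, x i j * y i j = -∑ i, ∑ j, x i j * y i j := by
    conv_lhs => rw [Finset.sum_comm]
    simp only [← Finset.sum_neg_distrib]
    refine Finset.sum_congr rfl fun i _ => Finset.sum_congr rfl fun j _ => ?_
    rw [hx, hy]; ring
  have h2 : (2 : ℝ) • ∑ i, ∑ j, x i j * y i j = 0 := by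
    rw [two_smul]; nth_rewrite 1 [h1]; simp
  have := congrArg (fun z => (1 / 2 : ℝ) • z) h2
  simpa [smul_smul] using this

/-- The contracted second Bianchi identity. -/
lemma contracted_bianchi (h : IsMetric d G Q r s) (m : ι) :
    d m (Q * ricci d (chr d G Q)).trace
      + 2 * ∑ i, ∑ a, chr d G Q m i a * (Q * ricci d (chr d G Q)) a i
    = 2 * (∑ i, d i ((Q * ricci d (chr d G Q)) i m)
      + ∑ i, ∑ a, chr d G Q i i a * (Q * ricci d (chr d G Q)) a m) := by
  set P := Q * ricci d (chr d G Q) with hP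
  have hPS : ∀ a m, P a m = ∑ k, (curv d (chr d G Q) k m * Q) k a := h.inv_mul_ricci
  set Γ := chr d G Q with hΓ
  have hs : ∀ i j k, Γ i k j = Γ j k i := chr_symm h.symm
  -- S is the curvature with its last index raised. It is skew in the form indices and in the matrix
  -- indices, and its contraction is the raised Ricci tensor P.
  set S : ι → ι → Matrix ι ι A := fun i j => curv d Γ i j * Q with hS
  have hS1 : ∀ i j a b, S i j a b = -S j i a b := by
    intro i j a b
    simp only [hS]
    rw [curv_swap Γ i j, neg_mul]; rfl
  have hS2 : ∀ i j a b, S i j a b = -S i j b a := by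
    intro i j a b
    have h1 := h.curv_skew i j
    have h2 : Q * (curv d Γ i j)ᵀ = (S i j)ᵀ := by rw [hS, Matrix.transpose_mul, h.inv_symm]
    rw [h2] at h1
    exact eq_neg_of_add_eq_zero_left (congrFun (congrFun h1 a) b)
  have hP' : ∀ a m, P a m = ∑ k, S k m k a := hPS
  -- Because Q is parallel, multiplying the second Bianchi identity by Q replaces the commutators by
  -- the covariant derivatives of S.
  have hB : ∀ m i j, ((S i j).map (d m) + Γ m * S i j + S i j * (Γ m)ᵀ)
      + ((S j m).map (d i) + Γ i * S j m + S j m * (Γ i)ᵀ)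
      + ((S m i).map (d j) + Γ j * S m i + S m i * (Γ j)ᵀ) = 0 := by
    intro m i j
    have h1 := congrArg (fun M => M * Q) (bianchi h.comm Γ m i j)
    simp only [zero_mul] at h1
    rw [← h1]
    simp only [hS, map_derivation_mul, h.deriv_inv]
    noncomm_ring
  -- Contract the form indices i, j with the matrix indices. The first cyclic term gives ∇ₘR and
  -- each of the other two gives minus the divergence of P.
  have key : ∑ i, ∑ j, (((S i j).map (d m) + Γ m * S i j + S i j * (Γ m)ᵀ) i j
      + ((S j m).map (d i) + Γ i * S j m + S j m * (Γ i)ᵀ) i j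
      + ((S m i).map (d j) + Γ j * S m i + S m i * (Γ j)ᵀ) i j) = 0 := by
    refine Finset.sum_eq_zero fun i _ => Finset.sum_eq_zero fun j _ => ?_
    exact congrFun (congrFun (hB m i j) i) j
  simp only [Matrix.add_apply, Matrix.map_apply, Matrix.mul_apply, Matrix.transpose_apply,
    Finset.sum_add_distrib] at key
  have a1 : ∑ i, ∑ j, d m (S i j i j) = d m P.trace := by
    simp only [Matrix.trace, Matrix.diag_apply, map_sum, hP']
    rw [Finset.sum_comm]
  have a2 : ∑ i, ∑ j, ∑ a, Γ m i a * S i j a j = ∑ i, ∑ a, Γ m i a * P a i := by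
    refine Finset.sum_congr rfl fun i _ => ?_
    rw [Finset.sum_comm]
    refine Finset.sum_congr rfl fun a _ => ?_
    rw [hP', Finset.mul_sum]
    exact Finset.sum_congr rfl fun j _ => by rw [hS1 i j, hS2 j i]; ring
  have a3 : ∑ i, ∑ j, ∑ a, S i j i a * Γ m j a = ∑ i, ∑ a, Γ m i a * P a i := by
    rw [Finset.sum_comm]
    refine Finset.sum_congr rfl fun i _ => ?_
    rw [Finset.sum_comm]
    refine Finset.sum_congr rfl fun a _ => ?_
    rw [hP', Finset.mul_sum]
    exact Finset.sum_congr rfl fun j _ => by ring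
  have b1 : ∑ i, ∑ j, d i (S j m i j) = -∑ i, d i (P i m) := by
    simp only [hP', map_sum, ← Finset.sum_neg_distrib]
    exact Finset.sum_congr rfl fun i _ => Finset.sum_congr rfl fun j _ => by rw [hS2, map_neg]
  have b2 : ∑ i, ∑ j, ∑ a, Γ i i a * S j m a j = -∑ i, ∑ a, Γ i i a * P a m := by
    simp only [hP', ← Finset.sum_neg_distrib]
    refine Finset.sum_congr rfl fun i _ => ?_
    rw [Finset.sum_comm]
    refine Finset.sum_congr rfl fun a _ => ?_
    rw [Finset.mul_sum, ← Finset.sum_neg_distrib]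
    exact Finset.sum_congr rfl fun j _ => by rw [hS2]; ring
  have b3 : ∑ i, ∑ j, ∑ a, S j m i a * Γ i j a = 0 := by
    rw [Finset.sum_comm]
    exact Finset.sum_eq_zero fun j _ =>
      sum_skew_mul_symm _ _ (fun i a => hS2 j m i a) (fun i a => hs i a j)
  have c1 : ∑ i, ∑ j, d j (S m i i j) = -∑ i, d i (P i m) := by
    rw [Finset.sum_comm]
    simp only [hP', map_sum, ← Finset.sum_neg_distrib]
    exact Finset.sum_congr rfl fun i _ => Finset.sum_congr rfl fun j _ => by rw [hS1, map_neg]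
  have c2 : ∑ i, ∑ j, ∑ a, Γ j i a * S m i a j = 0 := by
    refine Finset.sum_eq_zero fun i _ => ?_
    have := sum_skew_mul_symm (fun j a => S m i a j) (fun j a => Γ j i a)
      (fun j a => hS2 m i a j) (fun j a => hs j a i)
    rw [← this]
    exact Finset.sum_congr rfl fun i _ => Finset.sum_congr rfl fun j _ => mul_comm _ _
  have c3 : ∑ i, ∑ j, ∑ a, S m i i a * Γ j j a = -∑ i, ∑ a, Γ i i a * P a m := by
    rw [Finset.sum_comm]
    simp only [hP', ← Finset.sum_neg_distrib]
    refine Finset.sum_congr rfl fun i _ => ?_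
    rw [Finset.sum_comm]
    refine Finset.sum_congr rfl fun a _ => ?_
    rw [Finset.mul_sum, ← Finset.sum_neg_distrib]
    exact Finset.sum_congr rfl fun j _ => by rw [hS1]; ring
  rw [a1, a2, a3, b1, b2, b3, c1, c2, c3] at key
  linear_combination key

end IsMetric

end DiffAlg

/-! ### Variation of the connection and of the scalar curvature under the Ricci flow -/

namespace DiffAlg

open Matrix

namespace IsMetric

variable {ι A : Type*} [Fintype ι] [DecidableEq ι] [CommRing A] [Algebra ℝ A]
  {d : ι → Derivation ℝ A A} {G Q : Matrix ι ι A} {r s : A}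

/-- The symbols `∂ₜΓ` contracted with the metric, when `∂ₜ G = -2 Ric`. -/
lemma trace_evolution (h : IsMetric d G Q r s) {δ : Derivation ℝ A A}
    (hδ : ∀ i a, δ (d i a) = d i (δ a)) (hG : G.map δ = (-2 : ℝ) • ricci d (chr d G Q)) (i : ι) :
    ((chr d G Q i).map δ).trace = -d i (Q * ricci d (chr d G Q)).trace := by
  set R := (Q * ricci d (chr d G Q)).trace with hR
  have hr : δ r = -(R * r) := by
    have := derivation_sqrt_det δ h.inv_mul h.sq h.mul_inv
    rw [hG, mul_smul_comm, Matrix.trace_smul, ← hR] at this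
    have h2 := congrArg (fun z => (1 / 2 : ℝ) • z) this
    simp only [smul_smul, mul_smul_comm] at h2
    norm_num at h2
    rw [h2, mul_comm]
  -- Compute ∂ₜ∂ᵢr = ∂ᵢ∂ₜr for the density r, where ∂ᵢr = r·tr Γᵢ and ∂ₜr = -Rr. Cancelling r gives
  -- the claim without a formula for ∂ₜΓ.
  have h1 := hδ i r
  rw [h.deriv_sqrt, hr, Derivation.leibniz, map_neg, Derivation.leibniz, hr, h.deriv_sqrt] at h1
  have h2 : δ (chr d G Q i).trace = ((chr d G Q i).map δ).trace := by
    simp [Matrix.trace, map_sum]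
  rw [h2] at h1
  simp only [smul_eq_mul] at h1
  have h3 := congrArg (fun z => s * z) h1
  linear_combination h3 - (((chr d G Q i).map δ).trace + d i R) * h.mul_inv

/-- For a general variation of the metric with ∂ₜG = k, this contraction of ∂ₜΓ is the divergence of
k minus half the gradient of its trace. For k = -2 Ric it is -2 div Ric + ∇R, which vanishes by the
contracted Bianchi identity. -/
lemma contracted_evolution (h : IsMetric d G Q r s) {δ : Derivation ℝ A A}
    (hδ : ∀ i a, δ (d i a) = d i (δ a)) (hG : G.map δ = (-2 : ℝ) • ricci d (chr d G Q)) (m : ι) :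
    ∑ i, ∑ j, Q i j * ((chr d G Q i).map δ) m j = 0 := by
  have htr := h.trace_evolution hδ hG
  have hcb := h.contracted_bianchi
  set P := Q * ricci d (chr d G Q) with hP
  set Γ := chr d G Q with hΓ
  have hs : ∀ i j k, Γ i k j = Γ j k i := chr_symm h.symm
  have hQs : ∀ a b, Q a b = Q b a := fun a b => congrFun (congrFun h.inv_symm b) a
  have hc : ∀ i, G.map (d i) = (Γ i)ᵀ * G + G * Γ i := chr_compat h.symm h.inv_mul
  set C : ι → Matrix ι ι A := fun i => (Γ i).map δ with hC
  have hCs : ∀ i j k, C i k j = C j k i := fun i j k => congrArg δ (hs i j k)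
  have hh : G.map δ = (-2 : ℝ) • (G * P) := by
    rw [hG, hP, ← mul_assoc, h.mul_inv', one_mul]
  -- Differentiating metric compatibility in time expresses the symmetrized lowered ∂ₜΓ through the
  -- covariant derivative of P.
  have hN : ∀ i, (C i)ᵀ * G + G * C i = (-2 : ℝ) • (G * (P.map (d i) + Γ i * P - P * Γ i)) := by
    intro i
    have h1 : (G.map (d i)).map δ = (G.map δ).map (d i) := by ext a b; exact hδ i _
    have h2 : ((-2 : ℝ) • (G * P)).map (d i) = (-2 : ℝ) • (G * P).map (d i) := by
      ext a b; simp
    have hGP : (G * P)ᵀ = G * P := by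
      have h3 : (-2 : ℝ) • (G * P)ᵀ = (-2 : ℝ) • (G * P) := by
        rw [← Matrix.transpose_smul, ← hh, ← map_derivation_transpose, h.symm]
      exact (smul_right_injective _ (by norm_num : (-2 : ℝ) ≠ 0)) h3
    rw [hc, hh, h2] at h1
    simp only [map_derivation_add, map_derivation_mul, map_derivation_transpose, hc, hh] at h1
    have h4 : (C i)ᵀ * G + G * C i = (-2 : ℝ) • (((Γ i)ᵀ * G + G * Γ i) * P + G * P.map (d i))
        - ((Γ i)ᵀ * (-2 : ℝ) • (G * P) + (-2 : ℝ) • (G * P) * Γ i) := by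
      rw [← h1]; simp only [hC]; abel
    rw [h4]
    simp only [mul_smul_comm, smul_mul_assoc, ← smul_add, ← smul_sub]
    congr 1
    noncomm_ring
  have hQN : ∀ i, Q * ((C i)ᵀ * G + G * C i) = (-2 : ℝ) • (P.map (d i) + Γ i * P - P * Γ i) := by
    intro i
    rw [hN, mul_smul_comm, ← mul_assoc, h.inv_mul, one_mul]
  -- lower the index
  have hlow : ∀ l, ∑ k, G l k * ∑ i, ∑ j, Q i j * C i k j = 0 := by
    intro l
    -- Of the two contractions, this one is the lowered vector to be shown zero, and the next is tr
    -- ∂ₜΓ, known from `trace_evolution`.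
    have h1 : ∑ i, (Q * ((C i)ᵀ * G)) i l = ∑ k, G l k * ∑ i, ∑ j, Q i j * C i k j := by
      have hGs : ∀ a b, G a b = G b a := fun a b => congrFun (congrFun h.symm b) a
      simp only [Matrix.mul_apply, Matrix.transpose_apply, Finset.mul_sum]
      rw [Finset.sum_comm_cycle]
      refine Finset.sum_congr rfl fun k _ => ?_
      refine Finset.sum_congr rfl fun i _ => Finset.sum_congr rfl fun j _ => ?_
      rw [hGs l k]; ring
    have h2 : ∑ i, (Q * (G * C i)) i l = (C l).trace := by
      simp only [← mul_assoc, h.inv_mul, one_mul, Matrix.trace, Matrix.diag_apply]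
      exact Finset.sum_congr rfl fun i _ => hCs i l i
    have h3 : ∑ i, (Q * ((C i)ᵀ * G + G * C i)) i l
        = (-2 : ℝ) • (∑ i, d i (P i l) + ∑ i, ∑ a, Γ i i a * P a l
          - ∑ i, ∑ a, Γ l i a * P a i) := by
      rw [Finset.sum_congr rfl fun i _ => congrFun (congrFun (hQN i) i) l]
      simp only [Matrix.smul_apply, Matrix.add_apply, Matrix.sub_apply, Matrix.map_apply,
        Matrix.mul_apply, ← Finset.smul_sum, Finset.sum_sub_distrib, Finset.sum_add_distrib]
      congr 2
      rw [Finset.sum_comm]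
      refine Finset.sum_congr rfl fun i _ => Finset.sum_congr rfl fun a _ => ?_
      rw [hs a l i]; ring
    have h4 := hcb l
    simp only [mul_add, Matrix.add_apply, Finset.sum_add_distrib] at h3
    rw [h1, h2, htr l, neg_smul, two_smul] at h3
    linear_combination h3 + h4
  have hv : G *ᵥ (fun k => ∑ i, ∑ j, Q i j * C i k j) = 0 := by
    funext l; exact hlow l
  have hv2 : (fun k => ∑ i, ∑ j, Q i j * C i k j) = 0 := by
    rw [← Matrix.one_mulVec (fun k => ∑ i, ∑ j, Q i j * C i k j), ← h.inv_mul,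
      ← Matrix.mulVec_mulVec, hv, Matrix.mulVec_zero]
  exact congrFun hv2 m

/-- The variation of the Ricci tensor, contracted with the metric, is a divergence. -/
lemma trace_variation_ricci (h : IsMetric d G Q r s) {δ : Derivation ℝ A A}
    (hδ : ∀ i a, δ (d i a) = d i (δ a)) :
    (Q * (ricci d (chr d G Q)).map δ).trace
      = (∑ k, d k (∑ i, ∑ j, Q i j * ((chr d G Q i).map δ) k j)
          + ∑ k, (chr d G Q k).trace * ∑ i, ∑ j, Q i j * ((chr d G Q i).map δ) k j)
        - (∑ j, d j (∑ a, Q j a * ((chr d G Q a).map δ).trace)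
          + ∑ j, (chr d G Q j).trace * ∑ a, Q j a * ((chr d G Q a).map δ).trace) := by
  set Γ := chr d G Q with hΓ
  have hs : ∀ i j k, Γ i k j = Γ j k i := chr_symm h.symm
  have hQs : ∀ a b, Q a b = Q b a := fun a b => congrFun (congrFun h.inv_symm b) a
  set C : ι → Matrix ι ι A := fun i => (Γ i).map δ with hC
  have hCs : ∀ i j k, C i k j = C j k i := fun i j k => congrArg δ (hs i j k)
  set B : ι → Matrix ι ι A := fun i => C i * Q with hB
  -- Palatini's identity: the variation of the curvature is the antisymmetrized covariant derivative
  -- of the tensor ∂ₜΓ; the parallel Q raises an index.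
  have hcurv : ∀ k j, (curv d Γ k j).map δ * Q
      = ((B j).map (d k) + Γ k * B j + B j * (Γ k)ᵀ)
        - ((B k).map (d j) + Γ j * B k + B k * (Γ j)ᵀ) := by
    intro k j
    have hm : ∀ i k, ((Γ i).map (d k)).map δ = (C i).map (d k) := by
      intro i k; ext a b; exact hδ k _
    simp only [curv, map_derivation_add, map_derivation_sub, map_derivation_mul, hm, hB,
      h.deriv_inv]
    simp only [hC]
    noncomm_ring
  have h1 : (Q * (ricci d Γ).map δ).trace = ∑ k, ∑ j, ((curv d Γ k j).map δ * Q) k j := by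
    simp only [Matrix.trace, Matrix.diag_apply, Matrix.mul_apply, Matrix.map_apply, ricci,
      Matrix.of_apply, map_sum, Finset.mul_sum]
    rw [Finset.sum_comm_cycle]
    refine Finset.sum_congr rfl fun k _ => Finset.sum_congr rfl fun j _ =>
      Finset.sum_congr rfl fun l _ => ?_
    rw [hQs j l]; ring
  have hV : ∀ k, ∑ j, B j k j = ∑ i, ∑ j, Q i j * ((Γ i).map δ) k j := by
    intro k
    change _ = ∑ i, ∑ j, Q i j * C i k j
    simp only [hB, Matrix.mul_apply]
    exact Finset.sum_congr rfl fun i _ => Finset.sum_congr rfl fun j _ => by rw [hQs i j]; ring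
  have hU : ∀ j, ∑ k, B k k j = ∑ a, Q j a * ((Γ a).map δ).trace := by
    intro j
    change _ = ∑ a, Q j a * (C a).trace
    simp only [hB, Matrix.mul_apply, Matrix.trace, Matrix.diag_apply, Finset.mul_sum]
    rw [Finset.sum_comm]
    refine Finset.sum_congr rfl fun a _ => Finset.sum_congr rfl fun k _ => ?_
    rw [hCs k a k, hQs j a]; ring
  have hT : ∀ a, ∑ k, Γ k k a = (Γ a).trace := by
    intro a
    exact Finset.sum_congr rfl fun k _ => hs k a k
  rw [h1, Finset.sum_congr rfl fun k _ => Finset.sum_congr rfl fun j _ =>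
    congrFun (congrFun (hcurv k j) k) j]
  simp only [← hV, ← hU]
  simp only [Matrix.sub_apply, Matrix.add_apply, Matrix.map_apply, Matrix.mul_apply,
    Matrix.transpose_apply, Finset.sum_sub_distrib, Finset.sum_add_distrib]
  have e1 : ∑ k, ∑ j, ∑ a, Γ k k a * B j a j = ∑ k, (Γ k).trace * ∑ j, B j k j := by
    simp only [← hT, Finset.sum_mul, Finset.mul_sum]
    rw [Finset.sum_comm_cycle]
    exact Finset.sum_congr rfl fun _ _ => Finset.sum_comm
  have e2 : ∑ k, ∑ j, ∑ a, B k k a * Γ j j a = ∑ k, (Γ k).trace * ∑ j, B j j k := by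
    simp only [← hT, Finset.sum_mul, Finset.mul_sum]
    rw [Finset.sum_comm_cycle]
    exact Finset.sum_congr rfl fun _ _ => Finset.sum_congr rfl fun _ _ =>
      Finset.sum_congr rfl fun _ _ => mul_comm _ _
  -- These are the connection terms that do not complete a divergence; by symmetry of Γ the two of
  -- them are equal and occur with opposite signs.
  have e3 : ∑ k, ∑ j, ∑ a, B j k a * Γ k j a = ∑ k, ∑ j, ∑ a, Γ j k a * B k a j := by
    rw [Finset.sum_comm_cycle]
    rw [Finset.sum_comm_cycle]
    refine Finset.sum_congr rfl fun k _ => ?_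
    refine Finset.sum_congr rfl fun j _ => Finset.sum_congr rfl fun a _ => ?_
    rw [hs j a k]; ring
  rw [e1, e2, e3]
  simp only [map_sum]
  rw [Finset.sum_comm (f := fun k j => d j (B k k j))]
  ring

/-- The evolution of the scalar curvature under the Ricci flow. -/
theorem scalar_evolution (h : IsMetric d G Q r s) {δ : Derivation ℝ A A}
    (hδ : ∀ i a, δ (d i a) = d i (δ a)) (hG : G.map δ = (-2 : ℝ) • ricci d (chr d G Q)) :
    δ (Q * ricci d (chr d G Q)).trace
      = lap d r s Q (Q * ricci d (chr d G Q)).trace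
        + (2 : ℝ) • (Q * ricci d (chr d G Q) * Q * ricci d (chr d G Q)).trace := by
  have hvar := h.trace_variation_ricci hδ
  -- Of the two divergences, the first is that of the zero field and the second that of -∇R, so
  -- ∂ₜRic contributes ΔR. The derivative of the inverse metric contributes 2|Ric|².
  simp only [h.contracted_evolution hδ hG, h.trace_evolution hδ hG, map_zero, mul_zero,
    Finset.sum_const_zero, add_zero, zero_sub] at hvar
  set Ric := ricci d (chr d G Q) with hRic
  set R := (Q * Ric).trace with hR
  have h1 : δ R = ((Q * Ric).map δ).trace := by simp [hR, Matrix.trace, map_sum]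
  have hlap : lap d r s Q R = ∑ j, d j (∑ a, Q j a * d a R)
      + ∑ j, (chr d G Q j).trace * ∑ a, Q j a * d a R := by
    rw [lap, ← Finset.sum_add_distrib, Finset.mul_sum]
    refine Finset.sum_congr rfl fun i _ => ?_
    rw [Derivation.leibniz, h.deriv_sqrt]
    simp only [smul_eq_mul]
    linear_combination (d i (∑ j, Q i j * d j R)
      + (∑ j, Q i j * d j R) * (chr d G Q i).trace) * h.mul_inv
  rw [h1, map_derivation_mul, Matrix.trace_add, map_derivation_inv δ h.inv_mul, hG, hvar, hlap]
  simp only [mul_neg, Finset.sum_neg_distrib, map_neg, mul_smul_comm, neg_smul, neg_mul, neg_neg]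
  rw [Matrix.smul_mul, Matrix.smul_mul, Matrix.trace_smul]
  ring

end IsMetric

end DiffAlg

/-! ### Change of coordinates: Christoffel symbols, Ricci tensor and Laplacian -/

namespace DiffAlg

open Matrix

variable {ι A : Type*} [Fintype ι] [DecidableEq ι] [CommRing A] [Algebra ℝ A]

/-- A change of coordinates in a differential algebra: two families of derivations related by an
invertible Jacobian `J a i = ∂ᵢφᵃ`. -/
structure IsChange (d D : ι → Derivation ℝ A A) (J K : Matrix ι ι A) : Prop where
  chain : ∀ i f, d i f = ∑ a, J a i * D a f
  symm : ∀ a i j, d i (J a j) = d j (J a i)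
  inv_mul : K * J = 1

namespace IsChange

variable {d D : ι → Derivation ℝ A A} {J K : Matrix ι ι A}

lemma mul_inv (h : IsChange d D J K) : J * K = 1 := mul_eq_one_comm.mp h.inv_mul

/-- The connection form in the new coordinates, pulled back. -/
def pullForm (J : Matrix ι ι A) (Γ : ι → Matrix ι ι A) (i : ι) : Matrix ι ι A :=
  ∑ a, J a i • Γ a

/-- The gauge transform of the pulled back connection. -/
def gauge (d : ι → Derivation ℝ A A) (J K : Matrix ι ι A) (Γ : ι → Matrix ι ι A) (i : ι) :
    Matrix ι ι A :=
  K * (J.map (d i) + pullForm J Γ i * J)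

lemma sandwich_apply (X Y Z : Matrix ι ι A) (k l : ι) :
    (X * Y * Z) k l = ∑ c, ∑ e, X k c * Y c e * Z e l := by
  simp only [Matrix.mul_apply, Finset.sum_mul]
  exact Finset.sum_comm

lemma pullForm_mul_apply (Γ : ι → Matrix ι ι A) (i c j : ι) :
    (pullForm J Γ i * J) c j = ∑ a, ∑ b, J a i * J b j * Γ a c b := by
  simp only [pullForm, Finset.sum_mul, Matrix.sum_apply, Matrix.smul_apply,
    Matrix.mul_apply, smul_eq_mul]
  rw [Finset.sum_comm]
  exact Finset.sum_congr rfl fun _ _ => Finset.sum_congr rfl fun _ _ => by ring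

/-- The transformation rule of the Christoffel symbols. -/
lemma chr_eq (h : IsChange d D J K) {G₁ Q₁ G₂ Q₂ : Matrix ι ι A} (hG₂ : G₂ᵀ = G₂)
    (hQ₁ : Q₁ * G₁ = 1) (hQ₂ : Q₂ * G₂ = 1) (hG : G₁ = Jᵀ * G₂ * J) :
    gauge d J K (chr D G₂ Q₂) = chr d G₁ Q₁ := by
  have hG₁ : G₁ᵀ = G₁ := by
    rw [hG]; simp [Matrix.transpose_mul, hG₂, mul_assoc]
  have hs₂ : ∀ i j k, chr D G₂ Q₂ i k j = chr D G₂ Q₂ j k i := chr_symm hG₂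
  set Γ := chr D G₂ Q₂ with hΓ
  -- Uniqueness of the Levi-Civita connection: it suffices that the gauge transform is torsion-free,
  -- by symmetry of ∂J, and compatible with G₁.
  refine eq_chr hG₁ hQ₁ (fun i j k => ?_) (fun i => ?_)
  · rw [gauge, gauge, Matrix.mul_apply, Matrix.mul_apply]
    refine Finset.sum_congr rfl fun c _ => congrArg (K k c * ·) ?_
    rw [Matrix.add_apply, Matrix.add_apply, pullForm_mul_apply, pullForm_mul_apply,
      Matrix.map_apply, Matrix.map_apply, h.symm, Finset.sum_comm]
    congr 1
    exact Finset.sum_congr rfl fun _ _ => Finset.sum_congr rfl fun _ _ => by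
      rw [hs₂]; ring
  · have hm : G₂.map (d i) = (pullForm J Γ i)ᵀ * G₂ + G₂ * pullForm J Γ i := by
      have h1 : G₂.map (d i) = ∑ a, J a i • G₂.map (D a) := by
        ext a b; simp [h.chain, Matrix.sum_apply]
      rw [h1]
      simp only [pullForm, Matrix.transpose_sum, Finset.sum_mul, Finset.mul_sum,
        ← Finset.sum_add_distrib, Matrix.transpose_smul, smul_mul_assoc, mul_smul_comm, ← smul_add]
      exact Finset.sum_congr rfl fun a _ => by rw [hΓ, chr_compat hG₂ hQ₂]
    have h2 : G₁ * gauge d J K Γ i = Jᵀ * G₂ * (J.map (d i) + pullForm J Γ i * J) := by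
      rw [hG, gauge, ← mul_assoc, mul_assoc (Jᵀ * G₂), h.mul_inv, mul_one]
    have h3 : (gauge d J K Γ i)ᵀ * G₁ = (J.map (d i) + pullForm J Γ i * J)ᵀ * G₂ * J := by
      have := congrArg Matrix.transpose h2
      rw [Matrix.transpose_mul, hG₁] at this
      rw [this, Matrix.transpose_mul, Matrix.transpose_mul, hG₂, Matrix.transpose_transpose,
        mul_assoc]
    rw [h2, h3, hG, map_derivation_mul, map_derivation_mul, hm, map_derivation_transpose,
      Matrix.transpose_add, Matrix.transpose_mul]
    noncomm_ring

/-- Curvature is a 2-form and commutes with pull-back of the connection form: the terms containing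
∂J are symmetric in i and j and drop out. -/
lemma curv_pullForm (h : IsChange d D J K) (Γ : ι → Matrix ι ι A) (i j : ι) :
    curv d (pullForm J Γ) i j = ∑ a, ∑ b, (J a i * J b j) • curv D Γ a b := by
  have hd : ∀ i j, (pullForm J Γ j).map (d i)
      = ∑ b, d i (J b j) • Γ b + ∑ b, ∑ a, (J a i * J b j) • (Γ b).map (D a) := by
    intro i j
    ext x y
    simp only [pullForm, Matrix.map_apply, Matrix.sum_apply, Matrix.smul_apply, smul_eq_mul,
      map_sum, Derivation.leibniz, Matrix.add_apply, ← Finset.sum_add_distrib]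
    refine Finset.sum_congr rfl fun b _ => ?_
    rw [h.chain i (Γ b x y), Finset.mul_sum, add_comm, mul_comm (Γ b x y)]
    congr 1
    exact Finset.sum_congr rfl fun a _ => by ring
  have hmul : ∀ i j, pullForm J Γ i * pullForm J Γ j
      = ∑ a, ∑ b, (J a i * J b j) • (Γ a * Γ b) := by
    intro i j
    simp only [pullForm, Finset.sum_mul, Finset.mul_sum, smul_mul_assoc, mul_smul_comm, smul_smul,
      Finset.smul_sum]
    rw [Finset.sum_comm]
    exact Finset.sum_congr rfl fun b _ => Finset.sum_congr rfl fun a _ => by rw [mul_comm (J b i)]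
  simp only [curv, hd, hmul, smul_add, smul_sub, Finset.sum_add_distrib, Finset.sum_sub_distrib]
  rw [Finset.sum_congr rfl fun b _ => by rw [h.symm b i j]]
  rw [Finset.sum_comm (f := fun b a => (J a i * J b j) • (Γ b).map (D a))]
  rw [Finset.sum_comm (f := fun a b => (J a j * J b i) • (Γ a * Γ b))]
  simp only [mul_comm (J _ j) (J _ i)]
  abel

/-- Gauge covariance of the curvature. The inhomogeneous part K·∂J of the gauge transform is flat,
because the derivations commute, so only conjugation remains. -/
lemma curv_gauge (h : IsChange d D J K) (hd : ∀ i j a, d i (d j a) = d j (d i a))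
    (Γ : ι → Matrix ι ι A) (i j : ι) :
    curv d (gauge d J K Γ) i j = K * curv d (pullForm J Γ) i j * J := by
  set Θ := pullForm J Γ with hΘ
  have hK : ∀ i, K.map (d i) = -(K * J.map (d i) * K) := fun i =>
    map_derivation_inv (d i) h.inv_mul
  have hJJ : (J.map (d j)).map (d i) = (J.map (d i)).map (d j) := by ext a b; exact hd i j _
  have hc : ∀ X : Matrix ι ι A, J * (K * X) = X := fun X => by
    rw [← mul_assoc, h.mul_inv, one_mul]
  simp only [curv, gauge, ← hΘ, map_derivation_mul, map_derivation_add, hK, hJJ]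
  simp only [mul_add, add_mul, mul_sub, sub_mul, neg_mul, mul_assoc, hc]
  abel

/-- The Ricci tensor is a tensor. -/
theorem ricci_eq (h : IsChange d D J K) (hd : ∀ i j a, d i (d j a) = d j (d i a))
    {G₁ Q₁ G₂ Q₂ : Matrix ι ι A} (hG₂ : G₂ᵀ = G₂)
    (hQ₁ : Q₁ * G₁ = 1) (hQ₂ : Q₂ * G₂ = 1) (hG : G₁ = Jᵀ * G₂ * J) :
    ricci d (chr d G₁ Q₁) = Jᵀ * ricci D (chr D G₂ Q₂) * J := by
  rw [← h.chr_eq hG₂ hQ₁ hQ₂ hG]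
  set Γ := chr D G₂ Q₂ with hΓ
  -- In the contraction that defines the Ricci tensor, the Jacobian of the form index meets its
  -- inverse from the conjugation and they cancel.
  have htr : ∀ (Z : ι → Matrix ι ι A) (l : ι),
      ∑ k, (K * ∑ a, J a k • Z a) k l = ∑ a, Z a a l := by
    intro Z l
    have hJK : ∀ a c, ∑ k, J a k * K k c = if a = c then 1 else 0 := fun a c => by
      have := congrFun (congrFun h.mul_inv a) c
      rwa [Matrix.mul_apply, Matrix.one_apply] at this
    simp only [Matrix.mul_apply, Matrix.sum_apply, Matrix.smul_apply, smul_eq_mul, Finset.mul_sum]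
    rw [Finset.sum_comm_cycle]
    refine Finset.sum_congr rfl fun a _ => ?_
    rw [Finset.sum_comm]
    have : ∀ c, ∑ k, K k c * (J a k * Z a c l) = (if a = c then 1 else 0) * Z a c l := by
      intro c
      rw [← hJK, Finset.sum_mul]
      exact Finset.sum_congr rfl fun k _ => by ring
    rw [Finset.sum_congr rfl fun c _ => this c]
    simp
  ext l j
  have h1 : ∀ k, K * (∑ a, ∑ b, (J a k * J b j) • curv D Γ a b) * J
      = K * ∑ a, J a k • ((∑ b, J b j • curv D Γ a b) * J) := by
    intro k
    simp only [mul_assoc, Finset.sum_mul, Finset.smul_sum, smul_smul, smul_mul_assoc]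
  simp only [ricci, Matrix.of_apply, h.curv_gauge hd, h.curv_pullForm]
  rw [Finset.sum_congr rfl fun k _ => congrFun (congrFun (h1 k) k) l, htr, sandwich_apply]
  simp only [Matrix.mul_apply, Matrix.sum_apply, Matrix.smul_apply, smul_eq_mul, Matrix.of_apply,
    Finset.sum_mul, Finset.mul_sum, Matrix.transpose_apply]
  rw [Finset.sum_comm]
  refine Finset.sum_congr rfl fun e _ => ?_
  rw [Finset.sum_comm]
  exact Finset.sum_congr rfl fun b _ => Finset.sum_congr rfl fun a _ => by ring

/-- The Laplace operator does not depend on the coordinates. -/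
theorem lap_eq (h : IsChange d D J K) {G₁ Q₁ G₂ Q₂ : Matrix ι ι A} {r₁ s₁ r₂ s₂ : A}
    (h₁ : IsMetric d G₁ Q₁ r₁ s₁) (h₂ : IsMetric D G₂ Q₂ r₂ s₂) (hG : G₁ = Jᵀ * G₂ * J) (f : A) :
    lap d r₁ s₁ Q₁ f = lap D r₂ s₂ Q₂ f := by
  rw [h₁.lap_eq, h₂.lap_eq, ← h.chr_eq h₂.symm h₁.inv_mul h₂.inv_mul hG]
  set Γ := chr D G₂ Q₂ with hΓ
  -- The covariant Hessian is a tensor: the term ∂J in the second derivatives is absorbed by the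
  -- inhomogeneous part of the connection. The Laplacian is its trace.
  have hess : ∀ i j, d i (d j f) - ∑ k, gauge d J K Γ i k j * d k f
      = ∑ a, ∑ b, J a i * J b j * (D a (D b f) - ∑ c, Γ a c b * D c f) := by
    intro i j
    have e1 : d i (d j f) = ∑ b, d i (J b j) * D b f + ∑ a, ∑ b, J a i * J b j * D a (D b f) := by
      rw [h.chain j f, map_sum, Finset.sum_comm, ← Finset.sum_add_distrib]
      refine Finset.sum_congr rfl fun b _ => ?_
      rw [Derivation.leibniz, h.chain i (D b f), smul_eq_mul, smul_eq_mul, Finset.mul_sum, add_comm,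
        mul_comm (D b f)]
      congr 1
      exact Finset.sum_congr rfl fun a _ => by ring
    have e2 : ∑ k, gauge d J K Γ i k j * d k f
        = ∑ c, (J.map (d i) + pullForm J Γ i * J) c j * D c f := by
      have : J * gauge d J K Γ i = J.map (d i) + pullForm J Γ i * J := by
        rw [gauge, ← mul_assoc, h.mul_inv, one_mul]
      rw [← this]
      generalize gauge d J K Γ i = X
      simp only [Matrix.mul_apply, h.chain _ f, Finset.mul_sum, Finset.sum_mul]
      rw [Finset.sum_comm]
      exact Finset.sum_congr rfl fun _ _ => Finset.sum_congr rfl fun _ _ => by ring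
    rw [e1, e2]
    simp only [Matrix.add_apply, pullForm_mul_apply, Matrix.map_apply, add_mul,
      Finset.sum_add_distrib, mul_sub, Finset.sum_sub_distrib, Finset.mul_sum, Finset.sum_mul]
    rw [add_sub_add_left_eq_sub, ← Finset.sum_comm_cycle (f := fun a b c => _)]
    congr 1
    refine Finset.sum_congr rfl fun a _ => Finset.sum_congr rfl fun b _ =>
      Finset.sum_congr rfl fun c _ => ?_
    ring
  have hQ : Q₂ = J * Q₁ * Jᵀ := by
    have h3 : J * Q₁ * Jᵀ * G₂ = 1 := by
      have h4 : Q₁ * (Jᵀ * G₂ * J) = 1 := by rw [← hG, h₁.inv_mul]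
      have h5 : Q₁ * (Jᵀ * G₂) = K := by
        calc Q₁ * (Jᵀ * G₂) = Q₁ * (Jᵀ * G₂ * J) * K := by
              rw [mul_assoc Q₁, mul_assoc _ J, h.mul_inv, mul_one]
          _ = K := by rw [h4, one_mul]
      rw [mul_assoc, mul_assoc, h5, h.mul_inv]
    calc Q₂ = J * Q₁ * Jᵀ * G₂ * Q₂ := by rw [h3, one_mul]
      _ = _ := by rw [mul_assoc, h₂.mul_inv', mul_one]
  simp only [hess, hQ, sandwich_apply, Finset.mul_sum, Finset.sum_mul, Matrix.transpose_apply]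
  generalize hX : (fun a b => D a (D b f) - ∑ c, Γ a c b * D c f) = X
  have hX' : ∀ a b, D a (D b f) - ∑ c, Γ a c b * D c f = X a b := fun a b => by rw [← hX]
  simp only [hX']
  rw [Finset.sum_congr rfl fun i _ => Finset.sum_comm_cycle,
    Finset.sum_congr rfl fun i _ => Finset.sum_comm_cycle, Finset.sum_comm_cycle,
    Finset.sum_comm_cycle]
  exact Finset.sum_congr rfl fun a _ => Finset.sum_congr rfl fun b _ =>
    Finset.sum_congr rfl fun i _ => Finset.sum_congr rfl fun j _ => by ring

end IsChange

end DiffAlg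

namespace DiffAlg

open Matrix

/-! ### Naturality of curvature and Laplacian under algebra homomorphisms -/

section Hom

variable {ι A B : Type*} [Fintype ι] [DecidableEq ι] [CommRing A] [Algebra ℝ A] [CommRing B]
  [Algebra ℝ B] {d : ι → Derivation ℝ A A} {e : ι → Derivation ℝ B B} (ψ : A →ₐ[ℝ] B)
  (hψ : ∀ i a, ψ (d i a) = e i (ψ a))

include hψ in
lemma chr_hom (G Q : Matrix ι ι A) (i k j : ι) :
    ψ (chr d G Q i k j) = chr e (G.map ψ) (Q.map ψ) i k j := by
  simp [chr, hψ]

include hψ in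
lemma ricci_hom (Γ : ι → Matrix ι ι A) (i j : ι) :
    ψ (ricci d Γ i j) = ricci e (fun i => (Γ i).map ψ) i j := by
  simp [ricci, curv, hψ, Matrix.mul_apply]

include hψ in
lemma ricci_chr_hom (G Q : Matrix ι ι A) (i j : ι) :
    ψ (ricci d (chr d G Q) i j) = ricci e (chr e (G.map ψ) (Q.map ψ)) i j := by
  rw [ricci_hom ψ hψ]
  congr 2
  funext i; ext k j
  exact chr_hom ψ hψ G Q i k j

include hψ in
lemma lap_hom (r s : A) (Q : Matrix ι ι A) (f : A) :
    ψ (lap d r s Q f) = lap e (ψ r) (ψ s) (Q.map ψ) (ψ f) := by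
  simp [lap, hψ]

end Hom

/-! ### The algebra of smooth functions on a set with unique derivatives -/

section SmoothAlg

variable {E F : Type*} [NormedAddCommGroup E] [NormedSpace ℝ E]
  [NormedAddCommGroup F] [NormedSpace ℝ F]

/-- The algebra of functions on `S` which are restrictions of functions smooth within `S`. -/
def smoothAlg (S : Set E) : Subalgebra ℝ (S → ℝ) where
  carrier := {f | ∃ φ : E → ℝ, ContDiffOn ℝ ∞ φ S ∧ ∀ x : S, f x = φ x}
  mul_mem' := by
    rintro f g ⟨φ, hφ, hf⟩ ⟨ψ, hψ, hg⟩
    exact ⟨fun x => φ x * ψ x, hφ.mul hψ, fun x => by simp [hf, hg]⟩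
  add_mem' := by
    rintro f g ⟨φ, hφ, hf⟩ ⟨ψ, hψ, hg⟩
    exact ⟨fun x => φ x + ψ x, hφ.add hψ, fun x => by simp [hf, hg]⟩
  algebraMap_mem' c := ⟨fun _ => c, contDiffOn_const, fun _ => rfl⟩

namespace smoothAlg

variable {S : Set E}

/-- A representative of an element of `smoothAlg S`. -/
def rep (f : smoothAlg S) : E → ℝ := f.2.choose

lemma contDiffOn_rep (f : smoothAlg S) : ContDiffOn ℝ ∞ (rep f) S := f.2.choose_spec.1

lemma apply_eq_rep (f : smoothAlg S) (x : S) : f.1 x = rep f x := f.2.choose_spec.2 x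

/-- The element of `smoothAlg S` given by a smooth function. -/
def mk (φ : E → ℝ) (hφ : ContDiffOn ℝ ∞ φ S) : smoothAlg S := ⟨fun x => φ x, φ, hφ, fun _ => rfl⟩

lemma ext {f g : smoothAlg S} (h : ∀ x, f.1 x = g.1 x) : f = g := Subtype.ext (funext h)

/-- Evaluation at a point of `S`. -/
def ev (x : S) : smoothAlg S →ₐ[ℝ] ℝ := (Pi.evalAlgHom ℝ (fun _ : S => ℝ) x).comp (smoothAlg S).val

lemma ev_apply (x : S) (f : smoothAlg S) : ev x f = f.1 x := rfl

lemma contDiffOn_of_eq (f : smoothAlg S) {φ : E → ℝ} (h : ∀ x : S, f.1 x = φ x) :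
    ContDiffOn ℝ ∞ φ S :=
  (contDiffOn_rep f).congr fun x hx => by rw [← h ⟨x, hx⟩, apply_eq_rep]

/-- A derivative within S sees only the values on S, so the arbitrary choice made in `rep` does not
affect the derivations. -/
lemma fderivWithin_rep (f : smoothAlg S) {φ : E → ℝ} (h : ∀ x : S, f.1 x = φ x) (x : S) :
    fderivWithin ℝ (rep f) S x = fderivWithin ℝ φ S x :=
  fderivWithin_congr (fun y hy => by rw [← h ⟨y, hy⟩, apply_eq_rep])
    (by rw [← h x, apply_eq_rep])

lemma differentiableWithinAt_rep (f : smoothAlg S) (x : S) :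
    DifferentiableWithinAt ℝ (rep f) S x :=
  (contDiffOn_rep f).differentiableOn (by simp) x x.2

/-- The directional derivative, as a derivation of `smoothAlg S`. -/
def der (hS : UniqueDiffOn ℝ S) (v : E) : Derivation ℝ (smoothAlg S) (smoothAlg S) :=
  Derivation.mk'
    { toFun := fun f => mk (fun x => fderivWithin ℝ (rep f) S x v)
        (((contDiffOn_rep f).fderivWithin hS (m := ∞) (by simp)).clm_apply contDiffOn_const)
      map_add' := fun f g => by
        refine ext fun x => ?_
        change fderivWithin ℝ (rep (f + g)) S x v
          = fderivWithin ℝ (rep f) S x v + fderivWithin ℝ (rep g) S x v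
        rw [fderivWithin_rep (f + g) (φ := fun y => rep f y + rep g y)
          (fun y => by rw [← apply_eq_rep f, ← apply_eq_rep g]; rfl), fderivWithin_fun_add
          (hS x x.2) (differentiableWithinAt_rep f x) (differentiableWithinAt_rep g x)]
        rfl
      map_smul' := fun c f => by
        refine ext fun x => ?_
        change fderivWithin ℝ (rep (c • f)) S x v = c • fderivWithin ℝ (rep f) S x v
        rw [fderivWithin_rep (c • f) (φ := fun y => c • rep f y)
          (fun y => by rw [← apply_eq_rep f]; rfl), fderivWithin_fun_const_smul
          (hS x x.2) (differentiableWithinAt_rep f x)]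
        rfl }
    (fun f g => by
      refine ext fun x => ?_
      change fderivWithin ℝ (rep (f * g)) S x v
        = f.1 x * fderivWithin ℝ (rep g) S x v + g.1 x * fderivWithin ℝ (rep f) S x v
      rw [fderivWithin_rep (f * g) (φ := fun y => rep f y * rep g y)
          (fun y => by rw [← apply_eq_rep f, ← apply_eq_rep g]; rfl), fderivWithin_fun_mul
          (hS x x.2) (differentiableWithinAt_rep f x) (differentiableWithinAt_rep g x),
          apply_eq_rep f, apply_eq_rep g]
      rfl)

lemma der_apply (hS : UniqueDiffOn ℝ S) (v : E) (f : smoothAlg S) {φ : E → ℝ}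
    (h : ∀ x : S, f.1 x = φ x) (x : S) : (der hS v f).1 x = fderivWithin ℝ φ S x v := by
  rw [← fderivWithin_rep f h]; rfl

/-- Second derivatives within S are symmetric also at boundary points, as limits from the interior;
hence the closure assumption. -/
lemma der_comm (hS : UniqueDiffOn ℝ S) (hS' : S ⊆ closure (interior S)) (v w : E)
    (f : smoothAlg S) : der hS v (der hS w f) = der hS w (der hS v f) := by
  refine ext fun x => ?_
  have key : ∀ v w, (der hS v (der hS w f)).1 x
      = fderivWithin ℝ (fderivWithin ℝ (rep f) S) S x v w := by
    intro v w
    rw [der_apply hS v (der hS w f) (φ := fun y => fderivWithin ℝ (rep f) S y w)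
      (fun y => rfl) x]
    have hd : DifferentiableWithinAt ℝ (fderivWithin ℝ (rep f) S) S x :=
      ((contDiffOn_rep f).fderivWithin hS (m := ∞) (by simp)).differentiableOn (by simp) x x.2
    rw [fderivWithin_clm_apply (hS x x.2) hd (differentiableWithinAt_const w)]
    simp
  have hsymm : IsSymmSndFDerivWithinAt ℝ (rep f) S x :=
    (contDiffOn_rep f x x.2).isSymmSndFDerivWithinAt
      (by rw [minSmoothness_of_isRCLikeNormedField]; exact WithTop.coe_le_coe.mpr (le_top : (2 : ℕ∞) ≤ ⊤)) hS (hS' x.2) x.2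
  rw [key, key, hsymm]

lemma exists_sqrt (f : smoothAlg S) (hf : ∀ x, 0 < f.1 x) :
    ∃ r s : smoothAlg S, r * r = f ∧ r * s = 1 ∧ ∀ x, r.1 x = √(f.1 x) := by
  have hne : ∀ x ∈ S, rep f x ≠ 0 := fun x hx => by
    rw [← apply_eq_rep f ⟨x, hx⟩]; exact (hf _).ne'
  have hr : ContDiffOn ℝ ∞ (fun x => √(rep f x)) S := (contDiffOn_rep f).sqrt hne
  have hs : ContDiffOn ℝ ∞ (fun x => (√(rep f x))⁻¹) S := hr.inv fun x hx => by
    have := hf ⟨x, hx⟩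
    rw [apply_eq_rep] at this
    exact (Real.sqrt_pos.mpr this).ne'
  refine ⟨mk _ hr, mk _ hs, ext fun x => ?_, ext fun x => ?_, fun x => ?_⟩
  · change √(rep f x) * √(rep f x) = f.1 x
    rw [← apply_eq_rep, Real.mul_self_sqrt (hf x).le]
  · change √(rep f x) * (√(rep f x))⁻¹ = 1
    rw [← apply_eq_rep f x]
    exact mul_inv_cancel₀ (Real.sqrt_pos.mpr (hf x)).ne'
  · rw [apply_eq_rep f]; rfl

/-- Composition with a smooth map, as a homomorphism of algebras. -/
def pull {S' : Set F} (φ : E → F) (hφ : ContDiffOn ℝ ∞ φ S) (hm : MapsTo φ S S') :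
    smoothAlg S' →ₐ[ℝ] smoothAlg S where
  toFun f := ⟨fun x => f.1 ⟨φ x, hm x.2⟩, fun x => rep f (φ x), (contDiffOn_rep f).comp hφ hm,
    fun _ => apply_eq_rep f _⟩
  map_one' := rfl
  map_mul' _ _ := rfl
  map_zero' := rfl
  map_add' _ _ := rfl
  commutes' _ := rfl

lemma pull_apply {S' : Set F} (φ : E → F) (hφ : ContDiffOn ℝ ∞ φ S) (hm : MapsTo φ S S')
    (f : smoothAlg S') (x : S) : (pull φ hφ hm f).1 x = f.1 ⟨φ x, hm x.2⟩ := rfl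

lemma der_pull {S' : Set F} (hS : UniqueDiffOn ℝ S) (hS' : UniqueDiffOn ℝ S') (φ : E → F)
    (hφ : ContDiffOn ℝ ∞ φ S) (hm : MapsTo φ S S') (f : smoothAlg S') (v : E) (x : S) :
    (der hS v (pull φ hφ hm f)).1 x
      = (der hS' (fderivWithin ℝ φ S x v) f).1 ⟨φ x, hm x.2⟩ := by
  rw [der_apply hS v _ (φ := fun x => rep f (φ x)) (fun x => apply_eq_rep f _),
    der_apply hS' _ f (apply_eq_rep f)]
  have h := fderivWithin_comp (x := (x : E)) (g := rep f)
    (differentiableWithinAt_rep f ⟨φ x, hm x.2⟩)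
    (hφ.differentiableOn (by simp) x x.2) hm (hS x x.2)
  change fderivWithin ℝ (rep f ∘ φ) S x v = _
  rw [h]; rfl

end smoothAlg

end SmoothAlg

/-! ### Comparison with the coordinate formulas on the half-space -/

section Coordinates

variable {n : ℕ} [NeZero n]

/-- A relatively open subset of the half-space. -/
structure IsHalfOpen (Ω : Set (Coord n)) : Prop where
  subset : Ω ⊆ range (𝓡∂ n)
  mem_nhds : ∀ y ∈ Ω, Ω ∈ 𝓝[range (𝓡∂ n)] y

namespace IsHalfOpen

variable {Ω : Set (Coord n)} (hΩ : IsHalfOpen Ω)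
include hΩ

lemma nhdsWithin_eq {y : Coord n} (hy : y ∈ Ω) : 𝓝[Ω] y = 𝓝[range (𝓡∂ n)] y :=
  le_antisymm (nhdsWithin_mono _ hΩ.subset) (nhdsWithin_le_iff.mpr (hΩ.mem_nhds y hy))

/-- `pd` differentiates within the whole half-space, the algebra within Ω; relative openness makes
the two agree. -/
lemma fderivWithin_eq {V : Type*} [NormedAddCommGroup V] [NormedSpace ℝ V] (f : Coord n → V)
    {y : Coord n} (hy : y ∈ Ω) :
    fderivWithin ℝ f Ω y = fderivWithin ℝ f (range (𝓡∂ n)) y :=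
  fderivWithin_congr_set ((nhdsWithin_eq_iff_eventuallyEq).mp (hΩ.nhdsWithin_eq hy))

lemma uniqueDiffOn : UniqueDiffOn ℝ Ω := fun y hy =>
  (((𝓡∂ n).uniqueDiffOn y (hΩ.subset hy))).mono_nhds (hΩ.nhdsWithin_eq hy).ge

lemma subset_closure : Ω ⊆ closure (interior Ω) := by
  intro y hy
  have h1 := (𝓡∂ n).range_subset_closure_interior (hΩ.subset hy)
  obtain ⟨U, hU, hyU, hsub⟩ := mem_nhdsWithin.mp (hΩ.mem_nhds y hy)
  rw [mem_closure_iff] at h1 ⊢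
  intro V hV hyV
  obtain ⟨z, ⟨hzV, hzU⟩, hz⟩ := h1 (V ∩ U) (hV.inter hU) ⟨hyV, hyU⟩
  refine ⟨z, hzV, ?_⟩
  exact interior_maximal (fun w hw => hsub ⟨hw.1, interior_subset hw.2⟩)
    (hU.inter isOpen_interior) ⟨hzU, hz⟩

/-- The coordinate derivations. -/
def coordDer (i : Fin n) : Derivation ℝ (smoothAlg Ω) (smoothAlg Ω) :=
  smoothAlg.der hΩ.uniqueDiffOn (basisVec i)

lemma coordDer_apply (i : Fin n) (f : smoothAlg Ω) {φ : Coord n → ℝ}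
    (h : ∀ y : Ω, f.1 y = φ y) (y : Ω) : (hΩ.coordDer i f).1 y = pd i φ y := by
  rw [coordDer, smoothAlg.der_apply _ _ f h, hΩ.fderivWithin_eq φ y.2, pd]

lemma coordDer_comm (i j : Fin n) (f : smoothAlg Ω) :
    hΩ.coordDer i (hΩ.coordDer j f) = hΩ.coordDer j (hΩ.coordDer i f) :=
  smoothAlg.der_comm _ hΩ.subset_closure _ _ f

end IsHalfOpen

/-- A positive definite matrix of smooth functions is a metric in `smoothAlg`. -/
lemma exists_isMetric {E : Type*} [NormedAddCommGroup E] [NormedSpace ℝ E] {S : Set E} {ι : Type*}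
    [Fintype ι] [DecidableEq ι] {d : ι → Derivation ℝ (smoothAlg S) (smoothAlg S)}
    (hd : ∀ i j a, d i (d j a) = d j (d i a)) (G : Matrix ι ι (smoothAlg S)) (hG : Gᵀ = G)
    (hdet : ∀ x, 0 < G.det.1 x) :
    ∃ (Q : Matrix ι ι (smoothAlg S)) (r s : smoothAlg S), IsMetric d G Q r s ∧
      ∀ x, r.1 x = √(G.det.1 x) := by
  obtain ⟨r, s, h1, h2, h3⟩ := smoothAlg.exists_sqrt G.det hdet
  -- The inverse of G is its adjugate divided by det G, and s² = 1 / det G.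
  refine ⟨(s * s) • G.adjugate, r, s, ⟨hd, hG, ?_, h1, h2⟩, h3⟩
  rw [smul_mul_assoc, Matrix.adjugate_mul, smul_smul, ← h1]
  have : s * s * (r * r) = 1 := by
    linear_combination (r * s + 1) * h2
  rw [this, one_smul]

lemma det_apply {E : Type*} [NormedAddCommGroup E] [NormedSpace ℝ E] {S : Set E} {ι : Type*}
    [Fintype ι] [DecidableEq ι] (G : Matrix ι ι (smoothAlg S)) (x : S) :
    G.det.1 x = (G.map (smoothAlg.ev x)).det :=
  (smoothAlg.ev x).toRingHom.map_det G

lemma inv_apply {E : Type*} [NormedAddCommGroup E] [NormedSpace ℝ E] {S : Set E} {ι : Type*}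
    [Fintype ι] [DecidableEq ι] {G Q : Matrix ι ι (smoothAlg S)} (h : Q * G = 1) (x : S) :
    Q.map (smoothAlg.ev x) = (G.map (smoothAlg.ev x))⁻¹ := by
  refine (Matrix.inv_eq_left_inv ?_).symm
  have := congrArg (fun M => M.map (smoothAlg.ev x)) h
  simp only [Matrix.map_mul] at this
  rw [this]
  ext i j
  by_cases hij : i = j <;> simp [Matrix.one_apply, hij]

section Bridge

variable {Ω : Set (Coord n)} (hΩ : IsHalfOpen Ω) {G Q : Matrix (Fin n) (Fin n) (smoothAlg Ω)}
  {r s : smoothAlg Ω} (h : IsMetric hΩ.coordDer G Q r s)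
  {Gc : Coord n → Matrix (Fin n) (Fin n) ℝ} (hGc : ∀ (y : Ω) a b, (G a b).1 y = Gc y a b)
include h hGc

lemma inv_apply_coord (y : Ω) (a b : Fin n) : (Q a b).1 y = (Gc y)⁻¹ a b := by
  have h1 := inv_apply h.inv_mul y
  have h2 : G.map (smoothAlg.ev y) = Gc y := by ext a b; exact hGc y a b
  rw [h2] at h1
  exact congrFun (congrFun h1 a) b

lemma chr_apply_coord (i k j : Fin n) (y : Ω) :
    (chr hΩ.coordDer G Q i k j).1 y = christoffel Gc k i j y := by
  have h1 : ∀ a b c, (hΩ.coordDer a (G b c)).1 y = pd a (fun z => Gc z b c) y := fun a b c =>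
    hΩ.coordDer_apply a (G b c) (fun y => hGc y b c) y
  rw [← smoothAlg.ev_apply, chr, Matrix.of_apply, map_smul, map_sum, christoffel]
  simp only [map_mul, map_sub, map_add, smoothAlg.ev_apply, h1, inv_apply_coord hΩ h hGc, smul_eq_mul]

lemma ricci_apply_coord (i j : Fin n) (y : Ω) :
    (ricci hΩ.coordDer (chr hΩ.coordDer G Q) i j).1 y = ricciCoord Gc i j y := by
  have h1 : ∀ a i k j, (hΩ.coordDer a (chr hΩ.coordDer G Q i k j)).1 y
      = pd a (christoffel Gc k i j) y := fun a i k j =>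
    hΩ.coordDer_apply a _ (fun y => chr_apply_coord hΩ h hGc i k j y) y
  have hs : ∀ i j k, chr hΩ.coordDer G Q i k j = chr hΩ.coordDer G Q j k i := chr_symm h.symm
  rw [← smoothAlg.ev_apply, ricci, Matrix.of_apply, map_sum, ricciCoord]
  refine Finset.sum_congr rfl fun k _ => ?_
  simp only [curv, Matrix.sub_apply, Matrix.add_apply, Matrix.map_apply, Matrix.mul_apply,
    map_add, map_sub, map_sum, map_mul]
  simp only [smoothAlg.ev_apply, Finset.sum_sub_distrib]
  -- The two conventions place the lower indices of Γ in different order; symmetry of Γ reconciles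
  -- them.
  rw [hs j i k, hs k i k, h1, h1]
  simp only [hs _ i, chr_apply_coord hΩ h hGc]
  ring

lemma lap_apply_coord (hr : ∀ y : Ω, r.1 y = √(G.det.1 y)) (f : smoothAlg Ω) {φ : Coord n → ℝ}
    (hf : ∀ y : Ω, f.1 y = φ y) (y : Ω) :
    (lap hΩ.coordDer r s Q f).1 y = laplaceCoord Gc φ y := by
  have hdet : ∀ y : Ω, G.det.1 y = (Gc y).det := by
    intro y
    rw [det_apply]
    congr 1
    ext a b; exact hGc y a b
  have hs : s.1 y = (√(Gc y).det)⁻¹ := by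
    have := congrArg (smoothAlg.ev y) h.mul_inv
    rw [map_mul, map_one, smoothAlg.ev_apply, smoothAlg.ev_apply, hr, hdet] at this
    exact eq_inv_of_mul_eq_one_right this
  rw [← smoothAlg.ev_apply, lap, map_mul, map_sum, laplaceCoord, smoothAlg.ev_apply, hs]
  congr 1
  refine Finset.sum_congr rfl fun i _ => ?_
  rw [smoothAlg.ev_apply]
  refine hΩ.coordDer_apply i _ (fun z => ?_) y
  rw [← smoothAlg.ev_apply, map_mul, map_sum, smoothAlg.ev_apply, hr, hdet]
  congr 1
  refine Finset.sum_congr rfl fun j _ => ?_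
  rw [map_mul, smoothAlg.ev_apply, smoothAlg.ev_apply, inv_apply_coord hΩ h hGc,
    hΩ.coordDer_apply j f hf]

end Bridge

end Coordinates

end DiffAlg

/-! ### The metric as a matrix at each point -/

namespace BoundaryRicci

open DiffAlg

variable {n : ℕ} [NeZero n] {W : Type*} [TopologicalSpace W]
  [ChartedSpace (EuclideanHalfSpace n) W] [IsManifold (𝓡∂ n) ∞ W]

/-- The metric as a bilinear form on `ℝⁿ`. -/
def innerAt (g : RMetric n W) (x : W) (v w : Coord n) : ℝ :=
  g.inner x (v : TangentSpace (𝓡∂ n) x) (w : TangentSpace (𝓡∂ n) x)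

section innerAt

variable (g : RMetric n W) (x : W)

lemma innerAt_symm (v w : Coord n) : innerAt g x v w = innerAt g x w v := g.symm x v w

lemma innerAt_pos {v : Coord n} (hv : v ≠ 0) : 0 < innerAt g x v v := g.pos x v hv

lemma innerAt_sum_left {κ : Type*} (s : Finset κ) (c : κ → ℝ) (v : κ → Coord n) (w : Coord n) :
    innerAt g x (∑ i ∈ s, c i • v i) w = ∑ i ∈ s, c i * innerAt g x (v i) w := by
  have h : ∀ v : Coord n, innerAt g x v w = (g.inner x).flip w v := fun _ => rfl
  rw [h]
  erw [map_sum]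
  refine Finset.sum_congr rfl fun i _ => ?_
  erw [map_smul]
  rfl

lemma innerAt_sum_right {κ : Type*} (s : Finset κ) (c : κ → ℝ) (v : κ → Coord n) (w : Coord n) :
    innerAt g x w (∑ i ∈ s, c i • v i) = ∑ i ∈ s, c i * innerAt g x w (v i) := by
  rw [innerAt_symm, innerAt_sum_left]
  exact Finset.sum_congr rfl fun i _ => by rw [innerAt_symm]

lemma sum_basisVec (v : Coord n) : ∑ i, v i • basisVec i = v := by
  ext j
  simp [basisVec, Finset.sum_apply, Pi.single_apply]

lemma metricMat_apply (i j : Fin n) : metricMat g x i j = innerAt g x (basisVec i) (basisVec j) :=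
  rfl

lemma innerAt_eq_sum (v w : Coord n) :
    innerAt g x v w = ∑ i, ∑ j, v i * w j * metricMat g x i j := by
  conv_lhs => rw [← sum_basisVec v, ← sum_basisVec w]
  rw [innerAt_sum_left]
  refine Finset.sum_congr rfl fun i _ => ?_
  rw [innerAt_sum_right, Finset.mul_sum]
  exact Finset.sum_congr rfl fun j _ => by rw [metricMat_apply]; ring

lemma posDef_gram {V : Fin n → Coord n} (hV : LinearIndependent ℝ V) :
    (Matrix.of fun i j => innerAt g x (V i) (V j)).PosDef := by
  refine Matrix.PosDef.of_dotProduct_mulVec_pos ?_ fun c hc => ?_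
  · ext i j
    simp [innerAt_symm g x (V j)]
  · have h1 : star c ⬝ᵥ (Matrix.of fun i j => innerAt g x (V i) (V j)).mulVec c
        = innerAt g x (∑ i, c i • V i) (∑ i, c i • V i) := by
      rw [innerAt_sum_left]
      simp only [dotProduct, Matrix.mulVec, innerAt_sum_right, Matrix.of_apply]
      refine Finset.sum_congr rfl fun i _ => ?_
      simp only [Pi.star_apply, star_trivial]
      congr 1
      exact Finset.sum_congr rfl fun j _ => mul_comm _ _
    rw [h1]
    refine innerAt_pos g x fun h0 => hc ?_
    funext i
    exact Fintype.linearIndependent_iff.mp hV c h0 i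

lemma linearIndependent_basisVec : LinearIndependent ℝ (basisVec : Fin n → Coord n) := by
  refine Fintype.linearIndependent_iff.mpr fun c hc i => ?_
  have : (∑ i, c i • basisVec i : Coord n) = WithLp.toLp 2 c := sum_basisVec (WithLp.toLp 2 c)
  rw [this] at hc
  have h2 := congrArg (fun v : Coord n => v i) hc
  simpa using h2

lemma metricMat_posDef : (metricMat g x).PosDef := posDef_gram g x linearIndependent_basisVec

lemma metricMat_symm : (metricMat g x).transpose = metricMat g x := by
  ext i j; exact innerAt_symm g x _ _

end innerAt

/-! ### Charts and their Jacobians -/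

section charts

/-- The differential of the inverse of the chart around `x₀`. -/
def chartDeriv (x₀ : W) (y : Coord n) : Coord n →L[ℝ] Coord n :=
  mfderivWithin 𝓘(ℝ, Coord n) (𝓡∂ n) (extChartAt (𝓡∂ n) x₀).symm (range (𝓡∂ n)) y

/-- The matrix of `chartDeriv`. -/
def chartMat (x₀ : W) (y : Coord n) : Matrix (Fin n) (Fin n) ℝ :=
  Matrix.of fun a i => chartDeriv x₀ y (basisVec i) a

/-- The domain of a change of charts. -/
def overlap (x₀ x₁ : W) : Set (Coord n) :=
  ((extChartAt (𝓡∂ n) x₀).symm ≫ extChartAt (𝓡∂ n) x₁).source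

/-- A change of charts. -/
def trans (x₀ x₁ : W) : Coord n → Coord n :=
  extChartAt (𝓡∂ n) x₁ ∘ (extChartAt (𝓡∂ n) x₀).symm

variable (x₀ x₁ : W)

lemma mem_overlap {y : Coord n} : y ∈ overlap x₀ x₁ ↔ y ∈ (extChartAt (𝓡∂ n) x₀).target ∧
    (extChartAt (𝓡∂ n) x₀).symm y ∈ (extChartAt (𝓡∂ n) x₁).source := by
  rw [overlap, PartialEquiv.trans_source, PartialEquiv.symm_source]; rfl

lemma isHalfOpen_target : IsHalfOpen (extChartAt (𝓡∂ n) x₀).target :=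
  ⟨extChartAt_target_subset_range x₀, fun _ hy => extChartAt_target_mem_nhdsWithin_of_mem hy⟩

lemma isHalfOpen_overlap : IsHalfOpen (n := n) (overlap x₀ x₁) := by
  refine ⟨fun y hy => extChartAt_target_subset_range x₀ ((mem_overlap x₀ x₁).mp hy).1,
    fun y hy => ?_⟩
  obtain ⟨h1, h2⟩ := (mem_overlap x₀ x₁).mp hy
  have h3 : (extChartAt (𝓡∂ n) x₀).target ∩ (extChartAt (𝓡∂ n) x₀).symm ⁻¹'
      (extChartAt (𝓡∂ n) x₁).source ∈ 𝓝[(extChartAt (𝓡∂ n) x₀).target] y :=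
    inter_mem self_mem_nhdsWithin
      ((continuousOn_extChartAt_symm x₀ y h1).preimage_mem_nhdsWithin
        ((isOpen_extChartAt_source x₁).mem_nhds h2))
  rw [(isHalfOpen_target x₀).nhdsWithin_eq h1] at h3
  exact Filter.mem_of_superset h3 fun z hz => (mem_overlap x₀ x₁).mpr hz

lemma contDiffOn_trans : ContDiffOn ℝ ∞ (trans x₀ x₁ : Coord n → Coord n) (overlap x₀ x₁) :=
  contDiffOn_ext_coord_change x₁ x₀

lemma trans_mem {y : Coord n} (hy : y ∈ overlap x₀ x₁) :
    trans x₀ x₁ y ∈ (extChartAt (𝓡∂ n) x₁).target :=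
  (extChartAt (𝓡∂ n) x₁).map_source ((mem_overlap x₀ x₁).mp hy).2

lemma symm_trans {y : Coord n} (hy : y ∈ overlap x₀ x₁) :
    (extChartAt (𝓡∂ n) x₁).symm (trans x₀ x₁ y) = (extChartAt (𝓡∂ n) x₀).symm y :=
  (extChartAt (𝓡∂ n) x₁).left_inv ((mem_overlap x₀ x₁).mp hy).2

lemma differentiableWithinAt_trans {y : Coord n} (hy : y ∈ overlap x₀ x₁) :
    DifferentiableWithinAt ℝ (trans x₀ x₁) (range (𝓡∂ n)) y := by
  have := (contDiffOn_trans x₀ x₁).differentiableOn (by simp) y hy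
  exact this.mono_of_mem_nhdsWithin ((isHalfOpen_overlap x₀ x₁).mem_nhds y hy)

lemma chartDeriv_trans {y : Coord n} (hy : y ∈ overlap x₀ x₁) (v : Coord n) :
    chartDeriv x₀ y v = chartDeriv x₁ (trans x₀ x₁ y)
      (fderivWithin ℝ (trans x₀ x₁) (range (𝓡∂ n)) y v) := by
  have heq : (extChartAt (𝓡∂ n) x₀).symm =ᶠ[𝓝[range (𝓡∂ n)] y]
      (extChartAt (𝓡∂ n) x₁).symm ∘ trans x₀ x₁ := by
    filter_upwards [(isHalfOpen_overlap x₀ x₁).mem_nhds y hy] with z hz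
    exact (symm_trans x₀ x₁ hz).symm
  have h1 := heq.mfderivWithin_eq (I := 𝓘(ℝ, Coord n)) (I' := 𝓡∂ n) (symm_trans x₀ x₁ hy).symm
  have hd := (differentiableWithinAt_trans x₀ x₁ hy).mdifferentiableWithinAt
  have h2 := mfderivWithin_comp y (I := 𝓘(ℝ, Coord n)) (I' := 𝓘(ℝ, Coord n)) (I'' := 𝓡∂ n)
    (g := (extChartAt (𝓡∂ n) x₁).symm) (f := trans x₀ x₁) (u := range (𝓡∂ n))
    (s := range (𝓡∂ n))
    (mdifferentiableWithinAt_extChartAt_symm (trans_mem x₀ x₁ hy)) hd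
    (fun z _ => mem_range_self _)
    (((𝓡∂ n).uniqueDiffOn y ((isHalfOpen_overlap x₀ x₁).subset hy)).uniqueMDiffWithinAt)
  rw [chartDeriv, h1]
  erw [h2, mfderivWithin_eq_fderivWithin]
  rfl

/-- Vectors of T_x W are identified with ℝⁿ through the preferred chart at x, so in that chart the
differential is the identity. -/
lemma chartDeriv_self (x : W) (v : Coord n) :
    chartDeriv x (extChartAt (𝓡∂ n) x x) v = v := by
  rw [chartDeriv, mfderivWithin_range_extChartAt_symm]
  rfl

lemma linearIndependent_chartDeriv {y : Coord n} (hy : y ∈ (extChartAt (𝓡∂ n) x₀).target) :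
    LinearIndependent ℝ (fun i => chartDeriv x₀ y (basisVec i)) := by
  have hinv := isInvertible_mfderivWithin_extChartAt_symm (I := 𝓡∂ n) hy
  have hker : LinearMap.ker (chartDeriv x₀ y : Coord n →ₗ[ℝ] Coord n) = ⊥ :=
    LinearMap.ker_eq_bot.mpr hinv.injective
  exact (linearIndependent_basisVec (n := n)).map' (chartDeriv x₀ y : Coord n →ₗ[ℝ] Coord n) hker

variable (g : RMetric n W)

lemma metricCoord_apply (y : Coord n) (i j : Fin n) : metricCoord g x₀ y i j
    = innerAt g ((extChartAt (𝓡∂ n) x₀).symm y) (chartDeriv x₀ y (basisVec i))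
      (chartDeriv x₀ y (basisVec j)) := rfl

lemma metricCoord_posDef {y : Coord n} (hy : y ∈ (extChartAt (𝓡∂ n) x₀).target) :
    (metricCoord g x₀ y).PosDef :=
  posDef_gram g _ (linearIndependent_chartDeriv x₀ hy)

lemma metricCoord_symm (y : Coord n) : (metricCoord g x₀ y).transpose = metricCoord g x₀ y := by
  ext i j
  exact innerAt_symm g _ _ _

lemma metricCoord_self (x : W) : metricCoord g x (extChartAt (𝓡∂ n) x x) = metricMat g x := by
  ext i j
  rw [metricCoord_apply, chartDeriv_self, chartDeriv_self, extChartAt_to_inv, metricMat_apply]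

/-- The frame of the preferred charts jumps from point to point. Congruence with `chartMat` converts
matrices in that frame into expressions in one fixed chart; every comparison below between pointwise
and chart quantities has this form. -/
lemma metricCoord_eq_chartMat (y : Coord n) : metricCoord g x₀ y
    = (chartMat x₀ y).transpose * metricMat g ((extChartAt (𝓡∂ n) x₀).symm y) * chartMat x₀ y := by
  ext i j
  rw [metricCoord_apply, innerAt_eq_sum, IsChange.sandwich_apply]
  exact Finset.sum_congr rfl fun a _ => Finset.sum_congr rfl fun b _ => by
    simp only [chartMat, Matrix.transpose_apply, Matrix.of_apply]; ring

/-- The Jacobian matrix of a change of charts. -/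
def jac (y : Coord n) : Matrix (Fin n) (Fin n) ℝ :=
  Matrix.of fun a i => fderivWithin ℝ (trans x₀ x₁) (range (𝓡∂ n)) y (basisVec i) a

lemma chartMat_trans {y : Coord n} (hy : y ∈ overlap x₀ x₁) :
    chartMat x₀ y = chartMat x₁ (trans x₀ x₁ y) * jac x₀ x₁ y := by
  ext a i
  rw [chartMat, Matrix.of_apply, chartDeriv_trans x₀ x₁ hy, Matrix.mul_apply]
  conv_lhs => rw [← sum_basisVec (fderivWithin ℝ (trans x₀ x₁) (range (𝓡∂ n)) y (basisVec i)),
    map_sum]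
  simp only [map_smul, WithLp.ofLp_sum, Finset.sum_apply, PiLp.smul_apply, smul_eq_mul]
  exact Finset.sum_congr rfl fun b _ => by simp only [chartMat, jac, Matrix.of_apply]; ring

lemma metricCoord_trans {y : Coord n} (hy : y ∈ overlap x₀ x₁) : metricCoord g x₀ y
    = (jac x₀ x₁ y).transpose * metricCoord g x₁ (trans x₀ x₁ y) * jac x₀ x₁ y := by
  rw [metricCoord_eq_chartMat, metricCoord_eq_chartMat, chartMat_trans x₀ x₁ hy, symm_trans x₀ x₁ hy,
    Matrix.transpose_mul]
  simp only [Matrix.mul_assoc]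

lemma chartMat_self (x : W) : chartMat x (extChartAt (𝓡∂ n) x x) = 1 := by
  ext a i
  rw [chartMat, Matrix.of_apply, chartDeriv_self, Matrix.one_apply, basisVec]
  simp

lemma mem_overlap_symm {y : Coord n} (hy : y ∈ (extChartAt (𝓡∂ n) x₀).target) :
    y ∈ overlap x₀ ((extChartAt (𝓡∂ n) x₀).symm y) :=
  (mem_overlap _ _).mpr ⟨hy, mem_extChartAt_source _⟩

/-- The frame change at a point is also the Jacobian of the transition to the preferred chart of
that very point, so the transformation rules for coordinate changes apply to it. -/
lemma chartMat_eq_jac {y : Coord n} (hy : y ∈ (extChartAt (𝓡∂ n) x₀).target) :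
    chartMat x₀ y = jac x₀ ((extChartAt (𝓡∂ n) x₀).symm y) y := by
  rw [chartMat_trans _ _ (mem_overlap_symm x₀ hy)]
  have : trans x₀ ((extChartAt (𝓡∂ n) x₀).symm y) y = extChartAt (𝓡∂ n)
    ((extChartAt (𝓡∂ n) x₀).symm y) ((extChartAt (𝓡∂ n) x₀).symm y) := rfl
  rw [this, chartMat_self, one_mul]

lemma isUnit_chartMat {y : Coord n} (hy : y ∈ (extChartAt (𝓡∂ n) x₀).target) :
    IsUnit (chartMat x₀ y).det := by
  rw [isUnit_iff_ne_zero, Ne, ← Matrix.exists_mulVec_eq_zero_iff]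
  rintro ⟨c, hc, h0⟩
  refine hc (funext fun i => Fintype.linearIndependent_iff.mp
    (linearIndependent_chartDeriv x₀ hy) c ?_ i)
  ext a
  have := congrFun h0 a
  simp only [Matrix.mulVec, dotProduct, chartMat, Matrix.of_apply] at this
  simp only [WithLp.ofLp_sum, Finset.sum_apply, PiLp.smul_apply, smul_eq_mul]
  rw [PiLp.zero_apply, ← Pi.zero_apply (M := fun _ : Fin n => ℝ) a, ← this]
  exact Finset.sum_congr rfl fun i _ => mul_comm _ _

/-- Derivatives in the chart around `x₀`. -/
lemma pd_comp_symm {f : W → ℝ} {y : Coord n} (hy : y ∈ (extChartAt (𝓡∂ n) x₀).target)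
    (hf : MDifferentiableAt (𝓡∂ n) 𝓘(ℝ, ℝ) f ((extChartAt (𝓡∂ n) x₀).symm y)) (i : Fin n) :
    pd i (f ∘ (extChartAt (𝓡∂ n) x₀).symm) y
      = dirDeriv f ((extChartAt (𝓡∂ n) x₀).symm y) (chartDeriv x₀ y (basisVec i)) := by
  have h := mfderiv_comp_mfderivWithin y (I := 𝓘(ℝ, Coord n)) (I' := 𝓡∂ n) (I'' := 𝓘(ℝ, ℝ))
    (g := f) (f := (extChartAt (𝓡∂ n) x₀).symm) (s := range (𝓡∂ n)) hf
    (mdifferentiableWithinAt_extChartAt_symm hy)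
    (((𝓡∂ n).uniqueDiffOn y ((isHalfOpen_target x₀).subset hy)).uniqueMDiffWithinAt)
  rw [pd, ← mfderivWithin_eq_fderivWithin]
  erw [h]
  rfl

lemma dirDeriv_eq_sum (f : W → ℝ) (x : W) (v : Coord n) :
    dirDeriv f x v = ∑ i, v i * dirDeriv f x (basisVec i) := by
  obtain ⟨L, hL⟩ : ∃ L : Coord n →L[ℝ] ℝ, ∀ v, dirDeriv f x v = L v :=
    ⟨mfderiv (𝓡∂ n) 𝓘(ℝ, ℝ) f x, fun _ => rfl⟩
  simp only [hL]
  conv_lhs => rw [← sum_basisVec v, map_sum]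
  exact Finset.sum_congr rfl fun i _ => by rw [map_smul]; rfl

lemma pd_eq_sum {f : W → ℝ} {y : Coord n} (hy : y ∈ (extChartAt (𝓡∂ n) x₀).target)
    (hf : MDifferentiableAt (𝓡∂ n) 𝓘(ℝ, ℝ) f ((extChartAt (𝓡∂ n) x₀).symm y)) (i : Fin n) :
    pd i (f ∘ (extChartAt (𝓡∂ n) x₀).symm) y
      = ∑ a, chartMat x₀ y a i * dirDeriv f ((extChartAt (𝓡∂ n) x₀).symm y) (basisVec a) := by
  rw [pd_comp_symm x₀ hy hf, dirDeriv_eq_sum]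
  rfl

end charts

end BoundaryRicci

/-! ### Coordinate changes between domains in the half-space -/

namespace DiffAlg

open Matrix

section Change

variable {ι A B : Type*} [Fintype ι] [DecidableEq ι] [CommRing A] [Algebra ℝ A] [CommRing B]
  [Algebra ℝ B] {d : ι → Derivation ℝ A A} {e : ι → Derivation ℝ B B} {J K : Matrix ι ι A}

/-- The coordinate derivations of the new coordinates. -/
def newDer (d : ι → Derivation ℝ A A) (K : Matrix ι ι A) (a : ι) : Derivation ℝ A A :=
  ∑ i, K i a • d i

lemma newDer_apply (a : ι) (f : A) : newDer d K a f = ∑ i, K i a * d i f := by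
  rw [newDer, ← Derivation.coeFnAddMonoidHom_apply, map_sum, Finset.sum_apply]
  rfl

/-- The derivations ∂/∂φᵃ are built on the source algebra from the inverse Jacobian, so the map φ
itself never has to be inverted. -/
lemma isChange_newDer (hs : ∀ a i j, d i (J a j) = d j (J a i)) (hK : K * J = 1) :
    IsChange d (newDer d K) J K := by
  refine ⟨fun i f => ?_, hs, hK⟩
  simp only [newDer_apply, Finset.mul_sum]
  rw [Finset.sum_comm]
  have : ∀ k, ∑ a, J a i * (K k a * d k f) = (if k = i then 1 else 0) * d k f := by
    intro k
    have h1 := congrFun (congrFun hK k) i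
    rw [Matrix.mul_apply, Matrix.one_apply] at h1
    rw [← h1, Finset.sum_mul]
    exact Finset.sum_congr rfl fun a _ => by ring
  simp [this]

lemma IsChange.deriv_deriv {D : ι → Derivation ℝ A A} (h : IsChange d D J K) (i j : ι) (f : A) :
    d i (d j f) = ∑ b, d i (J b j) * D b f + ∑ a, ∑ b, J a i * J b j * D a (D b f) := by
  rw [h.chain j f, map_sum, Finset.sum_comm, ← Finset.sum_add_distrib]
  refine Finset.sum_congr rfl fun b _ => ?_
  rw [Derivation.leibniz, h.chain i (D b f), smul_eq_mul, smul_eq_mul, Finset.mul_sum, add_comm,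
    mul_comm (D b f)]
  congr 1
  exact Finset.sum_congr rfl fun a _ => by ring

/-- Expand ∂ᵢ∂ⱼf = ∂ⱼ∂ᵢf in the new derivations. The symmetric terms ∂J cancel, and the invertible
Jacobian can be removed from both sides. -/
lemma IsChange.comm {D : ι → Derivation ℝ A A} (h : IsChange d D J K)
    (hd : ∀ i j a, d i (d j a) = d j (d i a)) (a b : ι) (f : A) :
    D a (D b f) = D b (D a f) := by
  set X : Matrix ι ι A := Matrix.of fun a b => D a (D b f) with hX
  have h1 : Jᵀ * X * J = Jᵀ * Xᵀ * J := by
    ext i j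
    have h2 := hd i j f
    rw [h.deriv_deriv, h.deriv_deriv, Finset.sum_congr rfl fun b _ => by rw [h.symm b i j]] at h2
    have h3 := add_left_cancel h2
    rw [IsChange.sandwich_apply, IsChange.sandwich_apply]
    rw [Finset.sum_comm (f := fun a b => J a j * J b i * D a (D b f))] at h3
    calc _ = ∑ a, ∑ b, J a i * J b j * D a (D b f) := by
          exact Finset.sum_congr rfl fun a _ => Finset.sum_congr rfl fun b _ => by
            simp only [hX, Matrix.transpose_apply, Matrix.of_apply]; ring
      _ = _ := by
          rw [h3]
          exact Finset.sum_congr rfl fun a _ => Finset.sum_congr rfl fun b _ => by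
            simp only [hX, Matrix.transpose_apply, Matrix.of_apply]; ring
  have h4 : ∀ Y : Matrix ι ι A, Kᵀ * (Jᵀ * Y * J) * K = Y := by
    intro Y
    have h5 : Kᵀ * Jᵀ = 1 := by rw [← Matrix.transpose_mul, h.mul_inv, Matrix.transpose_one]
    rw [mul_assoc Jᵀ, ← mul_assoc Kᵀ, h5, one_mul, mul_assoc, h.mul_inv, mul_one]
  have h6 : X = Xᵀ := (h4 X).symm.trans (by rw [h1, h4])
  exact congrFun (congrFun h6 a) b

/-- This is the chain rule solved for the new partial derivatives: pulling back carries coordinate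
derivations of the target to `newDer`. -/
lemma newDer_hom (hK : K * J = 1) (ψ : B →ₐ[ℝ] A)
    (hψ : ∀ i b, d i (ψ b) = ∑ a, J a i * ψ (e a b)) (a : ι) (b : B) :
    ψ (e a b) = newDer d K a (ψ b) := by
  have hJK : J * K = 1 := mul_eq_one_comm.mp hK
  simp only [newDer_apply, hψ, Finset.mul_sum]
  rw [Finset.sum_comm]
  have : ∀ c, ∑ i, K i a * (J c i * ψ (e c b)) = (if c = a then 1 else 0) * ψ (e c b) := by
    intro c
    have h1 := congrFun (congrFun hJK c) a
    rw [Matrix.mul_apply, Matrix.one_apply] at h1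
    rw [← h1, Finset.sum_mul]
    exact Finset.sum_congr rfl fun i _ => by ring
  simp [this]

lemma IsMetric.hom {D : ι → Derivation ℝ A A} {G Q : Matrix ι ι B} {r s : B}
    (h : IsMetric e G Q r s) (ψ : B →ₐ[ℝ] A) (hD : ∀ i j a, D i (D j a) = D j (D i a)) :
    IsMetric D (G.map ψ) (Q.map ψ) (ψ r) (ψ s) := by
  refine ⟨hD, ?_, ?_, ?_, ?_⟩
  · rw [← Matrix.transpose_map, h.symm]
  · rw [← Matrix.map_mul, h.inv_mul, Matrix.map_one _ (map_zero ψ) (map_one ψ)]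
  · rw [← map_mul, h.sq]; exact ψ.toRingHom.map_det G
  · rw [← map_mul, h.mul_inv, map_one]

end Change

section CoordChange

variable {n : ℕ} [NeZero n] {Ω Ω' : Set (Coord n)} (hΩ : IsHalfOpen Ω) (hΩ' : IsHalfOpen Ω')
  {Gc : Coord n → Matrix (Fin n) (Fin n) ℝ} {G : Matrix (Fin n) (Fin n) (smoothAlg Ω)}
  (hG : ∀ (y : Ω) a b, (G a b).1 y = Gc y a b)

/-- A field of symmetric matrices with positive determinant and smooth entries. -/
structure IsMetricField (Ω : Set (Coord n)) (Gc : Coord n → Matrix (Fin n) (Fin n) ℝ) : Prop where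
  smooth : ∀ i j, ContDiffOn ℝ ∞ (fun y => Gc y i j) Ω
  symm : ∀ y ∈ Ω, (Gc y)ᵀ = Gc y
  det_pos : ∀ y ∈ Ω, 0 < (Gc y).det

lemma IsMetricField.exists_isMetric (h : IsMetricField Ω Gc) :
    ∃ (G Q : Matrix (Fin n) (Fin n) (smoothAlg Ω)) (r s : smoothAlg Ω),
      (∀ (y : Ω) a b, (G a b).1 y = Gc y a b) ∧ IsMetric hΩ.coordDer G Q r s ∧
      ∀ y, r.1 y = √(G.det.1 y) := by
  set G : Matrix (Fin n) (Fin n) (smoothAlg Ω) :=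
    Matrix.of fun a b => smoothAlg.mk (fun y => Gc y a b) (h.smooth a b) with hG
  have hGs : Gᵀ = G := by
    ext a b y
    exact congrFun (congrFun (h.symm y y.2) a) b
  have hdet : ∀ y : Ω, 0 < G.det.1 y := by
    intro y
    rw [det_apply]
    exact h.det_pos y y.2
  obtain ⟨Q, r, s, h1, h2⟩ := DiffAlg.exists_isMetric hΩ.coordDer_comm G hGs hdet
  exact ⟨G, Q, r, s, fun y a b => rfl, h1, h2⟩

include hΩ hΩ'

/-- The transformation of the Ricci tensor and the Laplace operator under a change of
coordinates. -/
theorem coordChange {φ : Coord n → Coord n} (hφ : ContDiffOn ℝ ∞ φ Ω) (hm : MapsTo φ Ω Ω')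
    {Gc Gc' : Coord n → Matrix (Fin n) (Fin n) ℝ} (h : IsMetricField Ω Gc)
    (h' : IsMetricField Ω' Gc') {Jc : Coord n → Matrix (Fin n) (Fin n) ℝ}
    (hJ : ∀ y ∈ Ω, ∀ a i, Jc y a i = fderivWithin ℝ φ (range (𝓡∂ n)) y (basisVec i) a)
    (hG : ∀ y ∈ Ω, Gc y = (Jc y)ᵀ * Gc' (φ y) * Jc y) :
    (∀ y ∈ Ω, (Matrix.of fun i j => ricciCoord Gc i j y)
      = (Jc y)ᵀ * (Matrix.of fun i j => ricciCoord Gc' i j (φ y)) * Jc y) ∧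
    (∀ f F : Coord n → ℝ, ContDiffOn ℝ ∞ f Ω' → (∀ y ∈ Ω, F y = f (φ y)) → ∀ y ∈ Ω,
      laplaceCoord Gc F y = laplaceCoord Gc' f (φ y)) := by
  obtain ⟨G₁, Q₁, r₁, s₁, hG₁, hM₁, hr₁⟩ := h.exists_isMetric hΩ
  obtain ⟨G₂, Q₂, r₂, s₂, hG₂, hM₂, hr₂⟩ := h'.exists_isMetric hΩ'
  set ψ := smoothAlg.pull φ hφ hm with hψ
  have hφa : ∀ a, ContDiffOn ℝ ∞ (fun y => φ y a) Ω := fun a =>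
    (EuclideanSpace.proj (𝕜 := ℝ) a).contDiff.comp_contDiffOn hφ
  have hpd : ∀ y ∈ Ω, ∀ a i, pd i (fun y => φ y a) y = Jc y a i := by
    intro y hy a i
    rw [hJ y hy]
    have hd : DifferentiableWithinAt ℝ φ (range (𝓡∂ n)) y :=
      (hφ.differentiableOn (by simp) y hy).mono_of_mem_nhdsWithin (hΩ.mem_nhds y hy)
    have h1 := fderivWithin_comp (x := y) (g := (EuclideanSpace.proj (𝕜 := ℝ) a : Coord n →L[ℝ] ℝ))
      (t := univ) (EuclideanSpace.proj (𝕜 := ℝ) a).differentiableAt.differentiableWithinAt hd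
      (mapsTo_univ _ _) ((𝓡∂ n).uniqueDiffOn y (hΩ.subset hy))
    rw [fderivWithin_univ, ContinuousLinearMap.fderiv] at h1
    rw [pd]
    change fderivWithin ℝ ((EuclideanSpace.proj (𝕜 := ℝ) a : Coord n →L[ℝ] ℝ) ∘ φ) _ y _ = _
    rw [h1]
    rfl
  set J : Matrix (Fin n) (Fin n) (smoothAlg Ω) := Matrix.of fun a i =>
    hΩ.coordDer i (smoothAlg.mk (fun y => φ y a) (hφa a)) with hJdef
  have hJy : ∀ (y : Ω) a i, (J a i).1 y = Jc y a i := by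
    intro y a i
    rw [← hpd y y.2]
    exact hΩ.coordDer_apply i _ (fun _ => rfl) y
  have hGG : G₁ = Jᵀ * G₂.map ψ * J := by
    ext i j y
    rw [hG₁, hG y y.2, IsChange.sandwich_apply, IsChange.sandwich_apply]
    rw [← smoothAlg.ev_apply]
    simp only [map_sum, map_mul, Matrix.transpose_apply, smoothAlg.ev_apply, hJy, Matrix.map_apply]
    refine Finset.sum_congr rfl fun c _ => Finset.sum_congr rfl fun e _ => ?_
    rw [hψ, smoothAlg.pull_apply, hG₂]
  -- The relation G₁ = JᵀG₂J yields the inverse Jacobian, so invertibility of J needs no separate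
  -- argument.
  set K := Q₁ * Jᵀ * G₂.map ψ with hK
  have hKJ : K * J = 1 := by
    rw [hK, mul_assoc, mul_assoc, ← mul_assoc Jᵀ, ← hGG, hM₁.inv_mul]
  have hch : IsChange hΩ.coordDer (newDer hΩ.coordDer K) J K :=
    isChange_newDer (fun a i j => hΩ.coordDer_comm _ _ _) hKJ
  have hchain : ∀ i b, hΩ.coordDer i (ψ b) = ∑ a, J a i * ψ (hΩ'.coordDer a b) := by
    intro i b
    refine smoothAlg.ext fun y => ?_
    rw [← smoothAlg.ev_apply y (∑ a, J a i * ψ (hΩ'.coordDer a b)), map_sum]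
    simp only [map_mul, smoothAlg.ev_apply, hJy]
    rw [IsHalfOpen.coordDer, hψ, smoothAlg.der_pull hΩ.uniqueDiffOn hΩ'.uniqueDiffOn,
      smoothAlg.der_apply _ _ b (smoothAlg.apply_eq_rep b), hΩ.fderivWithin_eq φ y.2]
    conv_lhs => rw [← sum_basisVec (fderivWithin ℝ φ (range (𝓡∂ n)) y (basisVec i)), map_sum]
    refine Finset.sum_congr rfl fun a _ => ?_
    rw [map_smul, smul_eq_mul, ← hJ y y.2, smoothAlg.pull_apply, IsHalfOpen.coordDer,
      smoothAlg.der_apply _ _ b (smoothAlg.apply_eq_rep b)]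
  have hnat : ∀ a b, ψ (hΩ'.coordDer a b) = newDer hΩ.coordDer K a (ψ b) :=
    newDer_hom hKJ ψ hchain
  have hM₂' : IsMetric (newDer hΩ.coordDer K) (G₂.map ψ) (Q₂.map ψ) (ψ r₂) (ψ s₂) :=
    hM₂.hom ψ (hch.comm hΩ.coordDer_comm)
  refine ⟨fun y hy => ?_, fun f F hf hF y hy => ?_⟩
  · have h1 := hch.ricci_eq hΩ.coordDer_comm hM₂'.symm hM₁.inv_mul hM₂'.inv_mul hGG
    ext i j
    rw [Matrix.of_apply, ← ricci_apply_coord hΩ hM₁ hG₁ i j ⟨y, hy⟩, h1, IsChange.sandwich_apply,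
      IsChange.sandwich_apply, ← smoothAlg.ev_apply]
    simp only [map_sum, map_mul, Matrix.transpose_apply, smoothAlg.ev_apply, hJy, Matrix.of_apply]
    refine Finset.sum_congr rfl fun c _ => Finset.sum_congr rfl fun e _ => ?_
    rw [← ricci_chr_hom ψ hnat, hψ, smoothAlg.pull_apply, ricci_apply_coord hΩ' hM₂ hG₂]
  · have h1 := hch.lap_eq hM₁ hM₂' hGG (ψ (smoothAlg.mk f hf))
    rw [← lap_hom ψ hnat] at h1
    have h2 := congrArg (fun z : smoothAlg Ω => z.1 ⟨y, hy⟩) h1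
    simp only [hψ] at h2
    rw [smoothAlg.pull_apply, lap_apply_coord hΩ' hM₂ hG₂ hr₂ (smoothAlg.mk f hf) (fun _ => rfl),
      lap_apply_coord hΩ hM₁ hG₁ hr₁ _ (φ := F) (fun y => (hF y y.2).symm)] at h2
    exact h2

end CoordChange

end DiffAlg

/-! ### Congruence invariants and chart-independence of the curvature -/

namespace BoundaryRicci

open DiffAlg Matrix

section MatrixInvariants

variable {ι : Type*} [Fintype ι] [DecidableEq ι]

/-- The trace of `R` with respect to `G`. -/
def trM (G R : Matrix ι ι ℝ) : ℝ := (G⁻¹ * Rᵀ).trace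

/-- The square of the norm of `R` with respect to `G`. -/
def normSqM (G R : Matrix ι ι ℝ) : ℝ := (G⁻¹ * R * G⁻¹ * Rᵀ).trace

/-- The inner product of covectors with respect to `G`. -/
def coinnerM (G : Matrix ι ι ℝ) (d e : ι → ℝ) : ℝ := d ⬝ᵥ (G⁻¹ *ᵥ e)

/-- The value of `R` on the vectors dual to the covectors `d` and `e`. -/
def evalM (G R : Matrix ι ι ℝ) (d e : ι → ℝ) : ℝ := (G⁻¹ *ᵥ d) ⬝ᵥ (R *ᵥ (G⁻¹ *ᵥ e))

variable {G R J : Matrix ι ι ℝ}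

lemma inv_sandwich (J G : Matrix ι ι ℝ) : (Jᵀ * G * J)⁻¹ = J⁻¹ * G⁻¹ * J⁻¹ᵀ := by
  rw [Matrix.mul_inv_rev, Matrix.mul_inv_rev, Matrix.transpose_nonsing_inv, mul_assoc]

lemma trM_sandwich (hJ : IsUnit J.det) : trM (Jᵀ * G * J) (Jᵀ * R * J) = trM G R := by
  have h1 : J⁻¹ᵀ * Jᵀ = 1 := by
    rw [← Matrix.transpose_mul, Matrix.mul_nonsing_inv _ hJ, Matrix.transpose_one]
  have h2 : (Jᵀ * R * J)ᵀ = Jᵀ * (Rᵀ * J) := by simp [Matrix.transpose_mul]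
  rw [trM, trM, inv_sandwich, h2, mul_assoc, ← mul_assoc J⁻¹ᵀ, h1, one_mul, mul_assoc,
    Matrix.trace_mul_comm, ← mul_assoc, mul_assoc, Matrix.mul_nonsing_inv _ hJ, mul_one]

lemma inv_sandwich_mulVec (hJ : IsUnit J.det) (d : ι → ℝ) :
    (Jᵀ * G * J)⁻¹ *ᵥ (Jᵀ *ᵥ d) = J⁻¹ *ᵥ (G⁻¹ *ᵥ d) := by
  have h1 : J⁻¹ᵀ * Jᵀ = 1 := by
    rw [← Matrix.transpose_mul, Matrix.mul_nonsing_inv _ hJ, Matrix.transpose_one]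
  rw [inv_sandwich, Matrix.mulVec_mulVec, mul_assoc, h1, mul_one, Matrix.mulVec_mulVec]

lemma coinnerM_sandwich (hJ : IsUnit J.det) (d e : ι → ℝ) :
    coinnerM (Jᵀ * G * J) (Jᵀ *ᵥ d) (Jᵀ *ᵥ e) = coinnerM G d e := by
  rw [coinnerM, coinnerM, inv_sandwich_mulVec hJ, Matrix.mulVec_transpose,
    ← Matrix.dotProduct_mulVec, Matrix.mulVec_mulVec, Matrix.mul_nonsing_inv _ hJ,
    Matrix.one_mulVec]

lemma evalM_sandwich (hJ : IsUnit J.det) (d e : ι → ℝ) :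
    evalM (Jᵀ * G * J) (Jᵀ * R * J) (Jᵀ *ᵥ d) (Jᵀ *ᵥ e) = evalM G R d e := by
  have h3 := Matrix.mul_nonsing_inv _ hJ
  rw [evalM, evalM, inv_sandwich_mulVec hJ, inv_sandwich_mulVec hJ, ← Matrix.mulVec_mulVec,
    Matrix.mulVec_mulVec _ J, h3, Matrix.one_mulVec, ← Matrix.mulVec_mulVec,
    Matrix.mulVec_transpose, dotProduct_comm, ← Matrix.dotProduct_mulVec, Matrix.mulVec_mulVec _ J, h3,
    Matrix.one_mulVec, dotProduct_comm]

end MatrixInvariants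

variable {n : ℕ} [NeZero n] {W : Type*} [TopologicalSpace W]
  [ChartedSpace (EuclideanHalfSpace n) W] [IsManifold (𝓡∂ n) ∞ W]

/-- The coefficients of the metric in all charts are smooth. -/
def HasSmoothCoord (g : RMetric n W) : Prop :=
  ∀ (x₀ : W) (i j : Fin n),
    ContDiffOn ℝ ∞ (fun y => metricCoord g x₀ y i j) (extChartAt (𝓡∂ n) x₀).target

variable {g : RMetric n W}

lemma HasSmoothCoord.isMetricField (hg : HasSmoothCoord g) (x₀ : W) {Ω : Set (Coord n)}
    (h : Ω ⊆ (extChartAt (𝓡∂ n) x₀).target) : IsMetricField Ω (metricCoord g x₀) :=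
  ⟨fun i j => (hg x₀ i j).mono h, fun y _ => metricCoord_symm x₀ g y,
    fun _ hy => (metricCoord_posDef x₀ g (h hy)).det_pos⟩

variable (g) in
/-- The matrix of the Ricci tensor. -/
def ricMat (x : W) : Matrix (Fin n) (Fin n) ℝ :=
  Matrix.of fun i j => ricciCoord (metricCoord g x) i j (extChartAt (𝓡∂ n) x x)

variable (g) in
/-- The matrix of the Ricci tensor in the chart around `x₀`. -/
def ricCoordMat (x₀ : W) (y : Coord n) : Matrix (Fin n) (Fin n) ℝ :=
  Matrix.of fun i j => ricciCoord (metricCoord g x₀) i j y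

/-- The differential of a function as a vector of partial derivatives. -/
def diffVec (f : W → ℝ) (x : W) : Fin n → ℝ := fun i => dirDeriv f x (basisVec i)

lemma ric_eq (x : W) (v w : Coord n) : ric g x v w = v.ofLp ⬝ᵥ (ricMat g x *ᵥ w.ofLp) := by
  simp only [ric, ricMat, dotProduct, Matrix.mulVec, Matrix.of_apply, Finset.mul_sum]
  exact Finset.sum_congr rfl fun i _ => Finset.sum_congr rfl fun j _ => by ring

lemma ric_basisVec (x : W) (i j : Fin n) : ric g x (basisVec i) (basisVec j) = ricMat g x i j := by
  rw [ric_eq]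
  simp [basisVec, dotProduct, Matrix.mulVec]

/-- The Ricci tensor in the chart around `x₀`. -/
lemma ricCoordMat_eq (hg : HasSmoothCoord g) (x₀ : W) {y : Coord n}
    (hy : y ∈ (extChartAt (𝓡∂ n) x₀).target) :
    ricCoordMat g x₀ y
      = (chartMat x₀ y)ᵀ * ricMat g ((extChartAt (𝓡∂ n) x₀).symm y) * chartMat x₀ y := by
  set x := (extChartAt (𝓡∂ n) x₀).symm y with hx
  -- Pass from the chart around x₀ to the preferred chart of the point over y, in which its
  -- curvature is defined.
  have h := (coordChange (isHalfOpen_overlap x₀ x) (isHalfOpen_target x) (contDiffOn_trans x₀ x)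
    (fun z hz => trans_mem x₀ x hz)
    (hg.isMetricField x₀ fun z hz => ((mem_overlap x₀ x).mp hz).1)
    (hg.isMetricField x subset_rfl) (Jc := jac x₀ x) (fun _ _ _ _ => rfl)
    (fun z hz => metricCoord_trans x₀ x g hz)).1 y (mem_overlap_symm x₀ hy)
  rw [chartMat_eq_jac x₀ hy]
  exact h

/-- The Laplace operator in the chart around `x₀`. -/
lemma laplaceCoord_eq (hg : HasSmoothCoord g) (x₀ : W) {f : W → ℝ}
    (hf : ContMDiff (𝓡∂ n) 𝓘(ℝ, ℝ) ∞ f) {y : Coord n}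
    (hy : y ∈ (extChartAt (𝓡∂ n) x₀).target) :
    laplaceCoord (metricCoord g x₀) (f ∘ (extChartAt (𝓡∂ n) x₀).symm) y
      = laplace g f ((extChartAt (𝓡∂ n) x₀).symm y) := by
  set x := (extChartAt (𝓡∂ n) x₀).symm y with hx
  refine (coordChange (isHalfOpen_overlap x₀ x) (isHalfOpen_target x) (contDiffOn_trans x₀ x)
    (fun z hz => trans_mem x₀ x hz)
    (hg.isMetricField x₀ fun z hz => ((mem_overlap x₀ x).mp hz).1)
    (hg.isMetricField x subset_rfl) (Jc := jac x₀ x) (fun _ _ _ _ => rfl)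
    (fun z hz => metricCoord_trans x₀ x g hz)).2 (f ∘ (extChartAt (𝓡∂ n) x).symm) _ ?_ ?_ y
    (mem_overlap_symm x₀ hy)
  · exact contMDiffOn_iff_contDiffOn.mp
      (hf.comp_contMDiffOn (contMDiffOn_extChartAt_symm x))
  · intro z hz
    simp only [Function.comp_apply, symm_trans x₀ x hz]

lemma diffVec_chart (x₀ : W) {f : W → ℝ} {y : Coord n}
    (hy : y ∈ (extChartAt (𝓡∂ n) x₀).target)
    (hf : MDifferentiableAt (𝓡∂ n) 𝓘(ℝ, ℝ) f ((extChartAt (𝓡∂ n) x₀).symm y)) :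
    (fun i => pd i (f ∘ (extChartAt (𝓡∂ n) x₀).symm) y)
      = (chartMat x₀ y)ᵀ *ᵥ diffVec f ((extChartAt (𝓡∂ n) x₀).symm y) := by
  funext i
  rw [pd_eq_sum x₀ hy hf]
  rfl

section Invariants

lemma inv_metricMat_symm (x : W) : (metricMat g x)⁻¹ᵀ = (metricMat g x)⁻¹ := by
  rw [Matrix.transpose_nonsing_inv, metricMat_symm]

lemma isUnit_metricMat (x : W) : IsUnit (metricMat g x).det :=
  isUnit_iff_ne_zero.mpr (metricMat_posDef g x).det_pos.ne'

/-- The transpose in `trM` matches the order of the indices in `scal`, so symmetry of the Ricci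
matrix is not needed here. -/
lemma scal_eq (x : W) : scal g x = trM (metricMat g x) (ricMat g x) := by
  simp only [scal, trM, Matrix.trace, Matrix.diag_apply, Matrix.mul_apply, ric_basisVec,
    Matrix.transpose_apply]

lemma grad_eq (f : W → ℝ) (x : W) :
    (grad g f x).ofLp = (metricMat g x)⁻¹ *ᵥ diffVec f x := rfl

lemma innerAt_eq (x : W) (v w : Coord n) :
    innerAt g x v w = v.ofLp ⬝ᵥ (metricMat g x *ᵥ w.ofLp) := by
  rw [innerAt_eq_sum]
  simp only [dotProduct, Matrix.mulVec, Finset.mul_sum]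
  exact Finset.sum_congr rfl fun i _ => Finset.sum_congr rfl fun j _ => by ring

lemma innerAt_grad (f h : W → ℝ) (x : W) : innerAt g x (grad g f x) (grad g h x)
    = coinnerM (metricMat g x) (diffVec f x) (diffVec h x) := by
  rw [innerAt_eq, grad_eq, grad_eq, Matrix.mulVec_mulVec, Matrix.mul_nonsing_inv _ (isUnit_metricMat x),
    Matrix.one_mulVec, coinnerM, Matrix.dotProduct_mulVec, ← Matrix.mulVec_transpose,
    inv_metricMat_symm]

lemma gradNormSq_eq (f : W → ℝ) (x : W) :
    gradNormSq g f x = coinnerM (metricMat g x) (diffVec f x) (diffVec f x) :=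
  innerAt_grad f f x

lemma ric_grad (f h : W → ℝ) (x : W) : ric g x (grad g f x) (grad g h x)
    = evalM (metricMat g x) (ricMat g x) (diffVec f x) (diffVec h x) := by
  rw [ric_eq, grad_eq, grad_eq, evalM]

/-- The cross terms contribute -2R²/n and the square of the trace part contributes (R/n)²·n = R²/n.
-/
lemma ric0NormSq_eq (hn : (n : ℝ) ≠ 0) (x : W) : ric0NormSq g x
    = normSqM (metricMat g x) (ricMat g x) - scal g x ^ 2 / n := by
  have h0 : ∀ i j, ric0 g x (basisVec i) (basisVec j)
      = (ricMat g x - (scal g x / n) • metricMat g x) i j := by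
    intro i j
    rw [ric0, ric_basisVec]; rfl
  set Q := (metricMat g x)⁻¹ with hQ
  have hQs : ∀ i j, Q i j = Q j i := fun i j => congrFun (congrFun (inv_metricMat_symm x) j) i
  set X := ricMat g x - (scal g x / n) • metricMat g x with hX
  have h1 : ric0NormSq g x = (Q * X * Q * Xᵀ).trace := by
    simp only [ric0NormSq, h0, ← hQ]
    simp only [Matrix.trace, Matrix.diag_apply, Matrix.mul_apply, Matrix.transpose_apply,
      Finset.sum_mul]
    rw [Finset.sum_congr rfl fun i _ => Finset.sum_comm_cycle,
      Finset.sum_congr rfl fun i _ => Finset.sum_comm_cycle, Finset.sum_comm]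
    refine Finset.sum_congr rfl fun k _ => ?_
    rw [Finset.sum_comm_cycle, Finset.sum_comm_cycle]
    refine Finset.sum_congr rfl fun l _ => Finset.sum_congr rfl fun j _ =>
      Finset.sum_congr rfl fun i _ => ?_
    rw [hQs i k]; ring
  have hQG : Q * metricMat g x = 1 := Matrix.nonsing_inv_mul _ (isUnit_metricMat x)
  have hGQ : metricMat g x * Q = 1 := Matrix.mul_nonsing_inv _ (isUnit_metricMat x)
  have h2 : Q * X = Q * ricMat g x - (scal g x / n) • 1 := by
    rw [hX, mul_sub, mul_smul_comm, hQG]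
  have h3 : Q * Xᵀ = Q * (ricMat g x)ᵀ - (scal g x / n) • 1 := by
    rw [hX, Matrix.transpose_sub, Matrix.transpose_smul, metricMat_symm, mul_sub, mul_smul_comm,
      hQG]
  have h4 : (Q * ricMat g x).trace = scal g x := by
    rw [← Matrix.trace_transpose, Matrix.transpose_mul, Matrix.trace_mul_comm, inv_metricMat_symm,
      scal_eq]; rfl
  have h5 : (Q * (ricMat g x)ᵀ).trace = scal g x := (scal_eq x).symm
  rw [h1, mul_assoc, h2, h3, sub_mul, mul_sub, mul_sub, Matrix.trace_sub, Matrix.trace_sub,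
    Matrix.trace_sub, normSqM, mul_assoc]
  simp only [mul_smul_comm, smul_mul_assoc, mul_one, one_mul, Matrix.trace_smul, h4, h5,
    Matrix.trace_one, smul_eq_mul, Fintype.card_fin, ← hQ]
  simp only [mul_assoc]
  field_simp
  ring

end Invariants

end BoundaryRicci

/-! ### Smooth functions on space-time and their time slices -/

namespace DiffAlg

section SpaceTime

variable {n : ℕ} [NeZero n] {T : ℝ} {Ω : Set (Coord n)} (hΩ : IsHalfOpen Ω)
include hΩ

lemma IsHalfOpen.uniqueDiffOn_prod (T : ℝ) :
    UniqueDiffOn ℝ (Ico 0 T ×ˢ Ω : Set (ℝ × Coord n)) :=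
  (uniqueDiffOn_Ico 0 T).prod hΩ.uniqueDiffOn

lemma IsHalfOpen.prod_subset_closure (T : ℝ) :
    (Ico 0 T ×ˢ Ω : Set (ℝ × Coord n)) ⊆ closure (interior (Ico 0 T ×ˢ Ω)) := by
  rintro ⟨t, y⟩ ⟨ht, hy⟩
  rw [interior_prod_eq, closure_prod_eq, interior_Ico]
  refine ⟨?_, hΩ.subset_closure hy⟩
  have h0 : (0 : ℝ) ≠ T := (ht.1.trans_lt ht.2).ne
  rw [closure_Ioo h0]
  exact Ico_subset_Icc_self ht

/-- The derivation `∂ₜ` on smooth functions on space-time. -/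
def IsHalfOpen.timeDer (T : ℝ) : Derivation ℝ (smoothAlg (Ico 0 T ×ˢ Ω : Set (ℝ × Coord n)))
    (smoothAlg (Ico 0 T ×ˢ Ω : Set (ℝ × Coord n))) :=
  smoothAlg.der (hΩ.uniqueDiffOn_prod T) (1, 0)

/-- The derivations `∂ᵢ` on smooth functions on space-time. -/
def IsHalfOpen.spaceDer (T : ℝ) (i : Fin n) :
    Derivation ℝ (smoothAlg (Ico 0 T ×ˢ Ω : Set (ℝ × Coord n)))
      (smoothAlg (Ico 0 T ×ˢ Ω : Set (ℝ × Coord n))) :=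
  smoothAlg.der (hΩ.uniqueDiffOn_prod T) (0, basisVec i)

lemma IsHalfOpen.hasDerivWithinAt_time (f : smoothAlg (Ico 0 T ×ˢ Ω : Set (ℝ × Coord n)))
    {φ : ℝ × Coord n → ℝ} (h : ∀ q : (Ico 0 T ×ˢ Ω : Set (ℝ × Coord n)), f.1 q = φ q)
    (q : (Ico 0 T ×ˢ Ω : Set (ℝ × Coord n))) :
    HasDerivWithinAt (fun s => φ (s, q.1.2)) ((hΩ.timeDer T f).1 q) (Ico 0 T) q.1.1 := by
  rw [IsHalfOpen.timeDer, smoothAlg.der_apply _ _ f h]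
  have hd : HasFDerivWithinAt φ (fderivWithin ℝ φ (Ico 0 T ×ˢ Ω) q) (Ico 0 T ×ˢ Ω)
      ((fun s : ℝ => (s, q.1.2)) q.1.1) :=
    ((smoothAlg.contDiffOn_of_eq f h).differentiableOn (by simp) q q.2).hasFDerivWithinAt
  have hc : HasDerivWithinAt (fun s : ℝ => (s, q.1.2)) ((1 : ℝ), (0 : Coord n)) (Ico 0 T) q.1.1 :=
    ((hasDerivAt_id q.1.1).prodMk (hasDerivAt_const _ _)).hasDerivWithinAt
  have hm : MapsTo (fun s : ℝ => (s, q.1.2)) (Ico 0 T) (Ico 0 T ×ˢ Ω) := fun s hs => ⟨hs, q.2.2⟩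
  exact hd.comp_hasDerivWithinAt q.1.1 hc hm

lemma IsHalfOpen.timeDer_apply (f : smoothAlg (Ico 0 T ×ˢ Ω : Set (ℝ × Coord n)))
    {φ : ℝ × Coord n → ℝ} (h : ∀ q : (Ico 0 T ×ˢ Ω : Set (ℝ × Coord n)), f.1 q = φ q)
    (q : (Ico 0 T ×ˢ Ω : Set (ℝ × Coord n))) {c : ℝ}
    (hc : HasDerivWithinAt (fun s => φ (s, q.1.2)) c (Ico 0 T) q.1.1) :
    (hΩ.timeDer T f).1 q = c :=
  (uniqueDiffOn_Ico 0 T _ q.2.1).eq_deriv _ (hΩ.hasDerivWithinAt_time f h q) hc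

omit hΩ in
lemma mapsTo_prodMk {t : ℝ} (ht : t ∈ Ico 0 T) : MapsTo (fun y => (t, y)) Ω (Ico 0 T ×ˢ Ω) :=
  fun _ hy => ⟨ht, hy⟩

omit hΩ in
/-- The restriction of functions on space-time to a time `t`. -/
def slice {t : ℝ} (ht : t ∈ Ico 0 T) :
    smoothAlg (Ico 0 T ×ˢ Ω : Set (ℝ × Coord n)) →ₐ[ℝ] smoothAlg Ω :=
  smoothAlg.pull (fun y => (t, y)) (contDiff_prodMk_right t).contDiffOn (mapsTo_prodMk ht)

lemma IsHalfOpen.slice_spaceDer {t : ℝ} (ht : t ∈ Ico 0 T) (i : Fin n)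
    (f : smoothAlg (Ico 0 T ×ˢ Ω : Set (ℝ × Coord n))) :
    slice ht (hΩ.spaceDer T i f) = hΩ.coordDer i (slice ht f) := by
  refine smoothAlg.ext fun y => ?_
  have h := smoothAlg.der_pull hΩ.uniqueDiffOn (hΩ.uniqueDiffOn_prod T) (fun y => (t, y))
    (contDiff_prodMk_right t).contDiffOn (mapsTo_prodMk ht) f (basisVec i) y
  have h1 := (hasFDerivAt_prodMk_right (𝕜 := ℝ) t (y : Coord n)).hasFDerivWithinAt (s := Ω)
  rw [h1.fderivWithin (hΩ.uniqueDiffOn y y.2)] at h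
  exact h.symm

end SpaceTime

end DiffAlg

/-! ### The Ricci flow in coordinates and the evolution of the scalar curvature -/

namespace BoundaryRicci

open DiffAlg Matrix

variable {n : ℕ} [NeZero n] {W : Type*} [TopologicalSpace W]
  [ChartedSpace (EuclideanHalfSpace n) W] [IsManifold (𝓡∂ n) ∞ W]
  {T : ℝ} {g : ℝ → RMetric n W}

/-- A solution of the Ricci flow in coordinates. -/
structure IsCoordFlow (T : ℝ) (Ω : Set (Coord n)) (Gc : ℝ → Coord n → Matrix (Fin n) (Fin n) ℝ) :
    Prop where
  halfOpen : IsHalfOpen Ω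
  smooth : ∀ i j, ContDiffOn ℝ ∞ (fun q : ℝ × Coord n => Gc q.1 q.2 i j) (Ico 0 T ×ˢ Ω)
  symm : ∀ t ∈ Ico 0 T, ∀ y ∈ Ω, (Gc t y)ᵀ = Gc t y
  det_pos : ∀ t ∈ Ico 0 T, ∀ y ∈ Ω, 0 < (Gc t y).det
  evolution : ∀ t ∈ Ico 0 T, ∀ y ∈ Ω, ∀ i j,
    HasDerivWithinAt (fun s => Gc s y i j) (-2 * ricciCoord (Gc t) i j y) (Ico 0 T) t

/-- A pointwise time derivative of a function smooth on space-time is a value of the derivation ∂ₜ,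
hence smooth; it need not be computed for its continuity to be known. -/
lemma continuousOn_time_deriv {Ω : Set (Coord n)} (hΩ : IsHalfOpen Ω) {f f' : ℝ × Coord n → ℝ}
    (hf : ContDiffOn ℝ ∞ f (Ico 0 T ×ˢ Ω))
    (hf' : ∀ t ∈ Ico 0 T, ∀ y ∈ Ω, HasDerivWithinAt (fun s => f (s, y)) (f' (t, y)) (Ico 0 T) t) :
    ContinuousOn f' (Ico 0 T ×ˢ Ω) :=
  (smoothAlg.contDiffOn_of_eq (hΩ.timeDer T (smoothAlg.mk f hf)) fun q =>
    hΩ.timeDer_apply (smoothAlg.mk f hf) (φ := f) (fun _ => rfl) q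
      (hf' q.1.1 q.2.1 q.1.2 q.2.2)).continuousOn

namespace IsCoordFlow

variable {Ω : Set (Coord n)} {Gc : ℝ → Coord n → Matrix (Fin n) (Fin n) ℝ}

/-- Symmetry comes from the flow itself: -2 Ric is the time derivative of a symmetric matrix, and
derivatives within [0,T) are unique. -/
lemma ricci_symm (h : IsCoordFlow T Ω Gc) {t : ℝ} (ht : t ∈ Ico 0 T) {y : Coord n} (hy : y ∈ Ω)
    (i j : Fin n) : ricciCoord (Gc t) i j y = ricciCoord (Gc t) j i y := by
  have h1 := h.evolution t ht y hy i j
  have h2 := (h.evolution t ht y hy j i).congr (f₁ := fun s => Gc s y i j)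
    (fun s hs => congrFun (congrFun (h.symm s hs y hy) j) i)
    (congrFun (congrFun (h.symm t ht y hy) j) i)
  have := (uniqueDiffOn_Ico 0 T t ht).eq_deriv _ h1 h2
  linarith

/-- The Ricci tensor and the scalar curvature of a Ricci flow as smooth functions on space-time,
and the evolution of the scalar curvature. -/
theorem exists_smooth (h : IsCoordFlow T Ω Gc) :
    ∃ (R : Matrix (Fin n) (Fin n) (smoothAlg (Ico 0 T ×ˢ Ω : Set (ℝ × Coord n))))
      (S : smoothAlg (Ico 0 T ×ˢ Ω : Set (ℝ × Coord n))),
      (∀ q i j, (R i j).1 q = ricciCoord (Gc q.1.1) i j q.1.2) ∧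
      (∀ q, S.1 q = trM (Gc q.1.1 q.1.2) (Matrix.of fun i j => ricciCoord (Gc q.1.1) i j q.1.2)) ∧
      (∀ q (F : Coord n → ℝ), (∀ y ∈ Ω, F y
          = trM (Gc q.1.1 y) (Matrix.of fun i j => ricciCoord (Gc q.1.1) i j y)) →
        (h.halfOpen.timeDer T S).1 q = laplaceCoord (Gc q.1.1) F q.1.2 + 2 *
          normSqM (Gc q.1.1 q.1.2) (Matrix.of fun i j => ricciCoord (Gc q.1.1) i j q.1.2)) ∧
      ∃ r : smoothAlg (Ico 0 T ×ˢ Ω : Set (ℝ × Coord n)),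
        (∀ q, r.1 q = √(Gc q.1.1 q.1.2).det) ∧ h.halfOpen.timeDer T r = -(S * r) := by
  have hΩ := h.halfOpen
  set d := hΩ.spaceDer T with hd
  set δ := hΩ.timeDer T with hδ
  obtain ⟨G, hGq⟩ : ∃ G : Matrix (Fin n) (Fin n) (smoothAlg (Ico 0 T ×ˢ Ω : Set (ℝ × Coord n))),
      ∀ i j, G i j = smoothAlg.mk (fun q => Gc q.1 q.2 i j) (h.smooth i j) :=
    ⟨Matrix.of fun i j => smoothAlg.mk (fun q => Gc q.1 q.2 i j) (h.smooth i j), fun _ _ => rfl⟩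
  have hGa : ∀ i j q, (G i j).1 q = Gc q.1.1 q.1.2 i j := fun i j q => by rw [hGq]; rfl
  have hGev : ∀ q, G.map (smoothAlg.ev q) = Gc q.1.1 q.1.2 := fun q => by ext i j; exact hGa i j q
  have hGs : Gᵀ = G := by
    ext i j q
    rw [Matrix.transpose_apply, hGa, hGa]
    exact congrFun (congrFun (h.symm _ q.2.1 _ q.2.2) i) j
  have hdet : ∀ q, 0 < G.det.1 q := by
    intro q
    rw [DiffAlg.det_apply, hGev]
    exact h.det_pos _ q.2.1 _ q.2.2
  have hcomm : ∀ i j a, d i (d j a) = d j (d i a) := fun i j a =>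
    smoothAlg.der_comm _ (hΩ.prod_subset_closure T) _ _ a
  have hδcomm : ∀ i a, δ (d i a) = d i (δ a) := fun i a =>
    smoothAlg.der_comm _ (hΩ.prod_subset_closure T) _ _ a
  obtain ⟨Q, r, s, hM, hr⟩ := exists_isMetric hcomm G hGs hdet
  -- The algebra runs on space-time, while the coordinate formulas live at a fixed time; restriction
  -- to a slice is a homomorphism that respects the space derivations.
  have hslice : ∀ {t : ℝ} (ht : t ∈ Ico 0 T), IsMetric hΩ.coordDer (G.map (slice ht))
      (Q.map (slice ht)) (slice ht r) (slice ht s) := fun ht => hM.hom (slice ht) hΩ.coordDer_comm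
  have hGslice : ∀ {t : ℝ} (ht : t ∈ Ico 0 T) (y : Ω) (a b : Fin n),
      ((G.map (slice ht)) a b).1 y = Gc t y a b := fun ht y a b => hGa a b ⟨(_, y), ht, y.2⟩
  have hric : ∀ (q : (Ico 0 T ×ˢ Ω : Set (ℝ × Coord n))) i j,
      (ricci d (chr d G Q) i j).1 q = ricciCoord (Gc q.1.1) i j q.1.2 := by
    intro q i j
    have h1 := ricci_chr_hom (slice q.2.1) (hΩ.slice_spaceDer q.2.1) G Q i j
    have h2 := ricci_apply_coord hΩ (hslice q.2.1) (hGslice q.2.1) i j ⟨q.1.2, q.2.2⟩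
    rw [← h1] at h2
    exact h2
  generalize hRdef : ricci d (chr d G Q) = R at hric
  have hQ : ∀ (q : (Ico 0 T ×ˢ Ω : Set (ℝ × Coord n))),
      Q.map (smoothAlg.ev q) = (Gc q.1.1 q.1.2)⁻¹ := fun q => by
    rw [inv_apply hM.inv_mul q, hGev]
  have hδG : G.map δ = (-2 : ℝ) • R := by
    ext i j q
    have h1 := hΩ.timeDer_apply (G i j) (φ := fun q => Gc q.1 q.2 i j)
      (fun q => hGa i j q) q (h.evolution _ q.2.1 _ q.2.2 i j)
    rw [← hric] at h1
    exact h1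
  have hev : ∀ q, R.map (smoothAlg.ev q)
      = Matrix.of fun i j => ricciCoord (Gc q.1.1) i j q.1.2 := fun q => by
    ext i j; exact hric q i j
  have hsym : ∀ q : (Ico 0 T ×ˢ Ω : Set (ℝ × Coord n)),
      (Matrix.of fun i j => ricciCoord (Gc q.1.1) i j q.1.2)ᵀ
        = Matrix.of fun i j => ricciCoord (Gc q.1.1) i j q.1.2 := by
    intro q; ext i j; exact h.ricci_symm q.2.1 q.2.2 j i
  have htr : ∀ (M : Matrix (Fin n) (Fin n) (smoothAlg (Ico 0 T ×ˢ Ω : Set (ℝ × Coord n)))) q,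
      M.trace.1 q = (M.map (smoothAlg.ev q)).trace := by
    intro M q
    rw [← smoothAlg.ev_apply]
    simp only [Matrix.trace, map_sum, Matrix.diag_apply, Matrix.map_apply]
  have hS : ∀ q : (Ico 0 T ×ˢ Ω : Set (ℝ × Coord n)), (Q * R).trace.1 q
      = trM (Gc q.1.1 q.1.2) (Matrix.of fun i j => ricciCoord (Gc q.1.1) i j q.1.2) := by
    intro q
    rw [htr, trM, hsym, ← hQ, ← hev, ← Matrix.map_mul]
  refine ⟨R, (Q * R).trace, hric, hS, fun q F hF => ?_, r, fun q => ?_, ?_⟩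
  rotate_left
  · rw [hr, DiffAlg.det_apply, hGev]
  · have h1 := derivation_sqrt_det δ hM.inv_mul hM.sq hM.mul_inv
    rw [hδG, mul_smul_comm, Matrix.trace_smul, mul_smul_comm] at h1
    have h2 := congrArg (fun z => (1 / 2 : ℝ) • z) h1
    simp only [smul_smul] at h2
    norm_num at h2
    rw [h2, mul_comm]
  have hevol := hM.scalar_evolution hδcomm (by rw [hRdef]; exact hδG)
  rw [hRdef] at hevol
  have h1 := lap_hom (slice q.2.1) (hΩ.slice_spaceDer q.2.1) r s Q (Q * R).trace
  have h2 := lap_apply_coord hΩ (hslice q.2.1) (hGslice q.2.1) (fun y => by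
      have := hr ⟨(q.1.1, y), q.2.1, y.2⟩
      have h3 : (G.map (slice q.2.1)).det = slice q.2.1 G.det :=
        ((slice q.2.1).toRingHom.map_det G).symm
      rw [h3]
      exact this) (slice q.2.1 (Q * R).trace) (φ := F)
    (fun y => (hS ⟨(q.1.1, y), q.2.1, y.2⟩).trans (hF y y.2).symm) ⟨q.1.2, q.2.2⟩
  rw [← h1] at h2
  have h4 : (lap d r s Q (Q * R).trace).1 q = laplaceCoord (Gc q.1.1) F q.1.2 := h2
  have h5 : ((2 : ℝ) • (Q * R * Q * R).trace).1 q = 2 * (Q * R * Q * R).trace.1 q := rfl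
  have h6 := congrArg (fun z : smoothAlg (Ico 0 T ×ˢ Ω : Set (ℝ × Coord n)) => z.1 q) hevol
  have h7 : (lap d r s Q (Q * R).trace + (2 : ℝ) • (Q * R * Q * R).trace).1 q
    = (lap d r s Q (Q * R).trace).1 q + ((2 : ℝ) • (Q * R * Q * R).trace).1 q := rfl
  refine h6.trans (h7.trans ?_)
  rw [h4, h5, htr, normSqM, hsym, ← hQ, ← hev, ← Matrix.map_mul, ← Matrix.map_mul,
    ← Matrix.map_mul]

lemma contDiffOn_ricciCoord (h : IsCoordFlow T Ω Gc) (i j : Fin n) :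
    ContDiffOn ℝ ∞ (fun q : ℝ × Coord n => ricciCoord (Gc q.1) i j q.2) (Ico 0 T ×ˢ Ω) := by
  obtain ⟨R, S, hR, -, -, -⟩ := h.exists_smooth
  exact smoothAlg.contDiffOn_of_eq (R i j) fun q => hR q i j

lemma contDiffOn_trM (h : IsCoordFlow T Ω Gc) :
    ContDiffOn ℝ ∞ (fun q : ℝ × Coord n =>
      trM (Gc q.1 q.2) (Matrix.of fun i j => ricciCoord (Gc q.1) i j q.2)) (Ico 0 T ×ˢ Ω) := by
  obtain ⟨R, S, -, hS, -, -⟩ := h.exists_smooth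
  exact smoothAlg.contDiffOn_of_eq S hS

/-- The evolution of the scalar curvature under the Ricci flow, in coordinates. -/
lemma hasDerivWithinAt_trM (h : IsCoordFlow T Ω Gc) {t : ℝ} (ht : t ∈ Ico 0 T) {y : Coord n}
    (hy : y ∈ Ω) (F : Coord n → ℝ)
    (hF : ∀ y ∈ Ω, F y = trM (Gc t y) (Matrix.of fun i j => ricciCoord (Gc t) i j y)) :
    HasDerivWithinAt (fun s => trM (Gc s y) (Matrix.of fun i j => ricciCoord (Gc s) i j y))
      (laplaceCoord (Gc t) F y + 2 *
        normSqM (Gc t y) (Matrix.of fun i j => ricciCoord (Gc t) i j y)) (Ico 0 T) t := by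
  obtain ⟨R, S, -, hS, hS', -⟩ := h.exists_smooth
  have h1 := h.halfOpen.hasDerivWithinAt_time S (φ := fun q =>
    trM (Gc q.1 q.2) (Matrix.of fun i j => ricciCoord (Gc q.1) i j q.2)) hS ⟨(t, y), ht, hy⟩
  rw [hS' ⟨(t, y), ht, hy⟩ F hF] at h1
  exact h1

/-- The evolution of the volume density under the Ricci flow, in coordinates. -/
lemma hasDerivWithinAt_sqrt_det (h : IsCoordFlow T Ω Gc) {t : ℝ} (ht : t ∈ Ico 0 T) {y : Coord n}
    (hy : y ∈ Ω) : HasDerivWithinAt (fun s => √(Gc s y).det)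
      (-(trM (Gc t y) (Matrix.of fun i j => ricciCoord (Gc t) i j y) * √(Gc t y).det))
      (Ico 0 T) t := by
  obtain ⟨R, S, -, hS, -, r, hr, hr'⟩ := h.exists_smooth
  have h1 := h.halfOpen.hasDerivWithinAt_time r (φ := fun q => √(Gc q.1 q.2).det) hr ⟨(t, y), ht, hy⟩
  rw [hr'] at h1
  have h2 : (-(S * r)).1 ⟨(t, y), ht, hy⟩ = -(S.1 ⟨(t, y), ht, hy⟩ * r.1 ⟨(t, y), ht, hy⟩) := rfl
  rw [h2, hS, hr] at h1
  exact h1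

end IsCoordFlow

namespace IsBoundaryRicciFlow

lemma hasSmoothCoord (hg : IsBoundaryRicciFlow T g) {t : ℝ} (ht : t ∈ Ico 0 T) :
    HasSmoothCoord (g t) := fun x₀ i j =>
  (hg.smooth x₀ i j).comp (contDiff_prodMk_right t).contDiffOn fun _ hy => ⟨ht, hy⟩

lemma hasDerivWithinAt_innerAt (hg : IsBoundaryRicciFlow T g) {t : ℝ} (ht : t ∈ Ico 0 T) (x : W)
    (v w : Coord n) : HasDerivWithinAt (fun s => innerAt (g s) x v w) (-2 * ric (g t) x v w)
      (Ico 0 T) t :=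
  hg.evolution t ht x v w

lemma hasDerivWithinAt_metricMat (hg : IsBoundaryRicciFlow T g) {t : ℝ} (ht : t ∈ Ico 0 T) (x : W)
    (i j : Fin n) : HasDerivWithinAt (fun s => metricMat (g s) x i j) (-2 * ricMat (g t) x i j)
      (Ico 0 T) t := by
  rw [← ric_basisVec]
  exact hg.evolution t ht x _ _

lemma hasDerivWithinAt_metricCoord (hg : IsBoundaryRicciFlow T g) {t : ℝ} (ht : t ∈ Ico 0 T)
    (x₀ : W) {y : Coord n} (hy : y ∈ (extChartAt (𝓡∂ n) x₀).target) (i j : Fin n) :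
    HasDerivWithinAt (fun s => metricCoord (g s) x₀ y i j) (-2 * ricCoordMat (g t) x₀ y i j)
      (Ico 0 T) t := by
  have h := hg.hasDerivWithinAt_innerAt ht ((extChartAt (𝓡∂ n) x₀).symm y)
    (chartDeriv x₀ y (basisVec i)) (chartDeriv x₀ y (basisVec j))
  have h2 : ric (g t) ((extChartAt (𝓡∂ n) x₀).symm y)
      (chartDeriv x₀ y (basisVec i)) (chartDeriv x₀ y (basisVec j))
      = ricCoordMat (g t) x₀ y i j := by
    rw [ricCoordMat_eq (hg.hasSmoothCoord ht) x₀ hy, IsChange.sandwich_apply, ric_eq]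
    simp only [dotProduct, Matrix.mulVec, Finset.mul_sum]
    exact Finset.sum_congr rfl fun a _ => Finset.sum_congr rfl fun b _ => by
      simp only [chartMat, Matrix.transpose_apply, Matrix.of_apply]; ring
  rw [h2] at h
  exact h

lemma spaceTime (hg : IsBoundaryRicciFlow T g) (x₀ : W) :
    IsCoordFlow T (extChartAt (𝓡∂ n) x₀).target (fun t => metricCoord (g t) x₀) :=
  ⟨isHalfOpen_target x₀, hg.smooth x₀, fun _ _ y _ => metricCoord_symm x₀ _ y,
    fun _ _ _ hy => (metricCoord_posDef x₀ _ hy).det_pos,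
    fun _ ht _ hy i j => hg.hasDerivWithinAt_metricCoord ht x₀ hy i j⟩

/-- The trace is invariant under congruence, so the scalar curvature, defined chart by chart at each
point, can be computed in one fixed chart. Its smoothness then becomes visible. -/
lemma scal_coord (hg : IsBoundaryRicciFlow T g) (x₀ : W) {t : ℝ} (ht : t ∈ Ico 0 T) {y : Coord n}
    (hy : y ∈ (extChartAt (𝓡∂ n) x₀).target) : scal (g t) ((extChartAt (𝓡∂ n) x₀).symm y)
      = trM (metricCoord (g t) x₀ y) (ricCoordMat (g t) x₀ y) := by
  rw [scal_eq, ← trM_sandwich (isUnit_chartMat x₀ hy), ← metricCoord_eq_chartMat,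
    ← ricCoordMat_eq (hg.hasSmoothCoord ht) x₀ hy]

/-- The scalar curvature is smooth in space and time. -/
lemma contDiffOn_scal (hg : IsBoundaryRicciFlow T g) (x₀ : W) :
    ContDiffOn ℝ ∞ (fun q : ℝ × Coord n => scal (g q.1) ((extChartAt (𝓡∂ n) x₀).symm q.2))
      (Ico 0 T ×ˢ (extChartAt (𝓡∂ n) x₀).target) := by
  exact (hg.spaceTime x₀).contDiffOn_trM.congr fun q hq => hg.scal_coord x₀ hq.1 hq.2

/-- The Ricci tensor is smooth in space and time. -/
lemma contDiffOn_ricCoordMat (hg : IsBoundaryRicciFlow T g) (x₀ : W) (i j : Fin n) :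
    ContDiffOn ℝ ∞ (fun q : ℝ × Coord n => ricCoordMat (g q.1) x₀ q.2 i j)
      (Ico 0 T ×ˢ (extChartAt (𝓡∂ n) x₀).target) := by
  exact (hg.spaceTime x₀).contDiffOn_ricciCoord i j

variable (g) in
/-- The time derivative of the scalar curvature along the flow. -/
def scalDeriv (t : ℝ) (x : W) : ℝ :=
  laplace (g t) (scal (g t)) x + 2 * normSqM (metricMat (g t) x) (ricMat (g t) x)

lemma hasDerivWithinAt_scal (hg : IsBoundaryRicciFlow T g) {t : ℝ} (ht : t ∈ Ico 0 T) (x : W) :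
    HasDerivWithinAt (fun s => scal (g s) x) (scalDeriv g t x) (Ico 0 T) t := by
  have h := (hg.spaceTime x).hasDerivWithinAt_trM ht (mem_extChartAt_target x)
    (scal (g t) ∘ (extChartAt (𝓡∂ n) x).symm) (fun y hy => hg.scal_coord x ht hy)
  rw [metricCoord_self] at h
  refine h.congr (fun s hs => ?_) ?_
  · have := hg.scal_coord x hs (mem_extChartAt_target x)
    rwa [extChartAt_to_inv] at this
  · have := hg.scal_coord x ht (mem_extChartAt_target x)
    rwa [extChartAt_to_inv] at this

/-- The expression is the time derivative of a smooth function on space-time, so ΔR and |Ric|² need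
not be treated separately. -/
lemma continuousOn_scalDeriv (hg : IsBoundaryRicciFlow T g) (x₀ : W) :
    ContinuousOn (fun q : ℝ × Coord n => scalDeriv g q.1 ((extChartAt (𝓡∂ n) x₀).symm q.2))
      (Ico 0 T ×ˢ (extChartAt (𝓡∂ n) x₀).target) := by
  obtain ⟨f, hf⟩ : ∃ f : ℝ × Coord n → ℝ,
    ∀ q, f q = scal (g q.1) ((extChartAt (𝓡∂ n) x₀).symm q.2) := ⟨_, fun _ => rfl⟩
  obtain ⟨f', hf'⟩ : ∃ f' : ℝ × Coord n → ℝ,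
    ∀ q, f' q = scalDeriv g q.1 ((extChartAt (𝓡∂ n) x₀).symm q.2) := ⟨_, fun _ => rfl⟩
  have h : ContinuousOn f' (Ico 0 T ×ˢ (extChartAt (𝓡∂ n) x₀).target) := by
    refine continuousOn_time_deriv (isHalfOpen_target x₀) (f := f)
      ((hg.contDiffOn_scal x₀).congr fun q _ => hf q) fun t ht y _ => ?_
    simp only [hf, hf']
    exact hg.hasDerivWithinAt_scal ht ((extChartAt (𝓡∂ n) x₀).symm y)
  exact h.congr fun q _ => (hf' q).symm

end IsBoundaryRicciFlow

end BoundaryRicci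

/-! ### Volume measures of W and of its boundary -/

namespace DiffAlg

lemma IsHalfOpen.measurableSet {n : ℕ} [NeZero n] {Ω : Set (Coord n)} (h : IsHalfOpen Ω) :
    MeasurableSet Ω := by
  -- A relatively open subset is the trace of an open set on the closed half-space.
  have h1 : Ω = interior (Ω ∪ (range (𝓡∂ n))ᶜ) ∩ range (𝓡∂ n) := by
    ext y
    constructor
    · intro hy
      refine ⟨mem_interior_iff_mem_nhds.mpr ?_, h.subset hy⟩
      have := mem_nhdsWithin_iff_eventually.mp (h.mem_nhds y hy)
      filter_upwards [this] with z hz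
      by_cases hzr : z ∈ range (𝓡∂ n)
      · exact Or.inl (hz hzr)
      · exact Or.inr hzr
    · rintro ⟨hy, hr⟩
      exact (interior_subset hy).resolve_right fun h => h hr
  rw [h1]
  exact isOpen_interior.measurableSet.inter (𝓡∂ n).isClosed_range.measurableSet

end DiffAlg

namespace BoundaryRicci

open DiffAlg

variable {n : ℕ} [NeZero n] {W : Type*} [TopologicalSpace W]
  [ChartedSpace (EuclideanHalfSpace n) W] [IsManifold (𝓡∂ n) ∞ W]

/-- The density of the Riemannian volume in a chart. -/
def volDensity (g : RMetric n W) (x₀ : W) (y : Coord n) : ℝ := √(metricCoord g x₀ y).det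

variable {g : RMetric n W}

lemma measurableSet_target (x₀ : W) : MeasurableSet (extChartAt (𝓡∂ n) x₀).target :=
  (isHalfOpen_target x₀).measurableSet

lemma HasSmoothCoord.continuousOn_metricCoord (hg : HasSmoothCoord g) (x₀ : W) :
    ContinuousOn (metricCoord g x₀) (extChartAt (𝓡∂ n) x₀).target :=
  continuousOn_pi.mpr fun i => continuousOn_pi.mpr fun j => (hg x₀ i j).continuousOn

lemma HasSmoothCoord.continuousOn_volDensity (hg : HasSmoothCoord g) (x₀ : W) :
    ContinuousOn (volDensity g x₀) (extChartAt (𝓡∂ n) x₀).target :=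
  Real.continuous_sqrt.comp_continuousOn
    ((continuous_id.matrix_det).comp_continuousOn (hg.continuousOn_metricCoord x₀))

lemma HasSmoothCoord.aemeasurable_ofReal_volDensity (hg : HasSmoothCoord g) (x₀ : W) :
    AEMeasurable (fun y => ENNReal.ofReal (volDensity g x₀ y))
      (volume.restrict (extChartAt (𝓡∂ n) x₀).target) :=
  ((hg.continuousOn_volDensity x₀).aemeasurable (measurableSet_target x₀)).ennreal_ofReal

/-- Being an interior point can be tested in any chart, and there it would force a positive zeroth
coordinate. -/
lemma mem_boundary_of_coord_zero (x₀ : W) {y : Coord n}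
    (hy : y ∈ (extChartAt (𝓡∂ n) x₀).target) (h0 : y 0 = 0) :
    (extChartAt (𝓡∂ n) x₀).symm y ∈ (𝓡∂ n).boundary W := by
  by_contra hb
  have hi : (𝓡∂ n).IsInteriorPoint ((extChartAt (𝓡∂ n) x₀).symm y) := by
    by_contra h
    exact hb (((𝓡∂ n).isBoundaryPoint_iff_not_isInteriorPoint _).mpr h)
  have hsrc := (extChartAt (𝓡∂ n) x₀).map_target hy
  rw [extChartAt_source] at hsrc
  rw [(𝓡∂ n).isInteriorPoint_iff_of_mem_atlas (n := ∞) (by simp) (chart_mem_atlas _ x₀) hsrc] at hi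
  have hi' : y ∈ interior (range (𝓡∂ n)) := by
    have h1 : (chartAt (EuclideanHalfSpace n) x₀).extend (𝓡∂ n) ((extChartAt (𝓡∂ n) x₀).symm y) = y :=
      (extChartAt (𝓡∂ n) x₀).right_inv hy
    rw [h1] at hi
    exact interior_mono (extChartAt_target_subset_range x₀) hi
  rw [interior_range_modelWithCornersEuclideanHalfSpace] at hi'
  exact absurd h0 (ne_of_gt hi')

section

variable [MeasurableSpace W] [BorelSpace W]

lemma aemeasurable_symm (x₀ : W) (f : Coord n → ENNReal) :
    AEMeasurable (extChartAt (𝓡∂ n) x₀).symm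
      ((volume.restrict (extChartAt (𝓡∂ n) x₀).target).withDensity f) :=
  ((continuousOn_extChartAt_symm x₀).aemeasurable (measurableSet_target x₀)).mono_ac
    (withDensity_absolutelyContinuous _ _)

lemma measurableSet_target_inter (x₀ : W) {A : Set W} (hA : MeasurableSet A) :
    MeasurableSet ((extChartAt (𝓡∂ n) x₀).target ∩ (extChartAt (𝓡∂ n) x₀).symm ⁻¹' A) := by
  have h1 : Continuous ((extChartAt (𝓡∂ n) x₀).target.domRestrict (extChartAt (𝓡∂ n) x₀).symm) :=
    continuousOn_iff_continuous_domRestrict.mp (continuousOn_extChartAt_symm x₀)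
  have h2 := (measurableSet_target x₀).subtype_image (h1.measurable hA)
  convert h2 using 1
  ext y
  constructor
  · rintro ⟨hy, hyA⟩; exact ⟨⟨y, hy⟩, hyA, rfl⟩
  · rintro ⟨⟨z, hz⟩, hzA, rfl⟩; exact ⟨hz, hzA⟩

lemma localVolume_apply (g : RMetric n W) (x₀ : W) {A : Set W} (hA : MeasurableSet A) :
    localVolume g x₀ A = ∫⁻ y in (extChartAt (𝓡∂ n) x₀).target ∩
      (extChartAt (𝓡∂ n) x₀).symm ⁻¹' A, ENNReal.ofReal (volDensity g x₀ y) := by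
  rw [localVolume, Measure.map_apply_of_aemeasurable (aemeasurable_symm x₀ _) hA,
    withDensity_apply', Measure.restrict_restrict' (measurableSet_target x₀), inter_comm]
  rfl

lemma localVolume_inter_source (g : RMetric n W) (x₀ : W) {A : Set W} (hA : MeasurableSet A) :
    localVolume g x₀ (A ∩ (extChartAt (𝓡∂ n) x₀).source) = localVolume g x₀ A := by
  rw [localVolume_apply g x₀ hA, localVolume_apply g x₀
    (hA.inter (isOpen_extChartAt_source x₀).measurableSet)]
  congr 2
  ext y
  constructor
  · rintro ⟨h1, h2, -⟩; exact ⟨h1, h2⟩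
  · rintro ⟨h1, h2⟩; exact ⟨h1, h2, (extChartAt (𝓡∂ n) x₀).map_target h1⟩

lemma det_fderivWithin_trans (x₀ x₁ : W) (y : Coord n) :
    (fderivWithin ℝ (trans x₀ x₁) (range (𝓡∂ n)) y).det = (jac x₀ x₁ y).det := by
  rw [ContinuousLinearMap.det, ← LinearMap.det_toMatrix (EuclideanSpace.basisFun (Fin n) ℝ).toBasis]
  congr 1

/-- Under congruence det G is multiplied by (det J)², so its root acquires exactly the factor |det
J| of the change of variables formula. -/
lemma volDensity_trans (g : RMetric n W) (x₀ x₁ : W) {y : Coord n} (hy : y ∈ overlap x₀ x₁) :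
    volDensity g x₀ y = |(jac x₀ x₁ y).det| * volDensity g x₁ (trans x₀ x₁ y) := by
  rw [volDensity, metricCoord_trans x₀ x₁ g hy, Matrix.det_mul, Matrix.det_mul, Matrix.det_transpose,
    show ∀ a b : ℝ, a * b * a = a ^ 2 * b from fun a b => by ring, Real.sqrt_mul (sq_nonneg _),
    Real.sqrt_sq_eq_abs, volDensity]

lemma localVolume_eq (g : RMetric n W) (x₀ x₁ : W) {A : Set W} (hA : MeasurableSet A)
    (h₀ : A ⊆ (extChartAt (𝓡∂ n) x₀).source) (h₁ : A ⊆ (extChartAt (𝓡∂ n) x₁).source) :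
    localVolume g x₁ A = localVolume g x₀ A := by
  rw [localVolume_apply g x₀ hA, localVolume_apply g x₁ hA]
  set B := (extChartAt (𝓡∂ n) x₀).target ∩ (extChartAt (𝓡∂ n) x₀).symm ⁻¹' A with hB
  have hBo : B ⊆ overlap x₀ x₁ := fun y hy => (mem_overlap _ _).mpr ⟨hy.1, h₁ hy.2⟩
  have himg : (extChartAt (𝓡∂ n) x₁).target ∩ (extChartAt (𝓡∂ n) x₁).symm ⁻¹' A
      = trans x₀ x₁ '' B := by
    ext z
    constructor
    · rintro ⟨hz, hzA⟩
      refine ⟨extChartAt (𝓡∂ n) x₀ ((extChartAt (𝓡∂ n) x₁).symm z),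
        ⟨(extChartAt (𝓡∂ n) x₀).map_source (h₀ hzA), ?_⟩, ?_⟩
      · rw [mem_preimage, (extChartAt (𝓡∂ n) x₀).left_inv (h₀ hzA)]; exact hzA
      · rw [trans, Function.comp_apply, (extChartAt (𝓡∂ n) x₀).left_inv (h₀ hzA),
          (extChartAt (𝓡∂ n) x₁).right_inv hz]
    · rintro ⟨y, hy, rfl⟩
      refine ⟨trans_mem x₀ x₁ (hBo hy), ?_⟩
      rw [mem_preimage, symm_trans x₀ x₁ (hBo hy)]
      exact hy.2
  have hinj : InjOn (trans x₀ x₁) B := by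
    intro y hy z hz hyz
    have := congrArg (extChartAt (𝓡∂ n) x₁).symm hyz
    rw [symm_trans x₀ x₁ (hBo hy), symm_trans x₀ x₁ (hBo hz)] at this
    exact (extChartAt (𝓡∂ n) x₀).symm.injOn hy.1 hz.1 this
  rw [himg, lintegral_image_eq_lintegral_abs_det_fderiv_mul volume (measurableSet_target_inter x₀ hA)
    (f' := fderivWithin ℝ (trans x₀ x₁) (range (𝓡∂ n))) (fun y hy =>
      (differentiableWithinAt_trans x₀ x₁ (hBo hy)).hasFDerivWithinAt.mono
        fun z hz => (isHalfOpen_target x₀).subset hz.1) hinj]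
  refine setLIntegral_congr_fun (measurableSet_target_inter x₀ hA) fun y hy => ?_
  rw [det_fderivWithin_trans, volDensity_trans g x₀ x₁ (hBo hy), ENNReal.ofReal_mul (abs_nonneg _)]

/-- Local volumes agree on overlaps. Cutting a countable cover by chart domains into disjoint pieces
glues them to a measure that equals each local volume on its own domain. It dominates the supremum,
while the supremum dominates every local volume. -/
lemma volumeMeasure_apply [LindelofSpace W] (g : RMetric n W) (x₀ : W) {A : Set W}
    (hA : MeasurableSet A) (h₀ : A ⊆ (extChartAt (𝓡∂ n) x₀).source) :
    volumeMeasure g A = localVolume g x₀ A := by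
  obtain ⟨t, htc, ht⟩ := countable_cover_nhds (X := W)
    (U := fun x => (extChartAt (𝓡∂ n) x).source) fun x => extChartAt_source_mem_nhds x
  have hne : t.Nonempty := by
    by_contra h
    rw [not_nonempty_iff_eq_empty] at h
    have : x₀ ∈ ⋃ x ∈ t, (extChartAt (𝓡∂ n) x).source := ht ▸ mem_univ x₀
    simp [h] at this
  obtain ⟨c, rfl⟩ := htc.exists_eq_range hne
  set S : ℕ → Set W := fun i => (extChartAt (𝓡∂ n) (c i)).source with hS
  have hSu : ⋃ i, S i = univ := by rw [← ht, biUnion_range]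
  have hSm : ∀ i, MeasurableSet (S i) := fun i => (isOpen_extChartAt_source (c i)).measurableSet
  -- The glued measure: on each disjoint piece of the cover, the local volume of the corresponding
  -- chart.
  set ν : Measure W := Measure.sum fun i => (localVolume g (c i)).restrict (disjointed S i) with hν
  have hνA : ∀ (x : W) (A : Set W), MeasurableSet A → A ⊆ (extChartAt (𝓡∂ n) x).source →
      ν A = localVolume g x A := by
    intro x A hA hAx
    rw [hν, Measure.sum_apply _ hA]
    have h1 : ∀ i, (localVolume g (c i)).restrict (disjointed S i) A
        = localVolume g x (A ∩ disjointed S i) := by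
      intro i
      rw [Measure.restrict_apply hA]
      exact localVolume_eq g x (c i) (hA.inter (MeasurableSet.disjointed hSm i))
        (inter_subset_left.trans hAx) (inter_subset_right.trans (disjointed_subset S i))
    simp only [h1]
    rw [← measure_iUnion, ← inter_iUnion, iUnion_disjointed, hSu, inter_univ]
    · exact fun i j hij => (disjoint_disjointed S hij).mono inter_subset_right inter_subset_right
    · exact fun i => hA.inter (MeasurableSet.disjointed hSm i)
  have hle : volumeMeasure g ≤ ν := by
    refine iSup_le fun x => Measure.le_iff.mpr fun A hA => ?_
    rw [← localVolume_inter_source g x hA, ← hνA x _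
      (hA.inter (isOpen_extChartAt_source x).measurableSet) inter_subset_right]
    exact measure_mono inter_subset_left
  refine le_antisymm ?_ ?_
  · rw [← hνA x₀ A hA h₀]; exact hle A
  · exact le_iSup (fun x => localVolume g x) x₀ A

lemma volumeMeasure_restrict_source [LindelofSpace W] (g : RMetric n W) (x₀ : W) :
    (volumeMeasure g).restrict (extChartAt (𝓡∂ n) x₀).source = localVolume g x₀ := by
  ext A hA
  rw [Measure.restrict_apply hA, volumeMeasure_apply g x₀
    (hA.inter (isOpen_extChartAt_source x₀).measurableSet) inter_subset_right,
    localVolume_inter_source g x₀ hA]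

/-- The integral of a function supported in a chart domain. -/
lemma HasSmoothCoord.integral_volumeMeasure [LindelofSpace W] (hg : HasSmoothCoord g) (x₀ : W)
    {f : W → ℝ} (hf : Continuous f) (h0 : ∀ x ∉ (extChartAt (𝓡∂ n) x₀).source, f x = 0) :
    ∫ x, f x ∂(volumeMeasure g) = ∫ y in (extChartAt (𝓡∂ n) x₀).target,
      volDensity g x₀ y * f ((extChartAt (𝓡∂ n) x₀).symm y) := by
  rw [← setIntegral_eq_integral_of_forall_compl_eq_zero h0, volumeMeasure_restrict_source,
    localVolume, integral_map (aemeasurable_symm x₀ _) hf.measurable.aestronglyMeasurable,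
    show (fun y => ENNReal.ofReal √(metricCoord g x₀ y).det)
      = fun y => ENNReal.ofReal (volDensity g x₀ y) from rfl]
  erw [integral_withDensity_eq_integral_toReal_smul₀ (hg.aemeasurable_ofReal_volDensity x₀)
      (Eventually.of_forall fun _ => ENNReal.ofReal_lt_top)]
  refine integral_congr_ae (Eventually.of_forall fun y => ?_)
  simp only [smul_eq_mul]
  rw [ENNReal.toReal_ofReal (show 0 ≤ volDensity g x₀ y from Real.sqrt_nonneg _)]

lemma HasSmoothCoord.isFiniteMeasure [CompactSpace W] (hg : HasSmoothCoord g) :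
    IsFiniteMeasure (volumeMeasure g) := by
  suffices IsLocallyFiniteMeasure (volumeMeasure g) from
    ⟨isCompact_univ.measure_lt_top⟩
  refine ⟨fun x => ?_⟩
  set e := extChartAt (𝓡∂ n) x with he
  obtain ⟨r, hr, hball⟩ := Metric.mem_nhdsWithin_iff.mp (extChartAt_target_mem_nhdsWithin (I := 𝓡∂ n) x)
  have hK : IsCompact (Metric.closedBall (e x) (r / 2) ∩ range (𝓡∂ n)) :=
    (isCompact_closedBall _ _).inter_right (𝓡∂ n).isClosed_range
  have hKt : Metric.closedBall (e x) (r / 2) ∩ range (𝓡∂ n) ⊆ e.target := fun y hy =>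
    hball ⟨Metric.closedBall_subset_ball (by linarith) hy.1, hy.2⟩
  obtain ⟨C, hC⟩ := (hK.image_of_continuousOn ((hg.continuousOn_volDensity x).mono hKt)).bddAbove
  -- Halving the radius keeps the closed half-ball inside the chart target, where the continuous
  -- density is bounded by compactness.
  set U := e.source ∩ e ⁻¹' Metric.ball (e x) (r / 2) with hU
  have hUo : IsOpen U := (continuousOn_extChartAt x).isOpen_inter_preimage
    (isOpen_extChartAt_source x) Metric.isOpen_ball
  refine ⟨U, hUo.mem_nhds ⟨mem_extChartAt_source x, Metric.mem_ball_self (half_pos hr)⟩, ?_⟩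
  rw [volumeMeasure_apply g x hUo.measurableSet inter_subset_left,
    localVolume_apply g x hUo.measurableSet]
  have hsub : e.target ∩ e.symm ⁻¹' U ⊆ Metric.closedBall (e x) (r / 2) ∩ range (𝓡∂ n) := by
    rintro y ⟨hy, -, hy2⟩
    rw [mem_preimage, e.right_inv hy] at hy2
    exact ⟨Metric.ball_subset_closedBall hy2, extChartAt_target_subset_range x hy⟩
  calc ∫⁻ y in e.target ∩ e.symm ⁻¹' U, ENNReal.ofReal (volDensity g x y)
      ≤ ∫⁻ y in Metric.closedBall (e x) (r / 2) ∩ range (𝓡∂ n), ENNReal.ofReal (volDensity g x y) :=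
        lintegral_mono_set hsub
    _ ≤ ∫⁻ y in Metric.closedBall (e x) (r / 2) ∩ range (𝓡∂ n), ENNReal.ofReal C :=
        setLIntegral_mono' hK.measurableSet fun y hy =>
          ENNReal.ofReal_le_ofReal (hC (mem_image_of_mem _ hy))
    _ < ⊤ := by
        rw [setLIntegral_const]
        exact ENNReal.mul_lt_top ENNReal.ofReal_lt_top hK.measure_lt_top

lemma integrable_of_continuous [CompactSpace W] (hg : HasSmoothCoord g) {f : W → ℝ}
    (hf : Continuous f) : Integrable f (volumeMeasure g) := by
  have := hg.isFiniteMeasure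
  exact hf.integrable_of_hasCompactSupport (HasCompactSupport.of_compactSpace f)

/-- Each local boundary volume is pushed forward from {y⁰ = 0}, hence carried by ∂W, and this passes
to the supremum. Nothing more about this measure is needed, since the boundary integrand will vanish
on ∂W. -/
lemma bdryMeasure_compl_boundary (g : RMetric n W) :
    bdryMeasure g ((𝓡∂ n).boundary W)ᶜ = 0 := by
  have hm : MeasurableSet ((𝓡∂ n).boundary W) :=
    ((𝓡∂ n).isClosed_boundary (n := ∞) (by simp)).measurableSet
  have h1 : ∀ x₀ : W, localBdryVolume g x₀ ((𝓡∂ n).boundary W)ᶜ = 0 := by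
    intro x₀
    rw [localBdryVolume]
    -- If the map were not a.e. measurable, `Measure.map` would be the zero measure and the claim
    -- would hold by default.
    by_cases hae : AEMeasurable ((extChartAt (𝓡∂ n) x₀).symm ∘ bdryIncl)
      (((volume : Measure (TangIdx n → ℝ)).restrict
        (bdryIncl ⁻¹' (extChartAt (𝓡∂ n) x₀).target)).withDensity
        (fun z => ENNReal.ofReal √(tangBlock (metricCoord g x₀ (bdryIncl z))).det))
    · rw [Measure.map_apply_of_aemeasurable hae hm.compl]
      refine withDensity_absolutelyContinuous _ _ ?_
      have hincl : Continuous (bdryIncl : (TangIdx n → ℝ) → Coord n) := by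
        refine (PiLp.continuous_toLp 2 _).comp (continuous_pi fun i => ?_)
        by_cases h : i ≠ 0
        · simp only [h, ne_eq, not_false_eq_true, dite_true]; exact continuous_apply _
        · simp only [h, dite_false]; exact continuous_const
      rw [Measure.restrict_apply' (hincl.measurable (measurableSet_target x₀))]
      convert measure_empty (μ := volume)
      rw [eq_empty_iff_forall_notMem]
      rintro z ⟨hz1, hz2⟩
      exact hz1 (mem_boundary_of_coord_zero x₀ hz2 (by simp [bdryIncl]))
    · rw [Measure.map_of_not_aemeasurable hae]; rfl
  -- Each local measure equals its restriction to the boundary, so the supremum is bounded by its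
  -- own restriction.
  have h2 : bdryMeasure g ≤ (bdryMeasure g).restrict ((𝓡∂ n).boundary W) := by
    refine iSup_le fun x₀ => ?_
    rw [← Measure.restrict_eq_self_of_ae_mem (μ := localBdryVolume g x₀)
      (s := (𝓡∂ n).boundary W) (h1 x₀)]
    exact Measure.restrict_mono le_rfl (le_iSup (fun x => localBdryVolume g x) x₀)
  refine le_antisymm ((h2 _).trans ?_) zero_le
  rw [Measure.restrict_apply hm.compl, compl_inter_self, measure_empty]

end

variable (n W) in
lemma exists_partition [CompactSpace W] [T2Space W] : ∃ (s : Finset W) (χ : W → W → ℝ),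
    (∀ a, ContMDiff (𝓡∂ n) 𝓘(ℝ, ℝ) ∞ (χ a)) ∧
    (∀ a, tsupport (χ a) ⊆ (extChartAt (𝓡∂ n) a).source) ∧ ∀ x, ∑ a ∈ s, χ a x = 1 := by
  obtain ⟨f, hf⟩ := SmoothPartitionOfUnity.exists_isSubordinate_chartAt_source (𝓡∂ n) W
  have hfin : (Function.support fun i => (f i : W → ℝ)).Finite := by
    have := f.locallyFinite.finite_nonempty_of_compact
    refine this.subset fun i hi => ?_
    rw [Function.mem_support, Ne, funext_iff, not_forall] at hi
    obtain ⟨x, hx⟩ := hi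
    exact ⟨x, hx⟩
  refine ⟨hfin.toFinset, fun a => f a, fun a => (f a).contMDiff, fun a => ?_, fun x => ?_⟩
  · rw [extChartAt_source]; exact hf a
  · rw [← f.sum_eq_one (mem_univ x), finsum_eq_sum_of_support_subset]
    intro i hi
    rw [Finite.coe_toFinset, Function.mem_support]
    intro h0
    exact hi (by simp [show (f i : W → ℝ) x = 0 from congrFun h0 x])

end BoundaryRicci

/-! ### The divergence theorem on the half-space -/

namespace DiffAlg

variable {n : ℕ} [NeZero n]

/-- Integrate over a box resting on {y⁰ = 0}. The flux through this face vanishes because the field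
is tangential there, and the other faces lie outside the support. -/
lemma integral_divergence_halfSpace {F : Fin n → Coord n → ℝ}
    (hF : ∀ i, ContDiffOn ℝ 1 (F i) (range (𝓡∂ n))) {R : ℝ} (hR : ∀ i y, R < ‖y‖ → F i y = 0)
    (h0 : ∀ y, y 0 = 0 → F 0 y = 0) :
    ∫ y in range (𝓡∂ n), ∑ i, pd i (F i) y = 0 := by
  obtain ⟨m, rfl⟩ : ∃ m, n = m + 1 := Nat.exists_eq_succ_of_ne_zero (NeZero.ne n)
  wlog hR0 : 0 ≤ R generalizing R
  · exact this (R := 0) (fun i y hy => hR i y (by linarith)) le_rfl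
  have hcd : ∀ i, ContinuousOn (fun y => pd i (F i) y) (range (𝓡∂ (m + 1))) := fun i =>
    ((hF i).continuousOn_fderivWithin (𝓡∂ (m + 1)).uniqueDiffOn le_rfl).clm_apply continuousOn_const
  have hpd0 : ∀ i y, R < ‖y‖ → pd i (F i) y = 0 := by
    intro i y hy
    have h1 : F i =ᶠ[𝓝 y] fun _ => 0 := by
      filter_upwards [(isOpen_lt continuous_const continuous_norm).mem_nhds hy] with z hz
      exact hR i z hz
    rw [pd, (h1.filter_mono nhdsWithin_le_nhds).fderivWithin_eq h1.eq_of_nhds]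
    simp
  -- The box is [0, R+1] × [-(R+1), R+1]^m; the extra 1 places the outer faces strictly beyond
  -- radius R.
  set a : Fin (m + 1) → ℝ := fun i => if i = 0 then 0 else -(R + 1) with ha
  set b : Fin (m + 1) → ℝ := fun _ => R + 1 with hb
  have hab : a ≤ b := fun i => by
    simp only [ha, hb]; split_ifs <;> linarith
  let L := (PiLp.continuousLinearEquiv 2 ℝ (fun _ : Fin (m + 1) => ℝ)).symm
  have hL : ∀ x, L x = WithLp.toLp 2 x := fun _ => rfl
  have hrange : ∀ x : Fin (m + 1) → ℝ, L x ∈ range (𝓡∂ (m + 1)) ↔ 0 ≤ x 0 := fun x => by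
    rw [range_modelWithCornersEuclideanHalfSpace]; rfl
  have hIcc : MapsTo L (Icc a b) (range (𝓡∂ (m + 1))) := fun x hx =>
    (hrange x).mpr (by simpa [ha] using hx.1 0)
  have hout : ∀ (x : Fin (m + 1) → ℝ) i, R < |x i| → R < ‖L x‖ := fun x i h =>
    h.trans_le (PiLp.norm_apply_le (L x) i)
  let f' : (Fin (m + 1) → ℝ) → (Fin (m + 1) → ℝ) →L[ℝ] Fin (m + 1) → ℝ := fun x =>
    ContinuousLinearMap.pi fun i =>
      (fderivWithin ℝ (F i) (range (𝓡∂ (m + 1))) (L x)).comp L.toContinuousLinearMap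
  have hf' : ∀ x, ∑ i, f' x (Pi.single i 1) i = ∑ i, pd i (F i) (L x) := fun x => rfl
  have hcont : ContinuousOn (fun x => ∑ i, pd i (F i) (L x)) (Icc a b) :=
    continuousOn_finsetSum _ fun i _ => (hcd i).comp L.continuous.continuousOn hIcc
  have key := integral_divergence_of_hasFDerivAt_off_countable a b hab (fun x i => F i (L x)) f' ∅
    countable_empty
    (continuousOn_pi.mpr fun i => (hF i).continuousOn.comp L.continuous.continuousOn hIcc)
    (fun x hx => by
      have h1 : L x ∈ interior (range (𝓡∂ (m + 1))) := by
        rw [interior_range_modelWithCornersEuclideanHalfSpace]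
        have h : 0 < x 0 := by simpa [ha] using (hx.1 0 (mem_univ 0)).1
        exact h
      refine hasFDerivAt_pi.mpr fun i => ?_
      refine HasFDerivAt.comp x (g := F i) (f := L) ?_ L.toContinuousLinearMap.hasFDerivAt
      exact (((hF i).differentiableOn one_ne_zero _ (interior_subset h1)).hasFDerivWithinAt).hasFDerivAt
        (mem_interior_iff_mem_nhds.mp h1))
    (by
      simp only [hf']
      exact hcont.integrableOn_compact isCompact_Icc)
  simp only [hf'] at key
  have hfaces : ∀ i : Fin (m + 1),
      ((∫ x in Icc (a ∘ i.succAbove) (b ∘ i.succAbove), F i (L (i.insertNth (b i) x))) -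
        ∫ x in Icc (a ∘ i.succAbove) (b ∘ i.succAbove), F i (L (i.insertNth (a i) x))) = 0 := by
    intro i
    have h1 : ∀ x : Fin m → ℝ, F i (L (i.insertNth (b i) x)) = 0 := fun x =>
      hR i _ (hout _ i (by
        rw [Fin.insertNth_apply_same, abs_of_nonneg (by simp only [hb]; linarith)]
        simp only [hb]; linarith))
    have h2 : ∀ x : Fin m → ℝ, F i (L (i.insertNth (a i) x)) = 0 := fun x => by
      by_cases hi : i = 0
      · subst hi
        refine h0 _ ?_
        rw [hL]
        simp [ha]
      · refine hR i _ (hout _ i ?_)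
        rw [Fin.insertNth_apply_same]
        simp only [ha, hi, if_false]
        rw [abs_neg, abs_of_nonneg (by linarith)]; linarith
    simp only [h1, h2, integral_zero, sub_zero]
  rw [Finset.sum_eq_zero fun i _ => hfaces i] at key
  have hpre : L ⁻¹' range (𝓡∂ (m + 1)) = {x | 0 ≤ x 0} := by
    ext x; exact hrange x
  have hmeas : MeasurePreserving (L : (Fin (m + 1) → ℝ) → Coord (m + 1)) volume volume :=
    PiLp.volume_preserving_toLp (Fin (m + 1))
  rw [← hmeas.setIntegral_preimage_emb L.toHomeomorph.measurableEmbedding, hpre]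
  refine Eq.trans ?_ key
  refine setIntegral_eq_of_subset_of_forall_sdiff_eq_zero
    (measurableSet_le measurable_const (measurable_pi_apply 0)) (fun x hx => ?_) fun x hx => ?_
  · simpa [ha] using hx.1 0
  · obtain ⟨hx0, hx1⟩ := hx
    obtain ⟨i, hi⟩ : ∃ i, R < |x i| := by
      by_contra! hcon
      refine hx1 ⟨fun i => ?_, fun i => ?_⟩
      · have := (abs_le.mp (hcon i)).1
        simp only [ha]
        split_ifs with h
        · rw [h]; exact hx0
        · linarith
      · have := (abs_le.mp (hcon i)).2
        simp only [hb]; linarith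
    exact Finset.sum_eq_zero fun j _ => hpd0 j _ (hout x i hi)

/-- The divergence theorem for compactly supported vector fields on a relatively open subset of the
half-space which are tangential to the boundary. -/
lemma integral_divergence {Ω K : Set (Coord n)} (hΩ : IsHalfOpen Ω) (hK : IsCompact K)
    {F : Fin n → Coord n → ℝ} (hF : ∀ i, ContDiffOn ℝ 1 (F i) Ω)
    (hFK : ∀ i, ∀ y ∈ Ω, y ∉ K → F i y = 0) (hKΩ : K ⊆ Ω) (h0 : ∀ y ∈ Ω, y 0 = 0 → F 0 y = 0) :
    ∫ y in Ω, ∑ i, pd i (F i) y = 0 := by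
  -- Extension by zero stays C¹: points outside Ω have a neighbourhood disjoint from the compact set
  -- K, where the extension is zero.
  set F' : Fin n → Coord n → ℝ := fun i => Ω.indicator (F i) with hF'
  have hFz : ∀ i y, y ∉ K → F' i y = 0 := fun i y hy => by
    by_cases hyΩ : y ∈ Ω
    · exact (indicator_of_mem hyΩ _).trans (hFK i y hyΩ hy)
    · exact indicator_of_notMem hyΩ _
  have heq : ∀ i, ∀ y ∈ Ω, F' i =ᶠ[𝓝[range (𝓡∂ n)] y] F i := fun i y hy => by
    filter_upwards [hΩ.mem_nhds y hy] with z hz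
    exact indicator_of_mem hz _
  have heq0 : ∀ i, ∀ y, y ∉ Ω → F' i =ᶠ[𝓝 y] fun _ => 0 := fun i y hy => by
    filter_upwards [hK.isClosed.isOpen_compl.mem_nhds fun h => hy (hKΩ h)] with z hz
    exact hFz i z hz
  have hcd : ∀ i, ContDiffOn ℝ 1 (F' i) (range (𝓡∂ n)) := by
    intro i y hy
    by_cases hyΩ : y ∈ Ω
    · exact ((hF i y hyΩ).mono_of_mem_nhdsWithin (hΩ.mem_nhds y hyΩ)).congr_of_eventuallyEq
        (heq i y hyΩ) (indicator_of_mem hyΩ _)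
    · exact ((contDiffAt_const (c := (0 : ℝ))).congr_of_eventuallyEq
        (heq0 i y hyΩ)).contDiffWithinAt
  obtain ⟨R, hR⟩ := hK.isBounded.exists_norm_le
  have key := integral_divergence_halfSpace hcd (R := R)
    (fun i y hy => hFz i y fun h => absurd (hR y h) (not_le.mpr hy))
    (fun y hy => by
      by_cases hyΩ : y ∈ Ω
      · exact (indicator_of_mem hyΩ _).trans (h0 y hyΩ hy)
      · exact indicator_of_notMem hyΩ _)
  rw [setIntegral_eq_of_subset_of_forall_sdiff_eq_zero (𝓡∂ n).isClosed_range.measurableSet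
    hΩ.subset] at key
  · rw [← key]
    refine setIntegral_congr_fun hΩ.measurableSet fun y hy => ?_
    exact Finset.sum_congr rfl fun i _ => by
      rw [pd, pd, (heq i y hy).fderivWithin_eq (indicator_of_mem hy _)]
  · intro y hy
    refine Finset.sum_eq_zero fun i _ => ?_
    rw [pd, ((heq0 i y hy.2).filter_mono nhdsWithin_le_nhds).fderivWithin_eq
      (heq0 i y hy.2).eq_of_nhds]
    simp

end DiffAlg

/-! ### Smoothness of coordinate expressions -/

namespace DiffAlg

section Smooth

variable {E : Type*} [NormedAddCommGroup E] [NormedSpace ℝ E] {ι : Type*} [Fintype ι] [DecidableEq ι]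
  {s : Set E} {k : WithTop ℕ∞} {G : E → Matrix ι ι ℝ}

lemma contDiffOn_det (h : ∀ i j, ContDiffOn ℝ k (fun y => G y i j) s) :
    ContDiffOn ℝ k (fun y => (G y).det) s := by
  simp only [Matrix.det_apply]
  exact ContDiffOn.sum fun σ _ => (contDiffOn_prod fun i _ => h _ _).const_smul _

lemma contDiffOn_inv (h : ∀ i j, ContDiffOn ℝ k (fun y => G y i j) s)
    (hd : ∀ y ∈ s, (G y).det ≠ 0) (i j : ι) : ContDiffOn ℝ k (fun y => (G y)⁻¹ i j) s := by
  simp only [Matrix.inv_def, Matrix.smul_apply, smul_eq_mul, Ring.inverse_eq_inv', Matrix.adjugate_apply]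
  refine ((contDiffOn_det h).inv hd).mul (contDiffOn_det fun a b => ?_)
  by_cases ha : a = j
  · subst ha; simp only [Matrix.updateRow_self]; exact contDiffOn_const
  · simp only [Matrix.updateRow_ne ha]; exact h a b

lemma contDiffOn_sqrt_det (h : ∀ i j, ContDiffOn ℝ k (fun y => G y i j) s)
    (hd : ∀ y ∈ s, (G y).det ≠ 0) : ContDiffOn ℝ k (fun y => √(G y).det) s :=
  (contDiffOn_det h).sqrt hd

end Smooth

variable {n : ℕ} [NeZero n] {Ω : Set (Coord n)} (hΩ : IsHalfOpen Ω)
include hΩ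

lemma IsHalfOpen.contDiffOn_pd {k m : WithTop ℕ∞} {f : Coord n → ℝ} (hf : ContDiffOn ℝ k f Ω)
    (hmk : m + 1 ≤ k) (i : Fin n) : ContDiffOn ℝ m (pd i f) Ω := by
  refine ((hf.fderivWithin hΩ.uniqueDiffOn hmk).clm_apply
    (contDiffOn_const (c := basisVec i))).congr fun y hy => ?_
  rw [pd, hΩ.fderivWithin_eq f hy]

lemma IsHalfOpen.differentiableWithinAt {k : WithTop ℕ∞} {f : Coord n → ℝ} (hf : ContDiffOn ℝ k f Ω)
    (hk : k ≠ 0) {y : Coord n} (hy : y ∈ Ω) : DifferentiableWithinAt ℝ f (range (𝓡∂ n)) y :=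
  (hf.differentiableOn hk y hy).mono_of_mem_nhdsWithin (hΩ.mem_nhds y hy)

lemma IsHalfOpen.pd_mul {f h : Coord n → ℝ} (hf : ContDiffOn ℝ 1 f Ω) (hh : ContDiffOn ℝ 1 h Ω)
    {y : Coord n} (hy : y ∈ Ω) (i : Fin n) :
    pd i (fun z => f z * h z) y = pd i f y * h y + f y * pd i h y := by
  rw [pd, fderivWithin_fun_mul ((𝓡∂ n).uniqueDiffOn y (hΩ.subset hy))
    (hΩ.differentiableWithinAt hf one_ne_zero hy) (hΩ.differentiableWithinAt hh one_ne_zero hy)]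
  simp only [add_apply, smul_apply, smul_eq_mul, pd]
  ring

end DiffAlg

/-! ### Green's formula on W -/

namespace BoundaryRicci

open DiffAlg
open scoped Matrix

variable {n : ℕ} [NeZero n] {W : Type*} [TopologicalSpace W]
  [ChartedSpace (EuclideanHalfSpace n) W] [IsManifold (𝓡∂ n) ∞ W]

lemma continuous_of_chart {F : W → ℝ} (h : ∀ x₀, ContinuousOn
    (F ∘ (extChartAt (𝓡∂ n) x₀).symm) (extChartAt (𝓡∂ n) x₀).target) : Continuous F := by
  refine continuous_iff_continuousAt.mpr fun x => ?_
  have h1 := (h x).comp (continuousOn_extChartAt x) fun z hz => (extChartAt (𝓡∂ n) x).map_source hz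
  refine ((h1 x (mem_extChartAt_source x)).continuousAt (extChartAt_source_mem_nhds x)).congr ?_
  filter_upwards [extChartAt_source_mem_nhds (I := 𝓡∂ n) x] with z hz
  simp only [Function.comp_apply, (extChartAt (𝓡∂ n) x).left_inv hz]

lemma contDiffOn_chart {k : ℕ∞} {u : W → ℝ} (hu : ContMDiff (𝓡∂ n) 𝓘(ℝ, ℝ) k u) (x₀ : W) :
    ContDiffOn ℝ k (u ∘ (extChartAt (𝓡∂ n) x₀).symm) (extChartAt (𝓡∂ n) x₀).target :=
  contMDiffOn_iff_contDiffOn.mp (hu.comp_contMDiffOn ((contMDiffOn_extChartAt_symm x₀).of_le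
    (WithTop.coe_le_coe.mpr le_top)))

/-- The inner product `⟨∇f, ∇h⟩`. -/
def gradInner (g : RMetric n W) (f h : W → ℝ) (x : W) : ℝ :=
  coinnerM (metricMat g x) (diffVec f x) (diffVec h x)

variable {g : RMetric n W}

section coord

variable (x₀ : W)

lemma det_metricCoord_ne_zero {y : Coord n} (hy : y ∈ (extChartAt (𝓡∂ n) x₀).target) :
    (metricCoord g x₀ y).det ≠ 0 := (metricCoord_posDef x₀ g hy).det_pos.ne'

lemma gradInner_chart {f h : W → ℝ} (hf : ContMDiff (𝓡∂ n) 𝓘(ℝ, ℝ) 1 f)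
    (hh : ContMDiff (𝓡∂ n) 𝓘(ℝ, ℝ) 1 h) {y : Coord n} (hy : y ∈ (extChartAt (𝓡∂ n) x₀).target) :
    coinnerM (metricCoord g x₀ y) (fun i => pd i (f ∘ (extChartAt (𝓡∂ n) x₀).symm) y)
      (fun i => pd i (h ∘ (extChartAt (𝓡∂ n) x₀).symm) y)
      = gradInner g f h ((extChartAt (𝓡∂ n) x₀).symm y) := by
  rw [diffVec_chart x₀ hy (hf.mdifferentiable one_ne_zero _),
    diffVec_chart x₀ hy (hh.mdifferentiable one_ne_zero _), metricCoord_eq_chartMat,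
    coinnerM_sandwich (isUnit_chartMat x₀ hy), gradInner]

/-- The vector density `√(det G) ∇f` in the chart around `x₀`. -/
def flux (g : RMetric n W) (x₀ : W) (f : W → ℝ) (i : Fin n) (z : Coord n) : ℝ :=
  √(metricCoord g x₀ z).det * ∑ j, (metricCoord g x₀ z)⁻¹ i j *
    pd j (f ∘ (extChartAt (𝓡∂ n) x₀).symm) z

lemma HasSmoothCoord.contDiffOn_flux (hg : HasSmoothCoord g) {f : W → ℝ}
    (hf : ContMDiff (𝓡∂ n) 𝓘(ℝ, ℝ) ∞ f) (i : Fin n) :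
    ContDiffOn ℝ ∞ (flux g x₀ f i) (extChartAt (𝓡∂ n) x₀).target :=
  (contDiffOn_sqrt_det (hg x₀) fun _ hy => det_metricCoord_ne_zero x₀ hy).mul
    (ContDiffOn.sum fun j _ => (contDiffOn_inv (hg x₀) (fun _ hy => det_metricCoord_ne_zero x₀ hy) i j).mul
      ((isHalfOpen_target x₀).contDiffOn_pd (contDiffOn_chart hf x₀) (by simp) j))

/-- In this form Δf times the volume density is a Euclidean divergence, to which the divergence
theorem applies. -/
lemma volDensity_mul_laplace (hg : HasSmoothCoord g) {f : W → ℝ}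
    (hf : ContMDiff (𝓡∂ n) 𝓘(ℝ, ℝ) ∞ f) {y : Coord n} (hy : y ∈ (extChartAt (𝓡∂ n) x₀).target) :
    volDensity g x₀ y * laplace g f ((extChartAt (𝓡∂ n) x₀).symm y) = ∑ i, pd i (flux g x₀ f i) y := by
  rw [← laplaceCoord_eq hg x₀ hf hy, laplaceCoord, volDensity, mul_inv_cancel_left₀]
  · rfl
  · exact (Real.sqrt_pos.mpr (metricCoord_posDef x₀ g hy).det_pos).ne'

lemma continuous_laplace (hg : HasSmoothCoord g) {f : W → ℝ}
    (hf : ContMDiff (𝓡∂ n) 𝓘(ℝ, ℝ) ∞ f) : Continuous (laplace g f) := by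
  refine continuous_of_chart (n := n) fun x₀ => ?_
  have h1 : ContinuousOn (fun y => (volDensity g x₀ y)⁻¹ * ∑ i, pd i (flux g x₀ f i) y)
      (extChartAt (𝓡∂ n) x₀).target :=
    ((hg.continuousOn_volDensity x₀).inv₀ fun y hy =>
      (Real.sqrt_pos.mpr (metricCoord_posDef x₀ g hy).det_pos).ne').mul
      (continuousOn_finsetSum _ fun i _ => ((isHalfOpen_target x₀).contDiffOn_pd (m := 0)
        (hg.contDiffOn_flux x₀ hf i) (by simp) i).continuousOn)
  refine h1.congr fun y hy => ?_
  simp only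
  rw [← volDensity_mul_laplace x₀ hg hf hy, inv_mul_cancel_left₀]
  · rfl
  · exact (Real.sqrt_pos.mpr (metricCoord_posDef x₀ g hy).det_pos).ne'

lemma continuousOn_pd_chart {f : W → ℝ} (hf : ContMDiff (𝓡∂ n) 𝓘(ℝ, ℝ) 1 f) (i : Fin n) :
    ContinuousOn (pd i (f ∘ (extChartAt (𝓡∂ n) x₀).symm)) (extChartAt (𝓡∂ n) x₀).target :=
  ((isHalfOpen_target x₀).contDiffOn_pd (m := 0) (contDiffOn_chart (k := 1) hf x₀) (by simp) i).continuousOn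

lemma continuous_gradInner (hg : HasSmoothCoord g) {f h : W → ℝ}
    (hf : ContMDiff (𝓡∂ n) 𝓘(ℝ, ℝ) 1 f) (hh : ContMDiff (𝓡∂ n) 𝓘(ℝ, ℝ) 1 h) :
    Continuous (gradInner g f h) := by
  refine continuous_of_chart (n := n) fun x₀ => ?_
  refine ContinuousOn.congr ?_ fun y hy => (gradInner_chart x₀ hf hh hy).symm
  simp only [coinnerM, dotProduct, Matrix.mulVec]
  exact continuousOn_finsetSum _ fun i _ => (continuousOn_pd_chart x₀ hf i).mul
    (continuousOn_finsetSum _ fun j _ => (contDiffOn_inv (hg x₀)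
      (fun _ hy => det_metricCoord_ne_zero x₀ hy) i j).continuousOn.mul (continuousOn_pd_chart x₀ hh j))

lemma apply_zero_of_mem_boundary {x : W} (hx : x ∈ (𝓡∂ n).boundary W) :
    (extChartAt (𝓡∂ n) x x : Coord n) 0 = 0 := by
  have h1 : (𝓡∂ n).IsBoundaryPoint x := hx
  rw [ModelWithCorners.IsBoundaryPoint, frontier_range_modelWithCornersEuclideanHalfSpace] at h1
  exact h1.symm

/-- Changes of charts preserve the tangent space of the boundary. -/
lemma chartMat_zero_apply {y : Coord n} (hy : y ∈ (extChartAt (𝓡∂ n) x₀).target) (h0 : y 0 = 0)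
    {j : Fin n} (hj : j ≠ 0) : chartMat x₀ y 0 j = 0 := by
  set x := (extChartAt (𝓡∂ n) x₀).symm y with hx
  rw [chartMat_eq_jac x₀ hy, jac, Matrix.of_apply]
  set φ : Coord n → Coord n := trans x₀ x with hφ
  have hyo := mem_overlap_symm x₀ hy
  have hd := (differentiableWithinAt_trans x₀ x hyo).hasFDerivWithinAt
  have hd0 : HasFDerivWithinAt (fun z => φ z 0)
      ((EuclideanSpace.proj (0 : Fin n)).comp (fderivWithin ℝ φ (range (𝓡∂ n)) y)) (range (𝓡∂ n)) y :=
    (EuclideanSpace.proj (𝕜 := ℝ) (0 : Fin n)).hasFDerivAt.comp_hasFDerivWithinAt y hd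
  -- The zeroth coordinate of the transition map is nonnegative and vanishes at boundary points, so
  -- it has a minimum there.
  have hmin : IsLocalMinOn (fun z => φ z 0) (range (𝓡∂ n)) y := by
    filter_upwards [(isHalfOpen_overlap x₀ x).mem_nhds y hyo] with z hz
    have h1 : φ y 0 = 0 := apply_zero_of_mem_boundary (mem_boundary_of_coord_zero x₀ hy h0)
    have h2 := extChartAt_target_subset_range x (trans_mem x₀ x hz)
    rw [range_modelWithCornersEuclideanHalfSpace] at h2
    rw [h1]
    exact h2
  -- For j ≠ 0 both directions ±eⱼ stay in the half-space, so the derivative at the minimum vanishes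
  -- along eⱼ.
  have hcone : ∀ c : ℝ, c • basisVec j ∈ posTangentConeAt (range (𝓡∂ n)) y := by
    intro c
    refine mem_posTangentConeAt_of_segment_subset ?_
    rw [segment_eq_image']
    rintro _ ⟨θ, -, rfl⟩
    rw [range_modelWithCornersEuclideanHalfSpace]
    simp [basisVec, h0, Ne.symm hj]
  exact hmin.hasFDerivWithinAt_eq_zero hd0 (by simpa using hcone 1) (by simpa using hcone (-1))

lemma inv_metricMat_zero_pos (g : RMetric n W) (x : W) : 0 < (metricMat g x)⁻¹ 0 0 :=
  (metricMat_posDef g x).inv.diag_pos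

lemma normalDeriv_eq (g : RMetric n W) (f : W → ℝ) (x : W) : normalDeriv g f x
    = -(((metricMat g x)⁻¹ *ᵥ diffVec f x) 0 / √((metricMat g x)⁻¹ 0 0)) := by
  rw [normalDeriv, dirDeriv_eq_sum, Matrix.mulVec, dotProduct, Finset.sum_div, ← Finset.sum_neg_distrib]
  refine Finset.sum_congr rfl fun i _ => ?_
  have hs : (metricMat g x)⁻¹ i 0 = (metricMat g x)⁻¹ 0 i :=
    congrFun (congrFun (inv_metricMat_symm (g := g) x) 0) i
  simp only [outNormal, diffVec, hs]
  ring

/-- The normal component of the gradient in an arbitrary chart. -/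
lemma flux_zero_eq_zero {f : W → ℝ} (hf : ContMDiff (𝓡∂ n) 𝓘(ℝ, ℝ) 1 f)
    (hν : ∀ x ∈ (𝓡∂ n).boundary W, normalDeriv g f x = 0) {y : Coord n}
    (hy : y ∈ (extChartAt (𝓡∂ n) x₀).target) (h0 : y 0 = 0) : flux g x₀ f 0 y = 0 := by
  set x := (extChartAt (𝓡∂ n) x₀).symm y with hx
  have h1 := hν x (mem_boundary_of_coord_zero x₀ hy h0)
  rw [normalDeriv_eq, neg_eq_zero, div_eq_zero_iff] at h1
  have h2 := h1.resolve_right (Real.sqrt_pos.mpr (inv_metricMat_zero_pos g x)).ne'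
  set v := (metricMat g x)⁻¹ *ᵥ diffVec f x with hv
  set J := chartMat x₀ y with hJ
  have hJu : IsUnit J.det := isUnit_chartMat x₀ hy
  have hw : (metricCoord g x₀ y)⁻¹ *ᵥ (fun j => pd j (f ∘ (extChartAt (𝓡∂ n) x₀).symm) y)
      = J⁻¹ *ᵥ v := by
    rw [diffVec_chart x₀ hy (hf.mdifferentiable one_ne_zero _), metricCoord_eq_chartMat]
    exact inv_sandwich_mulVec hJu _
  -- The zeroth row of J has only its diagonal entry: a change of charts rescales the normal
  -- component by a nonzero factor, so its vanishing does not depend on the chart.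
  have hJ0 : ∀ w : Fin n → ℝ, (J *ᵥ w) 0 = J 0 0 * w 0 := fun w => by
    rw [Matrix.mulVec, dotProduct, Finset.sum_eq_single 0]
    · intro j _ hj
      rw [hJ, chartMat_zero_apply x₀ hy h0 hj, zero_mul]
    · simp
  have hJ00 : J 0 0 ≠ 0 := by
    intro h
    have h3 := hJ0 (J⁻¹ *ᵥ Pi.single 0 1)
    rw [Matrix.mulVec_mulVec, Matrix.mul_nonsing_inv _ hJu, Matrix.one_mulVec, h] at h3
    simp at h3
  have h4 := hJ0 (J⁻¹ *ᵥ v)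
  rw [Matrix.mulVec_mulVec, Matrix.mul_nonsing_inv _ hJu, Matrix.one_mulVec, h2] at h4
  have h5 : (J⁻¹ *ᵥ v) 0 = 0 := (mul_eq_zero.mp h4.symm).resolve_left hJ00
  rw [← hw] at h5
  rw [flux]
  exact mul_eq_zero_of_right _ h5

end coord

lemma diffVec_sum {κ : Type*} (s : Finset κ) {f : κ → W → ℝ} (x : W)
    (hf : ∀ a, MDifferentiableAt (𝓡∂ n) 𝓘(ℝ, ℝ) (f a) x) (i : Fin n) :
    diffVec (n := n) (fun x => ∑ a ∈ s, f a x) x i = ∑ a ∈ s, diffVec (n := n) (f a) x i := by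
  classical
  have h : ∀ s : Finset κ, MDifferentiableAt (𝓡∂ n) 𝓘(ℝ, ℝ) (fun x => ∑ a ∈ s, f a x) x ∧
      diffVec (n := n) (fun x => ∑ a ∈ s, f a x) x i = ∑ a ∈ s, diffVec (n := n) (f a) x i := by
    intro s
    induction s using Finset.induction_on with
    | empty =>
      simp only [Finset.sum_empty]
      refine ⟨mdifferentiableAt_const, ?_⟩
      rw [diffVec, dirDeriv, mfderiv_const]
      rfl
    | insert a s ha ih =>
      simp only [Finset.sum_insert ha]
      have h1 := (hf a).hasMFDerivAt.add ih.1.hasMFDerivAt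
      refine ⟨h1.mdifferentiableAt, ?_⟩
      rw [← ih.2, diffVec, dirDeriv]
      erw [h1.mfderiv]
      rfl
  exact (h s).2

variable [CompactSpace W] [T2Space W] [MeasurableSpace W] [BorelSpace W]

/-- Green's formula for a function supported in a chart domain. -/
lemma green_chart (hg : HasSmoothCoord g) {f : W → ℝ} (hf : ContMDiff (𝓡∂ n) 𝓘(ℝ, ℝ) ∞ f)
    (hν : ∀ x ∈ (𝓡∂ n).boundary W, normalDeriv g f x = 0) (x₀ : W) {h : W → ℝ}
    (hh : ContMDiff (𝓡∂ n) 𝓘(ℝ, ℝ) 1 h) (hs : tsupport h ⊆ (extChartAt (𝓡∂ n) x₀).source) :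
    ∫ x, (gradInner g h f x + h x * laplace g f x) ∂(volumeMeasure g) = 0 := by
  have hf1 : ContMDiff (𝓡∂ n) 𝓘(ℝ, ℝ) 1 f := hf.of_le (by exact_mod_cast le_top)
  have hΩ := isHalfOpen_target (n := n) x₀
  have h0 : ∀ x ∉ (extChartAt (𝓡∂ n) x₀).source, gradInner g h f x + h x * laplace g f x = 0 := by
    intro x hx
    have h1 : h =ᶠ[𝓝 x] fun _ => 0 :=
      notMem_tsupport_iff_eventuallyEq.mp fun h2 => hx (hs h2)
    have h2 : diffVec (n := n) h x = 0 := by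
      funext i
      rw [diffVec, dirDeriv, h1.mfderiv_eq, mfderiv_const]
      rfl
    rw [h1.eq_of_nhds, gradInner, h2, coinnerM, zero_dotProduct, zero_mul, add_zero]
  have hc : Continuous fun x => gradInner g h f x + h x * laplace g f x :=
    (continuous_gradInner hg hh hf1).add (hh.continuous.mul (continuous_laplace hg hf))
  rw [hg.integral_volumeMeasure x₀ hc h0]
  set k := h ∘ (extChartAt (𝓡∂ n) x₀).symm with hk
  have hkd : ContDiffOn ℝ 1 k (extChartAt (𝓡∂ n) x₀).target := contDiffOn_chart (k := 1) hh x₀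
  have hfl : ∀ i, ContDiffOn ℝ 1 (flux g x₀ f i) (extChartAt (𝓡∂ n) x₀).target := fun i =>
    (hg.contDiffOn_flux x₀ hf i).of_le (by exact_mod_cast le_top)
  -- The field h√(det G)∇f has divergence √(det G)(⟨∇h,∇f⟩ + hΔf), is supported in the compact image
  -- of supp h, and is tangential because ∂_ν f = 0.
  rw [← integral_divergence hΩ (K := extChartAt (𝓡∂ n) x₀ '' tsupport h)
    (F := fun i y => k y * flux g x₀ f i y)]
  · refine setIntegral_congr_fun hΩ.measurableSet fun y hy => ?_
    rw [mul_add, ← gradInner_chart x₀ hh hf1 hy, mul_left_comm, volDensity_mul_laplace x₀ hg hf hy]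
    simp only [hΩ.pd_mul hkd (hfl _) hy]
    rw [Finset.sum_add_distrib, ← Finset.mul_sum]
    congr 1
    rw [coinnerM, dotProduct, Finset.mul_sum]
    exact Finset.sum_congr rfl fun i _ => by
      rw [flux, Matrix.mulVec, dotProduct, volDensity]; ring
  · exact (isClosed_tsupport h).isCompact.image_of_continuousOn
      ((continuousOn_extChartAt x₀).mono hs)
  · exact fun i => hkd.mul (hfl i)
  · intro i y hy hyK
    have : h ((extChartAt (𝓡∂ n) x₀).symm y) = 0 := by
      by_contra hne
      exact hyK ⟨_, subset_tsupport h hne, (extChartAt (𝓡∂ n) x₀).right_inv hy⟩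
    simp only [hk, Function.comp_apply, this, zero_mul]
  · rintro _ ⟨x, hx, rfl⟩
    exact (extChartAt (𝓡∂ n) x₀).map_source (hs hx)
  · intro y hy hy0
    simp only [flux_zero_eq_zero x₀ hf1 hν hy hy0, mul_zero]

/-- Green's formula for functions whose normal derivative vanishes. -/
theorem green (hg : HasSmoothCoord g) {f : W → ℝ} (hf : ContMDiff (𝓡∂ n) 𝓘(ℝ, ℝ) ∞ f)
    (hν : ∀ x ∈ (𝓡∂ n).boundary W, normalDeriv g f x = 0) {h : W → ℝ}
    (hh : ContMDiff (𝓡∂ n) 𝓘(ℝ, ℝ) 1 h) :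
    ∫ x, (gradInner g h f x + h x * laplace g f x) ∂(volumeMeasure g) = 0 := by
  have hf1 : ContMDiff (𝓡∂ n) 𝓘(ℝ, ℝ) 1 f := hf.of_le (by exact_mod_cast le_top)
  obtain ⟨s, χ, hχ, hχs, hχ1⟩ := exists_partition n W
  -- The cut-off is applied to h and not to f, so that the Neumann condition on f is preserved.
  have hχh : ∀ a, ContMDiff (𝓡∂ n) 𝓘(ℝ, ℝ) 1 (fun x => χ a x * h x) := fun a =>
    ((hχ a).of_le (by exact_mod_cast le_top)).mul hh
  have hsum : (fun x => ∑ a ∈ s, χ a x * h x) = h := by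
    funext x; rw [← Finset.sum_mul, hχ1, one_mul]
  have hd : ∀ x, diffVec (n := n) h x = ∑ a ∈ s, diffVec (n := n) (fun x => χ a x * h x) x := by
    intro x
    funext i
    rw [Finset.sum_apply, ← diffVec_sum (n := n) s x (fun a => (hχh a).mdifferentiable one_ne_zero x),
      hsum]
  have hpt : ∀ x, gradInner g h f x + h x * laplace g f x
      = ∑ a ∈ s, (gradInner g (fun x => χ a x * h x) f x + (χ a x * h x) * laplace g f x) := by
    intro x
    rw [Finset.sum_add_distrib, ← Finset.sum_mul, show ∑ a ∈ s, χ a x * h x = h x from congrFun hsum x]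
    congr 1
    simp only [gradInner, coinnerM]
    rw [hd x, sum_dotProduct]
  simp only [hpt]
  rw [integral_finsetSum]
  · exact Finset.sum_eq_zero fun a _ => green_chart hg hf hν a (hχh a)
      ((tsupport_mul_subset_left).trans (hχs a))
  · exact fun a _ => integrable_of_continuous hg ((continuous_gradInner hg (hχh a) hf1).add
      ((hχh a).continuous.mul (continuous_laplace hg hf)))

end BoundaryRicci

/-! ### Differentiation of inverse matrices and of integrals -/

namespace DiffAlg

section

variable {S : Set ℝ} {t : ℝ}

/-- Inversion is smooth where det ≠ 0, so a derivative exists; differentiating G⁻¹G = 1 determines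
its value. -/
lemma hasDerivWithinAt_inv {ι : Type*} [Fintype ι] [DecidableEq ι] {G : ℝ → Matrix ι ι ℝ}
    {G' : Matrix ι ι ℝ} (hS : UniqueDiffWithinAt ℝ S t)
    (h : ∀ i j, HasDerivWithinAt (fun s => G s i j) (G' i j) S t)
    (hd : ∀ s ∈ S, (G s).det ≠ 0) (ht : t ∈ S) (i j : ι) :
    HasDerivWithinAt (fun s => (G s)⁻¹ i j) (-((G t)⁻¹ * G' * (G t)⁻¹) i j) S t := by
  have hdiff : ∀ i j, DifferentiableWithinAt ℝ (fun s => (G s)⁻¹ i j) S t := by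
    intro i j
    have h1 : ContDiffOn ℝ 1 (fun M : ι → ι → ℝ => (Matrix.of M)⁻¹ i j)
        {M : ι → ι → ℝ | (Matrix.of M).det ≠ 0} :=
      contDiffOn_inv (G := fun M : ι → ι → ℝ => Matrix.of M)
        (fun i j => (contDiff_apply_apply ℝ ℝ i j).contDiffOn) (fun _ hM => hM) i j
    have h2 : DifferentiableWithinAt ℝ (fun s => fun i j => G s i j) S t :=
      differentiableWithinAt_pi.mpr fun i => differentiableWithinAt_pi.mpr fun j =>
        (h i j).differentiableWithinAt
    exact (h1.differentiableOn one_ne_zero (fun i j => G t i j) (hd t ht)).comp t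
      (t := {M : ι → ι → ℝ | (Matrix.of M).det ≠ 0}) h2 fun s hs => hd s hs
  choose Q' hQ' using fun i j => (⟨_, (hdiff i j).hasDerivWithinAt⟩ :
    ∃ c, HasDerivWithinAt (fun s => (G s)⁻¹ i j) c S t)
  have hprod : ∀ i j, ∑ k, (Q' i k * G t k j + (G t)⁻¹ i k * G' k j) = 0 := by
    intro i j
    have h1 : HasDerivWithinAt (fun s => ∑ k, (G s)⁻¹ i k * G s k j)
        (∑ k, (Q' i k * G t k j + (G t)⁻¹ i k * G' k j)) S t :=
      HasDerivWithinAt.fun_sum fun k _ => (hQ' i k).mul (h k j)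
    have h2 : ∀ s ∈ S, (∑ k, (G s)⁻¹ i k * G s k j) = (1 : Matrix ι ι ℝ) i j := by
      intro s hs
      rw [← Matrix.nonsing_inv_mul (G s) (isUnit_iff_ne_zero.mpr (hd s hs)), Matrix.mul_apply]
    exact hS.eq_deriv _ h1 ((hasDerivWithinAt_const t S _).congr h2 (h2 t ht))
  have hmat : Matrix.of Q' = -((G t)⁻¹ * G' * (G t)⁻¹) := by
    have h1 : Matrix.of Q' * G t = -((G t)⁻¹ * G') := by
      rw [eq_neg_iff_add_eq_zero]
      ext i j
      rw [Matrix.add_apply, Matrix.mul_apply, Matrix.mul_apply, ← Finset.sum_add_distrib]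
      exact hprod i j
    have hu : IsUnit (G t).det := isUnit_iff_ne_zero.mpr (hd t ht)
    calc Matrix.of Q' = Matrix.of Q' * G t * (G t)⁻¹ := by
          rw [mul_assoc, Matrix.mul_nonsing_inv _ hu, mul_one]
      _ = _ := by rw [h1, Matrix.neg_mul]
  have h3 := hQ' i j
  have h4 : Q' i j = -((G t)⁻¹ * G' * (G t)⁻¹) i j := congrFun (congrFun hmat i) j
  rwa [h4] at h3

end

/-- Differentiation under the integral sign over a compact set, one-sided at `0`. -/
lemma hasDerivWithinAt_setIntegral {E : Type*} [TopologicalSpace E] [T2Space E] [MeasurableSpace E]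
    [BorelSpace E] {μ : Measure E} [IsFiniteMeasureOnCompacts μ]
    {T : ℝ} {K : Set E} (hK : IsCompact K) {k k' : ℝ × E → ℝ}
    (hk : ContinuousOn k (Ico 0 T ×ˢ K)) (hk' : ContinuousOn k' (Ico 0 T ×ˢ K))
    (hd : ∀ t ∈ Ico 0 T, ∀ y ∈ K, HasDerivWithinAt (fun s => k (s, y)) (k' (t, y)) (Ico 0 T) t)
    {t : ℝ} (ht : t ∈ Ico 0 T) :
    HasDerivWithinAt (fun s => ∫ y in K, k (s, y) ∂μ) (∫ y in K, k' (t, y) ∂μ) (Ico 0 T) t := by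
  -- The compact interval [0,b] is a neighbourhood of t in [0,T), and on [0,b] × K the derivative is
  -- bounded by a constant C.
  obtain ⟨b, hb1, hb2⟩ := exists_between ht.2
  have hsub : Icc 0 b ⊆ Ico 0 T := fun s hs => ⟨hs.1, hs.2.trans_lt hb2⟩
  obtain ⟨C, hC⟩ := ((isCompact_Icc (a := (0 : ℝ)) (b := b)).prod hK).exists_bound_of_continuousOn
    (hk'.mono (prod_mono_left hsub))
  have hslice : ∀ s ∈ Ico 0 T, ContinuousOn (fun y => k (s, y)) K := fun s hs =>
    hk.comp (continuous_const.prodMk continuous_id).continuousOn fun y hy => ⟨hs, hy⟩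
  have hint : ∀ s ∈ Ico 0 T, IntegrableOn (fun y => k (s, y)) K μ := fun s hs =>
    (hslice s hs).integrableOn_compact hK
  rw [hasDerivWithinAt_iff_tendsto_slope]
  have hev : ∀ᶠ s in 𝓝[Ico 0 T \ {t}] t, s ∈ Icc 0 b ∧ s ≠ t := by
    filter_upwards [self_mem_nhdsWithin, mem_nhdsWithin_of_mem_nhds (Iio_mem_nhds hb1)] with s hs hs2
    exact ⟨⟨hs.1.1, le_of_lt hs2⟩, hs.2⟩
  have hlim : Tendsto (fun s => ∫ y in K, slope (fun r => k (r, y)) t s ∂μ) (𝓝[Ico 0 T \ {t}] t)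
      (𝓝 (∫ y in K, k' (t, y) ∂μ)) := by
    refine tendsto_integral_filter_of_dominated_convergence (fun _ => C) ?_ ?_ ?_ ?_
    · filter_upwards [hev] with s hs
      simp only [slope_def_field]
      exact (((hslice s (hsub hs.1)).sub (hslice t ht)).div_const _).aestronglyMeasurable
        hK.measurableSet
    · filter_upwards [hev] with s hs
      refine (ae_restrict_iff' hK.measurableSet).mpr (Eventually.of_forall fun y hy => ?_)
      -- The mean value inequality bounds the difference quotients by C, which gives the dominating
      -- function.
      have h1 := (convex_Icc (0 : ℝ) b).norm_image_sub_le_of_norm_hasDerivWithin_le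
        (f := fun r => k (r, y)) (f' := fun r => k' (r, y)) (C := C)
        (fun r hr => (hd r (hsub hr) y hy).mono hsub) (fun r hr => hC (r, y) ⟨hr, hy⟩)
        (x := t) (y := s) ⟨ht.1, hb1.le⟩ hs.1
      rw [slope_def_field, norm_div]
      exact div_le_of_le_mul₀ (norm_nonneg _) ((norm_nonneg _).trans (hC (t, y) ⟨⟨ht.1, hb1.le⟩, hy⟩)) h1
    · exact integrableOn_const hK.measure_lt_top.ne
    · refine (ae_restrict_iff' hK.measurableSet).mpr (Eventually.of_forall fun y hy => ?_)
      exact hasDerivWithinAt_iff_tendsto_slope.mp (hd t ht y hy)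
  refine hlim.congr' ?_
  filter_upwards [hev] with s hs
  simp only [slope_def_field]
  rw [integral_div, integral_sub (hint s (hsub hs.1)) (hint t ht)]

end DiffAlg

/-! ### Derivatives of integrals along the flow -/

namespace BoundaryRicci

open DiffAlg

variable {n : ℕ} [NeZero n] {W : Type*} [TopologicalSpace W]
  [ChartedSpace (EuclideanHalfSpace n) W] [IsManifold (𝓡∂ n) ∞ W] {T : ℝ}

variable (n) in
/-- Joint continuity of a family of functions on `W × [0, T)`. -/
def ContinuousFamily (T : ℝ) (f : ℝ → W → ℝ) : Prop :=
  ∀ x₀ : W, ContinuousOn (fun q : ℝ × Coord n => f q.1 ((extChartAt (𝓡∂ n) x₀).symm q.2))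
    (Ico 0 T ×ˢ (extChartAt (𝓡∂ n) x₀).target)

namespace ContinuousFamily

variable {f h : ℝ → W → ℝ}

lemma add (hf : ContinuousFamily n T f) (hh : ContinuousFamily n T h) :
    ContinuousFamily n T fun t x => f t x + h t x := fun x₀ => (hf x₀).add (hh x₀)

lemma sub (hf : ContinuousFamily n T f) (hh : ContinuousFamily n T h) :
    ContinuousFamily n T fun t x => f t x - h t x := fun x₀ => (hf x₀).sub (hh x₀)

lemma mul (hf : ContinuousFamily n T f) (hh : ContinuousFamily n T h) :
    ContinuousFamily n T fun t x => f t x * h t x := fun x₀ => (hf x₀).mul (hh x₀)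

lemma const_mul (c : ℝ) (hf : ContinuousFamily n T f) :
    ContinuousFamily n T fun t x => c * f t x := fun x₀ => continuousOn_const.mul (hf x₀)

lemma pow (hf : ContinuousFamily n T f) (k : ℕ) :
    ContinuousFamily n T fun t x => f t x ^ k := fun x₀ => (hf x₀).pow k

lemma rpow (hf : ContinuousFamily n T f) (hpos : ∀ t ∈ Ico 0 T, ∀ x, 0 < f t x) (p : ℝ) :
    ContinuousFamily n T fun t x => f t x ^ p := fun x₀ =>
  (hf x₀).rpow_const fun q hq => Or.inl (hpos q.1 hq.1 _).ne'

lemma slice (hf : ContinuousFamily n T f) {t : ℝ} (ht : t ∈ Ico 0 T) : Continuous (f t) :=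
  continuous_of_chart (n := n) fun x₀ => (hf x₀).comp
    (continuous_const.prodMk continuous_id).continuousOn fun _ hy => ⟨ht, hy⟩

end ContinuousFamily

variable [CompactSpace W] [T2Space W] [MeasurableSpace W] [BorelSpace W] {g : ℝ → RMetric n W}

/-- The derivative of integrals along a Ricci flow, whose volume form evolves by `-R`. -/
theorem IsBoundaryRicciFlow.hasDerivWithinAt_integral (hg : IsBoundaryRicciFlow T g)
    {f f' : ℝ → W → ℝ} (hf : ContinuousFamily n T f) (hf' : ContinuousFamily n T f')
    (hd : ∀ t ∈ Ico 0 T, ∀ x, HasDerivWithinAt (fun s => f s x) (f' t x) (Ico 0 T) t)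
    {t : ℝ} (ht : t ∈ Ico 0 T) :
    HasDerivWithinAt (fun s => ∫ x, f s x ∂(volumeMeasure (g s)))
      (∫ x, (f' t x - scal (g t) x * f t x) ∂(volumeMeasure (g t))) (Ico 0 T) t := by
  obtain ⟨s, χ, hχ, hχs, hχ1⟩ := exists_partition n W
  have hscal : ContinuousFamily n T fun t x => scal (g t) x := fun x₀ =>
    (hg.contDiffOn_scal x₀).continuousOn
  obtain ⟨F, hF⟩ : ∃ F : ℝ → W → ℝ, ∀ t x, F t x = f' t x - scal (g t) x * f t x :=
    ⟨_, fun _ _ => rfl⟩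
  have hFc : ContinuousFamily n T F := by
    have := hf'.sub (hscal.mul hf)
    simp only [← hF] at this
    exact this
  simp only [← hF]
  have hsplit : ∀ (φ : ℝ → W → ℝ), ContinuousFamily n T φ → ∀ t ∈ Ico 0 T,
      ∫ x, φ t x ∂(volumeMeasure (g t)) = ∑ a ∈ s, ∫ x, χ a x * φ t x ∂(volumeMeasure (g t)) := by
    intro φ hφ t ht
    rw [← integral_finsetSum]
    · simp only [← Finset.sum_mul, hχ1, one_mul]
    · exact fun a _ => integrable_of_continuous (hg.hasSmoothCoord ht)
        ((hχ a).continuous.mul (hφ.slice ht))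
  refine HasDerivWithinAt.congr (f := fun r => ∑ a ∈ s, ∫ x, χ a x * f r x ∂(volumeMeasure (g r)))
    ?_ (fun r hr => hsplit f hf r hr) (hsplit f hf t ht)
  rw [hsplit F hFc t ht]
  refine HasDerivWithinAt.fun_sum fun a _ => ?_
  set e := extChartAt (𝓡∂ n) a with he
  -- A compact set independent of time: after cutting off, all the integrals live on K with fixed
  -- Lebesgue measure, and the flow enters only through the density.
  set K : Set (Coord n) := e '' tsupport (χ a) with hKdef
  have hK : IsCompact K := (isClosed_tsupport _).isCompact.image_of_continuousOn
    ((continuousOn_extChartAt a).mono (hχs a))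
  have hKt : K ⊆ e.target := by
    rintro _ ⟨x, hx, rfl⟩
    exact e.map_source (hχs a hx)
  have hlocal : ∀ (φ : ℝ → W → ℝ), ContinuousFamily n T φ → ∀ t ∈ Ico 0 T,
      ∫ x, χ a x * φ t x ∂(volumeMeasure (g t))
        = ∫ y in K, volDensity (g t) a y * (χ a (e.symm y) * φ t (e.symm y)) := by
    intro φ hφ t ht
    have hz : ∀ x ∉ e.source, χ a x * φ t x = 0 := fun x hx => by
      rw [image_eq_zero_of_notMem_tsupport fun h => hx (hχs a h), zero_mul]
    rw [(hg.hasSmoothCoord ht).integral_volumeMeasure a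
      (f := fun x => χ a x * φ t x) ((hχ a).continuous.mul (hφ.slice ht)) hz]
    refine setIntegral_eq_of_subset_of_forall_sdiff_eq_zero (measurableSet_target a) hKt
      fun y hy => ?_
    have : χ a (e.symm y) = 0 := by
      by_contra hne
      exact hy.2 ⟨_, subset_tsupport _ hne, e.right_inv hy.1⟩
    rw [this, zero_mul, mul_zero]
  have hdens : ContinuousOn (fun q : ℝ × Coord n => volDensity (g q.1) a q.2)
      (Ico 0 T ×ˢ e.target) :=
    (contDiffOn_sqrt_det (G := fun q : ℝ × Coord n => metricCoord (g q.1) a q.2) (hg.smooth a)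
      fun _ hq => det_metricCoord_ne_zero a hq.2).continuousOn
  have hχc : ContinuousOn (fun q : ℝ × Coord n => χ a (e.symm q.2)) (Ico 0 T ×ˢ e.target) :=
    (hχ a).continuous.comp_continuousOn ((continuousOn_extChartAt_symm a).comp
      continuous_snd.continuousOn fun _ hq => hq.2)
  have hcont : ∀ (φ : ℝ → W → ℝ), ContinuousFamily n T φ → ContinuousOn (fun q : ℝ × Coord n =>
      volDensity (g q.1) a q.2 * (χ a (e.symm q.2) * φ q.1 (e.symm q.2))) (Ico 0 T ×ˢ K) :=
    fun φ hφ => (hdens.mul (hχc.mul (hφ a))).mono (prod_mono_right hKt)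
  refine HasDerivWithinAt.congr (f := fun r => ∫ y in K, volDensity (g r) a y *
    (χ a (e.symm y) * f r (e.symm y))) ?_ (fun r hr => hlocal f hf r hr) (hlocal f hf t ht)
  rw [hlocal F hFc t ht]
  refine hasDerivWithinAt_setIntegral hK (hcont f hf) (hcont F hFc) (fun r hr y hy => ?_) ht
  have h1 := (hg.spaceTime a).hasDerivWithinAt_sqrt_det hr (hKt hy)
  have h2 := h1.mul ((hd r hr (e.symm y)).const_mul (χ a (e.symm y)))
  refine h2.congr_deriv ?_
  rw [hF, hg.scal_coord a hr (hKt hy), volDensity, ricCoordMat]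
  ring

end BoundaryRicci

/-! ### Exchange of time and space derivatives -/

namespace DiffAlg

variable {n : ℕ} [NeZero n] {Ω : Set (Coord n)} {T : ℝ}

lemma add_smul_basisVec_mem_range {y : Coord n} (hy : y ∈ range (𝓡∂ n)) {θ : ℝ} (hθ : 0 ≤ θ)
    (i : Fin n) : y + θ • basisVec i ∈ range (𝓡∂ n) := by
  rw [range_modelWithCornersEuclideanHalfSpace] at hy ⊢
  have h1 : 0 ≤ (basisVec i : Coord n) 0 := by
    rw [basisVec, PiLp.single_apply]; split_ifs <;> norm_num
  exact add_nonneg hy (mul_nonneg hθ h1)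

lemma IsHalfOpen.hasDerivWithinAt_line (hΩ : IsHalfOpen Ω) {f : Coord n → ℝ}
    (hf : ContDiffOn ℝ 1 f Ω) {y : Coord n} (hy : y ∈ range (𝓡∂ n)) {i : Fin n} {θ : ℝ}
    (hmem : y + θ • basisVec i ∈ Ω) :
    HasDerivWithinAt (fun τ => f (y + τ • basisVec i)) (pd i f (y + θ • basisVec i)) (Ici 0) θ := by
  have h1 := (hΩ.differentiableWithinAt hf one_ne_zero hmem).hasFDerivWithinAt
  have h2 : HasDerivWithinAt (fun τ : ℝ => y + τ • (basisVec i : Coord n)) (basisVec i) (Ici 0) θ := by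
    have := ((hasDerivAt_id θ).smul_const (basisVec i : Coord n)).const_add y
    rw [one_smul] at this
    exact this.hasDerivWithinAt
  exact h1.comp_hasDerivWithinAt θ h2 fun τ hτ => add_smul_basisVec_mem_range hy hτ i

/-- Time derivatives commute with partial derivatives, one-sided at the boundaries. -/
lemma IsHalfOpen.hasDerivWithinAt_pd (hΩ : IsHalfOpen Ω) {u h : ℝ → Coord n → ℝ}
    (hu : ∀ t ∈ Ico 0 T, ContDiffOn ℝ 1 (u t) Ω) (hh : ∀ t ∈ Ico 0 T, ContDiffOn ℝ 1 (h t) Ω)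
    (hd : ∀ t ∈ Ico 0 T, ∀ y ∈ Ω, HasDerivWithinAt (fun s => u s y) (h t y) (Ico 0 T) t)
    (i : Fin n) (hc : ContinuousOn (fun q : ℝ × Coord n => pd i (h q.1) q.2) (Ico 0 T ×ˢ Ω))
    {t : ℝ} (ht : t ∈ Ico 0 T) {y : Coord n} (hy : y ∈ Ω) :
    HasDerivWithinAt (fun s => pd i (u s) y) (pd i (h t) y) (Ico 0 T) t := by
  set e : Coord n := basisVec i with he
  set c := pd i (h t) y with hcdef
  have hyr := hΩ.subset hy
  have hline : Continuous fun θ : ℝ => y + θ • e := by fun_prop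
  have hline0 : (fun θ : ℝ => y + θ • e) 0 = y := by simp
  have hΩline : ∀ᶠ θ in 𝓝[≥] (0 : ℝ), y + θ • e ∈ Ω := by
    have h1 : Tendsto (fun θ : ℝ => y + θ • e) (𝓝[≥] 0) (𝓝[range (𝓡∂ n)] y) := by
      refine tendsto_nhdsWithin_iff.mpr ⟨?_, ?_⟩
      · exact (hline.tendsto' 0 y hline0).mono_left nhdsWithin_le_nhds
      · filter_upwards [self_mem_nhdsWithin] with θ hθ
        exact add_smul_basisVec_mem_range hyr hθ i
    exact h1 (hΩ.mem_nhds y hy)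
  rw [hasDerivWithinAt_iff_isLittleO, Asymptotics.isLittleO_iff]
  intro ε hε
  have hev : ∀ᶠ q in 𝓝[Ico 0 T ×ˢ Ω] (t, y), dist (pd i (h q.1) q.2) c < ε :=
    Metric.tendsto_nhds.mp (hc (t, y) ⟨ht, hy⟩) ε hε
  rw [nhdsWithin_prod_eq] at hev
  obtain ⟨P, hP, Q, hQ, hPQ⟩ := eventually_prod_iff.mp hev
  obtain ⟨δ, hδ, hball⟩ := Metric.mem_nhdsWithin_iff.mp hP
  have hQline : ∀ᶠ θ in 𝓝[≥] (0 : ℝ), y + θ • e ∈ Ω ∧ Q (y + θ • e) := by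
    have h1 : Tendsto (fun θ : ℝ => y + θ • e) (𝓝[≥] 0) (𝓝[Ω] y) :=
      tendsto_nhdsWithin_iff.mpr ⟨(hline.tendsto' 0 y hline0).mono_left nhdsWithin_le_nhds, hΩline⟩
    exact hΩline.and (h1.eventually hQ)
  obtain ⟨θ₀, hθ₀, hθ⟩ := mem_nhdsGE_iff_exists_Icc_subset.mp hQline
  have hmem0 : t ∈ Metric.ball t δ ∩ Ico 0 T := ⟨Metric.mem_ball_self hδ, ht⟩
  have hconv : Convex ℝ (Metric.ball t δ ∩ Ico 0 T) := (convex_ball t δ).inter (convex_Ico 0 T)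
  -- Mean value inequality along the segment y + θeᵢ: ∂ᵢh stays within ε of its value c at (t, y).
  -- Only θ ≥ 0 is used, which keeps the segment in the half-space.
  have hspace : ∀ r ∈ Metric.ball t δ ∩ Ico 0 T, ∀ θ ∈ Icc 0 θ₀,
      ‖h r (y + θ • e) - h r y - θ * c‖ ≤ ε * θ := by
    intro r hr θ hθm
    have h1 := (convex_Icc (0 : ℝ) θ₀).norm_image_sub_le_of_norm_hasDerivWithin_le
      (f := fun τ => h r (y + τ • e) - τ * c) (f' := fun τ => pd i (h r) (y + τ • e) - c) (C := ε)
      (fun τ hτ => by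
        have h2 := (hΩ.hasDerivWithinAt_line (hh r hr.2) hyr (hθ hτ).1).mono
          (fun z hz => hz.1 : Icc 0 θ₀ ⊆ Ici 0)
        have h3 := ((hasDerivAt_id τ).mul_const c).hasDerivWithinAt (s := Icc 0 θ₀)
        rw [one_mul] at h3
        exact h2.sub h3)
      (fun τ hτ => (hPQ (hball hr) (hθ hτ).2).le) (x := 0) (y := θ)
      ⟨le_rfl, hθ₀.le⟩ hθm
    simp only [zero_smul, add_zero, zero_mul, sub_zero] at h1
    rw [Real.norm_of_nonneg hθm.1] at h1
    rwa [sub_right_comm]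
  -- A second mean value inequality, in time, for the spatial difference quotient of u. The bound
  -- ε|s - t| is uniform in θ and survives the limit θ → 0 below.
  have htime : ∀ s ∈ Metric.ball t δ ∩ Ico 0 T, ∀ θ ∈ Ioc 0 θ₀,
      ‖(u s (y + θ • e) - u s y) / θ - (u t (y + θ • e) - u t y) / θ - (s - t) * c‖
        ≤ ε * ‖s - t‖ := by
    intro s hs θ hθm
    have hyθ := (hθ ⟨hθm.1.le, hθm.2⟩).1
    have h1 := hconv.norm_image_sub_le_of_norm_hasDerivWithin_le
      (f := fun r => u r (y + θ • e) - u r y - r * (θ * c))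
      (f' := fun r => h r (y + θ • e) - h r y - θ * c) (C := ε * θ)
      (fun r hr => by
        have h3 := ((hasDerivAt_id r).mul_const (θ * c)).hasDerivWithinAt (s := Ico 0 T)
        rw [one_mul] at h3
        exact (((hd r hr.2 _ hyθ).sub (hd r hr.2 y hy)).sub h3).mono inter_subset_right)
      (fun r hr => hspace r hr θ ⟨hθm.1.le, hθm.2⟩) hmem0 hs
    have h4 : (u s (y + θ • e) - u s y) / θ - (u t (y + θ • e) - u t y) / θ - (s - t) * c
        = (u s (y + θ • e) - u s y - s * (θ * c) - (u t (y + θ • e) - u t y - t * (θ * c))) / θ := by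
      have := hθm.1.ne'
      field_simp
      ring
    rw [h4, norm_div, Real.norm_of_nonneg hθm.1.le, div_le_iff₀ hθm.1]
    calc _ ≤ ε * θ * ‖s - t‖ := h1
      _ = _ := by ring
  have hlim : ∀ s ∈ Ico 0 T, Tendsto (fun θ => (u s (y + θ • e) - u s y) / θ) (𝓝[>] 0)
      (𝓝 (pd i (u s) y)) := by
    intro s hs
    have h1 := hΩ.hasDerivWithinAt_line (hu s hs) hyr (i := i) (θ := 0) (by simpa using hy)
    rw [zero_smul, add_zero] at h1
    have h2 := (hasDerivWithinAt_iff_tendsto_slope.mp h1)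
    rw [Ici_sdiff_left] at h2
    refine h2.congr fun θ => ?_
    rw [slope_def_field, zero_smul, add_zero, sub_zero]
  filter_upwards [inter_mem_nhdsWithin (Ico 0 T) (Metric.ball_mem_nhds t hδ)] with s hs
  refine le_of_tendsto ((((hlim s hs.1).sub (hlim t ht)).sub_const ((s - t) * c)).norm) ?_
  filter_upwards [Ioc_mem_nhdsGT hθ₀] with θ hθm
  exact htime s ⟨hs.2, hs.1⟩ θ hθm

end DiffAlg

/-! ### Evolution of |∇u|² -/

namespace BoundaryRicci

open DiffAlg

variable {n : ℕ} [NeZero n] {W : Type*} [TopologicalSpace W]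
  [ChartedSpace (EuclideanHalfSpace n) W] [IsManifold (𝓡∂ n) ∞ W] {T : ℝ} {u h : ℝ → W → ℝ}

lemma ContinuousInC.continuousFamily {k : ℕ} (hu : ContinuousInC (n := n) T k u) :
    ContinuousFamily n T u := fun x₀ => by
  have h1 := hu.2 x₀ 0 (Nat.zero_le k)
  have h2 := (continuousMultilinearCurryFin0 ℝ (Coord n) ℝ).continuous.comp_continuousOn h1
  exact h2

lemma ContinuousInC.continuousOn_pd {k : ℕ} (hk : 1 ≤ k) (hu : ContinuousInC (n := n) T k u)
    (x₀ : W) (i : Fin n) : ContinuousOn (fun q : ℝ × Coord n =>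
      pd i (u q.1 ∘ (extChartAt (𝓡∂ n) x₀).symm) q.2) (Ico 0 T ×ˢ (extChartAt (𝓡∂ n) x₀).target) := by
  have h1 := hu.2 x₀ 1 hk
  have h2 := (ContinuousMultilinearMap.apply ℝ (fun _ : Fin 1 => Coord n) ℝ
    (fun _ => basisVec i)).continuous.comp_continuousOn h1
  refine h2.congr fun q hq => ?_
  have hΩ := isHalfOpen_target (n := n) x₀
  simp only [Function.comp_apply]
  erw [ContinuousMultilinearMap.apply_apply]
  rw [iteratedFDerivWithin_one_apply (hΩ.uniqueDiffOn q.2 hq.2), hΩ.fderivWithin_eq _ hq.2]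
  rfl

lemma ContinuousInC.contMDiff_one {k : ℕ} (hk : 1 ≤ k) (hu : ContinuousInC (n := n) T k u) {t : ℝ}
    (ht : t ∈ Ico 0 T) : ContMDiff (𝓡∂ n) 𝓘(ℝ, ℝ) 1 (u t) :=
  (hu.1 t ht).of_le (by exact_mod_cast hk)

lemma diffVec_eq_pd {f : W → ℝ} {x : W} (hf : MDifferentiableAt (𝓡∂ n) 𝓘(ℝ, ℝ) f x) (i : Fin n) :
    diffVec f x i = pd i (f ∘ (extChartAt (𝓡∂ n) x).symm) (extChartAt (𝓡∂ n) x x) := by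
  rw [pd_comp_symm x (mem_extChartAt_target x) (by rwa [extChartAt_to_inv]), chartDeriv_self,
    extChartAt_to_inv, diffVec]

namespace IsC1Family

variable (hu : IsC1Family (n := n) T u)
include hu

lemma hasDerivWithinAt {t : ℝ} (ht : t ∈ Ico 0 T) (x : W) :
    HasDerivWithinAt (fun s => u s x) (timeDeriv T u t x) (Ico 0 T) t :=
  (hu.differentiable t ht x).hasDerivWithinAt

lemma contMDiff_one {t : ℝ} (ht : t ∈ Ico 0 T) : ContMDiff (𝓡∂ n) 𝓘(ℝ, ℝ) 1 (u t) :=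
  hu.continuous.contMDiff_one one_le_two ht

lemma contMDiff_timeDeriv {t : ℝ} (ht : t ∈ Ico 0 T) :
    ContMDiff (𝓡∂ n) 𝓘(ℝ, ℝ) 1 (timeDeriv T u t) :=
  hu.continuous_deriv.contMDiff_one one_le_two ht

/-- Joint continuity of the first derivatives of ∂ₜu permits the exchange of ∂ₜ with the spatial
differential; here x is fixed and its preferred chart is used. -/
lemma hasDerivWithinAt_diffVec {t : ℝ} (ht : t ∈ Ico 0 T) (x : W) (i : Fin n) :
    HasDerivWithinAt (fun s => diffVec (u s) x i) (diffVec (timeDeriv T u t) x i) (Ico 0 T) t := by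
  have h1 := (isHalfOpen_target (n := n) x).hasDerivWithinAt_pd (T := T)
    (u := fun t => u t ∘ (extChartAt (𝓡∂ n) x).symm)
    (h := fun t => timeDeriv T u t ∘ (extChartAt (𝓡∂ n) x).symm)
    (fun t ht => contDiffOn_chart (k := 1) (hu.contMDiff_one ht) x)
    (fun t ht => contDiffOn_chart (k := 1) (hu.contMDiff_timeDeriv ht) x)
    (fun t ht y _ => hu.hasDerivWithinAt ht _) i
    (hu.continuous_deriv.continuousOn_pd one_le_two x i) ht (mem_extChartAt_target x)
  rw [diffVec_eq_pd ((hu.contMDiff_timeDeriv ht).mdifferentiable one_ne_zero x)]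
  exact h1.congr (fun s hs => diffVec_eq_pd ((hu.contMDiff_one hs).mdifferentiable one_ne_zero x) i)
    (diffVec_eq_pd ((hu.contMDiff_one ht).mdifferentiable one_ne_zero x) i)

end IsC1Family

namespace IsBoundaryRicciFlow

variable {g : ℝ → RMetric n W} (hg : IsBoundaryRicciFlow T g)
include hg

lemma hasDerivWithinAt_inv_metricMat {t : ℝ} (ht : t ∈ Ico 0 T) (x : W) (i j : Fin n) :
    HasDerivWithinAt (fun s => (metricMat (g s) x)⁻¹ i j)
      (2 * ((metricMat (g t) x)⁻¹ * ricMat (g t) x * (metricMat (g t) x)⁻¹) i j) (Ico 0 T) t := by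
  have h1 := hasDerivWithinAt_inv (G := fun s => metricMat (g s) x)
    (G' := (-2 : ℝ) • ricMat (g t) x) (uniqueDiffOn_Ico 0 T t ht)
    (fun i j => hg.hasDerivWithinAt_metricMat ht x i j)
    (fun s _ => (metricMat_posDef (g s) x).det_pos.ne') ht i j
  refine h1.congr_deriv ?_
  have h2 : (metricMat (g t) x)⁻¹ * ((-2 : ℝ) • ricMat (g t) x) * (metricMat (g t) x)⁻¹
      = (-2 : ℝ) • ((metricMat (g t) x)⁻¹ * ricMat (g t) x * (metricMat (g t) x)⁻¹) := by
    rw [Matrix.mul_smul, Matrix.smul_mul]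
  rw [h2, Matrix.smul_apply, smul_eq_mul]
  ring

lemma continuousOn_inv_metricCoord (x₀ : W) (i j : Fin n) : ContinuousOn
    (fun q : ℝ × Coord n => (metricCoord (g q.1) x₀ q.2)⁻¹ i j)
    (Ico 0 T ×ˢ (extChartAt (𝓡∂ n) x₀).target) :=
  (contDiffOn_inv (G := fun q : ℝ × Coord n => metricCoord (g q.1) x₀ q.2) (hg.smooth x₀)
    (fun _ hq => det_metricCoord_ne_zero x₀ hq.2) i j).continuousOn

lemma continuousFamily_gradInner {k m : ℕ} (hk : 1 ≤ k) (hm : 1 ≤ m)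
    (hu : ContinuousInC (n := n) T k u) (hh : ContinuousInC (n := n) T m h) :
    ContinuousFamily n T fun t x => gradInner (g t) (u t) (h t) x := by
  intro x₀
  refine ContinuousOn.congr ?_ fun q hq => (gradInner_chart x₀ (hu.contMDiff_one hk hq.1)
    (hh.contMDiff_one hm hq.1) hq.2).symm
  simp only [coinnerM, dotProduct, Matrix.mulVec]
  exact continuousOn_finsetSum _ fun i _ => (hu.continuousOn_pd hk x₀ i).mul
    (continuousOn_finsetSum _ fun j _ => (hg.continuousOn_inv_metricCoord x₀ i j).mul
      (hh.continuousOn_pd hm x₀ j))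

lemma continuousFamily_ric_grad {k : ℕ} (hk : 1 ≤ k) (hu : ContinuousInC (n := n) T k u) :
    ContinuousFamily n T fun t x => ric (g t) x (grad (g t) (u t) x) (grad (g t) (u t) x) := by
  intro x₀
  have hv : ∀ i, ContinuousOn (fun q : ℝ × Coord n => ((metricCoord (g q.1) x₀ q.2)⁻¹.mulVec
      fun i => pd i (u q.1 ∘ (extChartAt (𝓡∂ n) x₀).symm) q.2) i)
      (Ico 0 T ×ˢ (extChartAt (𝓡∂ n) x₀).target) := fun i => by
    have h : ∀ (Q : Matrix (Fin n) (Fin n) ℝ) (v : Fin n → ℝ),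
      Q.mulVec v i = ∑ j, Q i j * v j := fun _ _ => rfl
    simp only [h]
    exact continuousOn_finsetSum _ fun j _ => (hg.continuousOn_inv_metricCoord x₀ i j).mul
      (hu.continuousOn_pd hk x₀ j)
  have h1 : ContinuousOn (fun q : ℝ × Coord n => evalM (metricCoord (g q.1) x₀ q.2)
      (ricCoordMat (g q.1) x₀ q.2) (fun i => pd i (u q.1 ∘ (extChartAt (𝓡∂ n) x₀).symm) q.2)
      (fun i => pd i (u q.1 ∘ (extChartAt (𝓡∂ n) x₀).symm) q.2))
      (Ico 0 T ×ˢ (extChartAt (𝓡∂ n) x₀).target) := by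
    have h : ∀ (R : Matrix (Fin n) (Fin n) ℝ) (v : Fin n → ℝ),
      v ⬝ᵥ R.mulVec v = ∑ i, v i * ∑ j, R i j * v j := fun _ _ => rfl
    simp only [evalM, h]
    exact continuousOn_finsetSum _ fun i _ => (hv i).mul (continuousOn_finsetSum _ fun j _ =>
      (hg.contDiffOn_ricCoordMat x₀ i j).continuousOn.mul (hv j))
  refine h1.congr fun q hq => ?_
  simp only
  rw [ric_grad, diffVec_chart x₀ hq.2 ((hu.contMDiff_one hk hq.1).mdifferentiable one_ne_zero _),
    ricCoordMat_eq (hg.hasSmoothCoord hq.1) x₀ hq.2, metricCoord_eq_chartMat,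
    evalM_sandwich (isUnit_chartMat x₀ hq.2)]

/-- In gⁱʲ∂ᵢu∂ⱼu the inverse metric evolves by +2 Ric with raised indices, giving the Ricci term;
the two factors du give equal contributions by symmetry. -/
lemma hasDerivWithinAt_gradInner (hu : IsC1Family (n := n) T u) {t : ℝ} (ht : t ∈ Ico 0 T) (x : W) :
    HasDerivWithinAt (fun s => gradInner (g s) (u s) (u s) x)
      (2 * ric (g t) x (grad (g t) (u t) x) (grad (g t) (u t) x)
        + 2 * gradInner (g t) (timeDeriv T u t) (u t) x) (Ico 0 T) t := by
  have h1 : HasDerivWithinAt (fun s => ∑ i, diffVec (u s) x i * ∑ j, (metricMat (g s) x)⁻¹ i j *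
      diffVec (u s) x j) _ (Ico 0 T) t :=
    HasDerivWithinAt.fun_sum fun i _ => (hu.hasDerivWithinAt_diffVec ht x i).mul
      (HasDerivWithinAt.fun_sum fun j _ => (hg.hasDerivWithinAt_inv_metricMat ht x i j).mul
        (hu.hasDerivWithinAt_diffVec ht x j))
  refine h1.congr_deriv ?_
  rw [ric_grad, gradInner, evalM, coinnerM]
  set Q := (metricMat (g t) x)⁻¹ with hQ
  set R := ricMat (g t) x with hR
  set d := diffVec (n := n) (u t) x with hd
  set d' := diffVec (n := n) (timeDeriv T u t) x with hd'
  have hQs : Q.transpose = Q := inv_metricMat_symm x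
  have e1 : ∑ i, d i * ∑ j, 2 * (Q * R * Q) i j * d j
      = 2 * (Q.mulVec d ⬝ᵥ R.mulVec (Q.mulVec d)) := by
    have : Q.mulVec d ⬝ᵥ R.mulVec (Q.mulVec d) = d ⬝ᵥ (Q * R * Q).mulVec d := by
      rw [← Matrix.mulVec_mulVec, ← Matrix.mulVec_mulVec, Matrix.dotProduct_mulVec d Q,
        ← Matrix.mulVec_transpose, hQs]
    rw [this]
    simp only [dotProduct, Matrix.mulVec, Finset.mul_sum]
    exact Finset.sum_congr rfl fun i _ => Finset.sum_congr rfl fun j _ => by ring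
  have e2 : ∑ i, d i * ∑ j, Q i j * d' j = d' ⬝ᵥ Q.mulVec d := by
    have : d' ⬝ᵥ Q.mulVec d = d ⬝ᵥ Q.mulVec d' := by
      rw [Matrix.dotProduct_mulVec, ← Matrix.mulVec_transpose, hQs, dotProduct_comm]
    rw [this]; rfl
  have e3 : ∑ i, d' i * ∑ j, Q i j * d j = d' ⬝ᵥ Q.mulVec d := rfl
  simp only [Finset.sum_add_distrib, mul_add]
  rw [e1, e2, e3]
  ring

end IsBoundaryRicciFlow

end BoundaryRicci

/-! ### Evolution of the outward normal and of the Neumann condition -/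

namespace BoundaryRicci

open DiffAlg
open scoped Matrix

variable {n : ℕ} [NeZero n] {W : Type*} [TopologicalSpace W]
  [ChartedSpace (EuclideanHalfSpace n) W] [IsManifold (𝓡∂ n) ∞ W] {T : ℝ} {u : ℝ → W → ℝ}

section

variable (g : RMetric n W) (x : W)

/-- The Ricci endomorphism of the tangent space at `x`. -/
def ricVec (v : Coord n) : Coord n :=
  WithLp.toLp 2 ((metricMat g x)⁻¹ *ᵥ (ricMat g x *ᵥ v.ofLp))

lemma innerAt_ricVec (v w : Coord n) : innerAt g x w (ricVec g x v) = ric g x w v := by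
  rw [innerAt_eq, ric_eq, ricVec, Matrix.mulVec_mulVec, Matrix.mul_nonsing_inv _ (isUnit_metricMat x),
    Matrix.one_mulVec]

lemma dirDeriv_eq_dotProduct (f : W → ℝ) (v : Coord n) :
    dirDeriv f x v = diffVec f x ⬝ᵥ v.ofLp := by
  rw [dirDeriv_eq_sum]
  exact Finset.sum_congr rfl fun i _ => mul_comm _ _

lemma dirDeriv_add (f : W → ℝ) (v w : Coord n) :
    dirDeriv f x (v + w) = dirDeriv f x v + dirDeriv f x w := by
  simp only [dirDeriv_eq_dotProduct, WithLp.ofLp_add, dotProduct_add]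

lemma dirDeriv_smul (f : W → ℝ) (c : ℝ) (v : Coord n) :
    dirDeriv f x (c • v) = c * dirDeriv f x v := by
  simp only [dirDeriv_eq_dotProduct, WithLp.ofLp_smul, dotProduct_smul, smul_eq_mul]

lemma dirDeriv_sum {κ : Type*} (s : Finset κ) (f : W → ℝ) (v : κ → Coord n) :
    dirDeriv f x (∑ i ∈ s, v i) = ∑ i ∈ s, dirDeriv f x (v i) := by
  simp only [dirDeriv_eq_dotProduct, WithLp.ofLp_sum, dotProduct_sum]

/-- This turns a derivative along the Ricci endomorphism into the term Ric(∇f, ·) of the boundary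
formula. -/
lemma dirDeriv_ricVec (f : W → ℝ) (v : Coord n) :
    dirDeriv f x (ricVec g x v) = ric g x (grad g f x) v := by
  rw [dirDeriv_eq_dotProduct, ric_eq, grad_eq, ricVec, Matrix.dotProduct_mulVec,
    ← Matrix.mulVec_transpose, inv_metricMat_symm]

lemma outNormal_eq : outNormal g x
    = WithLp.toLp 2 ((-(√((metricMat g x)⁻¹ 0 0))⁻¹) • (metricMat g x)⁻¹ *ᵥ Pi.single 0 1) := by
  ext i
  simp [outNormal, div_eq_inv_mul]

lemma innerAt_outNormal_self : innerAt g x (outNormal g x) (outNormal g x) = 1 := by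
  have h0 := inv_metricMat_zero_pos g x
  have h1 : metricMat g x *ᵥ ((metricMat g x)⁻¹ *ᵥ Pi.single 0 1) = Pi.single 0 1 := by
    rw [Matrix.mulVec_mulVec, Matrix.mul_nonsing_inv _ (isUnit_metricMat x), Matrix.one_mulVec]
  have h2 : ((metricMat g x)⁻¹ *ᵥ Pi.single 0 1) ⬝ᵥ (Pi.single 0 1 : Fin n → ℝ)
      = (metricMat g x)⁻¹ 0 0 := by
    simp
  rw [innerAt_eq, outNormal_eq]
  simp only [Matrix.mulVec_smul, smul_dotProduct, dotProduct_smul, smul_eq_mul, h1, h2]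
  have h3 := (Real.sqrt_pos.mpr h0).ne'
  have h4 := Real.sq_sqrt h0.le
  field_simp
  linarith

/-- Expansion in an orthonormal basis that contains the normal vector. -/
lemma eq_sum_of_orthonormal {e : Fin (n - 1) → Coord n} {ν : Coord n}
    (he : ∀ i j, innerAt g x (e i) (e j) = if i = j then 1 else 0)
    (heν : ∀ i, innerAt g x (e i) ν = 0) (hν : innerAt g x ν ν = 1) (v : Coord n) :
    v = ∑ i, innerAt g x (e i) v • e i + innerAt g x ν v • ν := by
  -- Adjoining ν as `none` gives n orthonormal vectors, which therefore form a basis of ℝⁿ.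
  let V : Option (Fin (n - 1)) → Coord n := fun o => o.elim ν e
  have hV : ∀ a b, innerAt g x (V a) (V b) = if a = b then 1 else 0 := by
    rintro (_ | i) (_ | j)
    · simpa [V] using hν
    · simpa [V, innerAt_symm g x ν] using heν j
    · simpa [V] using heν i
    · simpa [V] using he i j
  have hexp : ∀ (c : Option (Fin (n - 1)) → ℝ) a, innerAt g x (V a) (∑ b, c b • V b) = c a := by
    intro c a
    rw [innerAt_sum_right]
    simp [hV]
  have hli : LinearIndependent ℝ V := by
    refine Fintype.linearIndependent_iff.mpr fun c hc a => ?_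
    rw [← hexp c a, hc]
    -- The empty sum supplies the vanishing of the form at the zero vector.
    have h1 := innerAt_sum_right g x (∅ : Finset (Fin 0)) (fun _ => 0) (fun _ => 0) (V a)
    simpa using h1
  have hcard : Fintype.card (Option (Fin (n - 1))) = Module.finrank ℝ (Coord n) := by
    rw [Fintype.card_option, Fintype.card_fin, finrank_euclideanSpace_fin]
    have := NeZero.pos n
    omega
  set b := basisOfLinearIndependentOfCardEqFinrank hli hcard with hb
  have h1 : v = ∑ a, b.repr v a • V a := by
    conv_lhs => rw [← b.sum_repr v]
    simp [hb]
  have h2 : ∀ a, b.repr v a = innerAt g x (V a) v := fun a => by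
    conv_rhs => rw [h1, hexp]
  simp only [h2] at h1
  rw [Fintype.sum_option] at h1
  conv_lhs => rw [h1]
  exact add_comm _ _

end

namespace IsBoundaryRicciFlow

variable {g : ℝ → RMetric n W} (hg : IsBoundaryRicciFlow T g)
include hg

/-- The covector dy⁰ does not depend on time, so only the inverse metric in ν = -G⁻¹dy⁰/√(G⁻¹)⁰⁰
varies. The numerator contributes 2 Ric(ν), and the normalizing factor -Ric(ν,ν)ν. -/
lemma hasDerivWithinAt_outNormal {t : ℝ} (ht : t ∈ Ico 0 T) (x : W) :
    HasDerivWithinAt (fun s => outNormal (g s) x)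
      ((2 : ℝ) • ricVec (g t) x (outNormal (g t) x)
        - ric (g t) x (outNormal (g t) x) (outNormal (g t) x) • outNormal (g t) x) (Ico 0 T) t := by
  rw [hasDerivWithinAt_iff_hasFDerivWithinAt, hasFDerivWithinAt_euclidean]
  intro i
  have h0 := inv_metricMat_zero_pos (g t) x
  have h1 := ((hg.hasDerivWithinAt_inv_metricMat ht x i 0).div
    ((hg.hasDerivWithinAt_inv_metricMat ht x 0 0).sqrt h0.ne') (Real.sqrt_pos.mpr h0).ne').neg
  rw [hasDerivWithinAt_iff_hasFDerivWithinAt] at h1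
  refine h1.congr_fderiv ?_
  set Q := (metricMat (g t) x)⁻¹ with hQ
  set R := ricMat (g t) x with hR
  set A := Q * R * Q with hA
  have hQs : Qᵀ = Q := inv_metricMat_symm x
  set c := -(√(Q 0 0))⁻¹ with hc
  have hν : (outNormal (g t) x).ofLp = c • Q *ᵥ Pi.single 0 1 :=
    congrArg WithLp.ofLp (outNormal_eq (g t) x)
  have hi : (Q *ᵥ Pi.single 0 1) i = Q i 0 := by simp
  have hv : (ricVec (g t) x (outNormal (g t) x)) i = c * A i 0 := by
    change (Q *ᵥ (R *ᵥ (outNormal (g t) x).ofLp)) i = _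
    rw [hν, Matrix.mulVec_smul, Matrix.mulVec_smul, Matrix.mulVec_mulVec, Matrix.mulVec_mulVec,
      ← hA]
    simp
  have hr : ric (g t) x (outNormal (g t) x) (outNormal (g t) x) = c * (c * A 0 0) := by
    rw [ric_eq, hν, Matrix.mulVec_smul, smul_dotProduct, dotProduct_smul, smul_eq_mul, smul_eq_mul]
    congr 2
    rw [dotProduct_comm, Matrix.dotProduct_mulVec, ← Matrix.mulVec_transpose, hQs,
      Matrix.mulVec_mulVec, Matrix.mulVec_mulVec, ← hR, ← hA]
    simp
  ext
  simp only [ContinuousLinearMap.toSpanSingleton_apply, ContinuousLinearMap.comp_apply, one_smul,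
    PiLp.proj_apply, PiLp.sub_apply, PiLp.smul_apply, smul_eq_mul, hv, hr]
  rw [show (outNormal (g t) x) i = c * Q i 0 by rw [hν, Pi.smul_apply, hi, smul_eq_mul], hc]
  have h3 := (Real.sqrt_pos.mpr h0).ne'
  have h4 := Real.sq_sqrt h0.le
  field_simp
  ring

/-- The normal derivative of `∂ₜ u`, if the normal derivatives of `u` vanish. -/
lemma normalDeriv_timeDeriv (hu : IsC1Family (n := n) T u) {x : W}
    (hν : ∀ t ∈ Ico 0 T, normalDeriv (g t) (u t) x = 0) {t : ℝ} (ht : t ∈ Ico 0 T) :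
    normalDeriv (g t) (timeDeriv T u t) x
      = -2 * ric (g t) x (grad (g t) (u t) x) (outNormal (g t) x) := by
  have hN := hg.hasDerivWithinAt_outNormal ht x
  set N' := (2 : ℝ) • ricVec (g t) x (outNormal (g t) x)
    - ric (g t) x (outNormal (g t) x) (outNormal (g t) x) • outNormal (g t) x with hN'
  have hNi : ∀ i, HasDerivWithinAt (fun s => outNormal (g s) x i) (N' i) (Ico 0 T) t := fun i =>
    (EuclideanSpace.proj (𝕜 := ℝ) i).hasFDerivAt.comp_hasDerivWithinAt t hN
  have h1 : HasDerivWithinAt (fun s => ∑ i, diffVec (u s) x i * outNormal (g s) x i)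
      (∑ i, (diffVec (timeDeriv T u t) x i * outNormal (g t) x i + diffVec (u t) x i * N' i))
      (Ico 0 T) t :=
    HasDerivWithinAt.fun_sum fun i _ => (hu.hasDerivWithinAt_diffVec ht x i).mul (hNi i)
  have h2 : ∀ s ∈ Ico 0 T, ∑ i, diffVec (u s) x i * outNormal (g s) x i = 0 := fun s hs =>
    (dirDeriv_eq_dotProduct x (u s) _).symm.trans (hν s hs)
  have h3 := (uniqueDiffOn_Ico 0 T t ht).eq_deriv _ h1
    ((hasDerivWithinAt_const t (Ico 0 T) (0 : ℝ)).congr h2 (h2 t ht))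
  rw [Finset.sum_add_distrib] at h3
  -- The time derivative of du(ν) = 0. In dirDeriv along ∂ₜν the component along ν drops out by the
  -- same condition, leaving only the Ricci endomorphism.
  have h4 : normalDeriv (g t) (timeDeriv T u t) x + dirDeriv (u t) x N' = 0 := by
    rw [normalDeriv, dirDeriv_eq_dotProduct, dirDeriv_eq_dotProduct]
    exact h3
  have h5 : dirDeriv (u t) x (outNormal (g t) x) = 0 := hν t ht
  rw [hN', sub_eq_add_neg, ← neg_smul, dirDeriv_add, dirDeriv_smul, dirDeriv_smul, h5,
    dirDeriv_ricVec] at h4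
  linarith

/-- The evolution of the outward unit normal in an orthonormal basis. -/
lemma hasDerivWithinAt_outNormal_orthonormal {t : ℝ} (ht : t ∈ Ico 0 T) (x : W)
    {e : Fin (n - 1) → Coord n} (he : ∀ i j, innerAt (g t) x (e i) (e j) = if i = j then 1 else 0)
    (heν : ∀ i, innerAt (g t) x (e i) (outNormal (g t) x) = 0) :
    HasDerivWithinAt (fun s => outNormal (g s) x)
      ((2 : ℝ) • ∑ i, ric (g t) x (e i) (outNormal (g t) x) • e i
        + ric (g t) x (outNormal (g t) x) (outNormal (g t) x) • outNormal (g t) x)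
      (Ico 0 T) t := by
  refine (hg.hasDerivWithinAt_outNormal ht x).congr_deriv ?_
  -- Expanding 2 Ric(ν) in the basis gives the normal component 2 Ric(ν,ν), of which one half is
  -- cancelled by the normalizing term.
  rw [eq_sum_of_orthonormal (g t) x he heν (innerAt_outNormal_self (g t) x)
    (ricVec (g t) x (outNormal (g t) x))]
  simp only [innerAt_ricVec]
  module

omit hg in
-- Ric(∇f,ν) is df applied to the vector Ric(ν); in the basis expansion of that vector the normal
-- part is killed by ∂_ν f = 0.
lemma ric_grad_outNormal {g : RMetric n W} {f : W → ℝ} {x : W} (hν : normalDeriv g f x = 0)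
    {e : Fin (n - 1) → Coord n} (he : ∀ i j, innerAt g x (e i) (e j) = if i = j then 1 else 0)
    (heν : ∀ i, innerAt g x (e i) (outNormal g x) = 0) :
    ric g x (grad g f x) (outNormal g x)
      = ∑ i, ric g x (e i) (outNormal g x) * dirDeriv f x (e i) := by
  rw [← dirDeriv_ricVec, eq_sum_of_orthonormal g x he heν (innerAt_outNormal_self g x)
    (ricVec g x (outNormal g x)), dirDeriv_add, dirDeriv_smul _ _ _ (outNormal g x),
    show dirDeriv f x (outNormal g x) = 0 from hν, mul_zero, add_zero, dirDeriv_sum]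
  simp only [innerAt_ricVec, dirDeriv_smul]

end IsBoundaryRicciFlow

end BoundaryRicci

/-! ### The Laplacian of a square and smoothness of the scalar curvature -/

namespace BoundaryRicci

open DiffAlg

variable {n : ℕ} [NeZero n] {W : Type*} [TopologicalSpace W]
  [ChartedSpace (EuclideanHalfSpace n) W] [IsManifold (𝓡∂ n) ∞ W] {T : ℝ}

lemma contMDiff_of_chart {F : W → ℝ} (h : ∀ x₀, ContDiffOn ℝ ∞
    (F ∘ (extChartAt (𝓡∂ n) x₀).symm) (extChartAt (𝓡∂ n) x₀).target) :
    ContMDiff (𝓡∂ n) 𝓘(ℝ, ℝ) ∞ F := by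
  intro x
  have h1 := (contMDiffOn_iff_contDiffOn.mpr (h x)).comp (contMDiffOn_extChartAt (I := 𝓡∂ n) (x := x))
    fun z hz => (extChartAt (𝓡∂ n) x).map_source (by rwa [extChartAt_source])
  have h2 := (h1 x (mem_chart_source _ x)).contMDiffAt
    ((chartAt (EuclideanHalfSpace n) x).open_source.mem_nhds (mem_chart_source _ x))
  refine h2.congr_of_eventuallyEq ?_
  filter_upwards [extChartAt_source_mem_nhds (I := 𝓡∂ n) x] with z hz
  simp only [Function.comp_apply, (extChartAt (𝓡∂ n) x).left_inv hz]

/-- The flux of f² is 2f times the flux of f, and the product rule for its divergence produces the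
gradient term. -/
lemma laplace_sq {g : RMetric n W} (hg : HasSmoothCoord g) {f : W → ℝ}
    (hf : ContMDiff (𝓡∂ n) 𝓘(ℝ, ℝ) ∞ f) (x : W) :
    laplace g (fun y => f y ^ 2) x = 2 * f x * laplace g f x + 2 * gradInner g f f x := by
  have hf1 : ContMDiff (𝓡∂ n) 𝓘(ℝ, ℝ) 1 f := hf.of_le (by exact_mod_cast le_top)
  have hf2 : ContMDiff (𝓡∂ n) 𝓘(ℝ, ℝ) ∞ fun y => f y ^ 2 := hf.pow 2
  have hΩ := isHalfOpen_target (n := n) x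
  have hx := mem_extChartAt_target (I := 𝓡∂ n) x
  have hfc : ContDiffOn ℝ 1 (f ∘ (extChartAt (𝓡∂ n) x).symm) (extChartAt (𝓡∂ n) x).target :=
    contDiffOn_chart (k := 1) hf1 x
  have hfl : ∀ i, ContDiffOn ℝ 1 (flux g x f i) (extChartAt (𝓡∂ n) x).target := fun i =>
    (hg.contDiffOn_flux x hf i).of_le (by exact_mod_cast le_top)
  have hflux : ∀ i, ∀ y ∈ (extChartAt (𝓡∂ n) x).target, flux g x (fun y => f y ^ 2) i y
      = 2 * ((f ∘ (extChartAt (𝓡∂ n) x).symm) y * flux g x f i y) := by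
    intro i y hy
    have h1 : ∀ j, pd j ((fun y => f y ^ 2) ∘ (extChartAt (𝓡∂ n) x).symm) y
        = 2 * (f ∘ (extChartAt (𝓡∂ n) x).symm) y * pd j (f ∘ (extChartAt (𝓡∂ n) x).symm) y := by
      intro j
      have h2 := hΩ.pd_mul hfc hfc hy j
      have h3 : ((fun y => f y ^ 2) ∘ (extChartAt (𝓡∂ n) x).symm : Coord n → ℝ)
          = fun z => (f ∘ (extChartAt (𝓡∂ n) x).symm) z * (f ∘ (extChartAt (𝓡∂ n) x).symm) z := by
        funext z; simp only [Function.comp_apply]; ring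
      rw [h3, h2]
      ring
    simp only [flux, h1, Finset.mul_sum]
    exact Finset.sum_congr rfl fun j _ => by ring
  set y := extChartAt (𝓡∂ n) x x with hy
  have hpd : ∀ i, pd i (flux g x (fun y => f y ^ 2) i) y
      = 2 * (pd i (f ∘ (extChartAt (𝓡∂ n) x).symm) y * flux g x f i y
        + (f ∘ (extChartAt (𝓡∂ n) x).symm) y * pd i (flux g x f i) y) := by
    intro i
    have h1 : flux g x (fun y => f y ^ 2) i =ᶠ[𝓝[range (𝓡∂ n)] y]
        fun z => 2 * ((f ∘ (extChartAt (𝓡∂ n) x).symm) z * flux g x f i z) := by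
      filter_upwards [hΩ.mem_nhds y hx] with z hz using hflux i z hz
    have h2 := hΩ.pd_mul (contDiffOn_const (c := (2 : ℝ))) (hfc.mul (hfl i)) hx i
    have h3 : pd i (fun _ : Coord n => (2 : ℝ)) y = 0 := by rw [pd, fderivWithin_const_apply]; rfl
    rw [pd, h1.fderivWithin_eq (hflux i y hx)]
    refine h2.trans ?_
    rw [h3, zero_mul, zero_add]
    exact congrArg (2 * ·) (hΩ.pd_mul hfc (hfl i) hx i)
  have hpos : volDensity g x y ≠ 0 :=
    (Real.sqrt_pos.mpr (metricCoord_posDef x g hx).det_pos).ne'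
  have hsymm : (extChartAt (𝓡∂ n) x).symm y = x := extChartAt_to_inv x
  have e1 := volDensity_mul_laplace x hg hf hx
  have e2 := volDensity_mul_laplace x hg hf2 hx
  have e3 := gradInner_chart (g := g) x hf1 hf1 hx
  rw [hsymm] at e1 e2 e3
  have e4 : ∑ i, pd i (f ∘ (extChartAt (𝓡∂ n) x).symm) y * flux g x f i y
      = volDensity g x y * gradInner g f f x := by
    rw [← e3, coinnerM, dotProduct, Finset.mul_sum]
    exact Finset.sum_congr rfl fun i _ => by
      rw [flux, Matrix.mulVec, dotProduct, volDensity]; ring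
  refine mul_left_cancel₀ hpos (e2.trans ?_)
  simp only [hpd]
  rw [← Finset.mul_sum, Finset.sum_add_distrib, ← Finset.mul_sum, ← e1, e4, Function.comp_apply, hsymm]
  ring

namespace IsBoundaryRicciFlow

variable {g : ℝ → RMetric n W} (hg : IsBoundaryRicciFlow T g)
include hg

lemma continuousFamily_scal : ContinuousFamily n T fun t x => scal (g t) x := fun x₀ =>
  (hg.contDiffOn_scal x₀).continuousOn

lemma contMDiff_scal {t : ℝ} (ht : t ∈ Ico 0 T) : ContMDiff (𝓡∂ n) 𝓘(ℝ, ℝ) ∞ (scal (g t)) :=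
  contMDiff_of_chart fun x₀ => by
    obtain ⟨f, hf⟩ : ∃ f : ℝ × Coord n → ℝ,
      ∀ q, f q = scal (g q.1) ((extChartAt (𝓡∂ n) x₀).symm q.2) := ⟨_, fun _ => rfl⟩
    have h1 : ContDiffOn ℝ ∞ f (Ico 0 T ×ˢ (extChartAt (𝓡∂ n) x₀).target) :=
      (hg.contDiffOn_scal x₀).congr fun q _ => hf q
    exact (h1.comp (contDiff_prodMk_right t).contDiffOn fun _ hy => ⟨ht, hy⟩).congr
      fun y _ => (hf (t, y)).symm

end IsBoundaryRicciFlow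

end BoundaryRicci

/-! ### The derivative of the Yamabe constant -/

namespace BoundaryRicci

open DiffAlg

lemma integral_linear_combination {X : Type*} [MeasurableSpace X] {μ : Measure X} {f₁ f₂ f₃ f₄ f₅ : X → ℝ} {a b c : ℝ}
    (h₁ : Integrable f₁ μ) (h₂ : Integrable f₂ μ) (h₃ : Integrable f₃ μ) (h₄ : Integrable f₄ μ)
    (h₅ : Integrable f₅ μ) :
    ∫ x, (f₁ x + a * f₂ x + f₃ x + b * f₄ x + c * f₅ x) ∂μ
      = ∫ x, f₁ x ∂μ + a * ∫ x, f₂ x ∂μ + ∫ x, f₃ x ∂μ + b * ∫ x, f₄ x ∂μ + c * ∫ x, f₅ x ∂μ := by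
  have h₁₂ : Integrable (fun x => f₁ x + a * f₂ x) μ := h₁.add (h₂.const_mul a)
  have h₁₃ : Integrable (fun x => f₁ x + a * f₂ x + f₃ x) μ := h₁₂.add h₃
  have h₁₄ : Integrable (fun x => f₁ x + a * f₂ x + f₃ x + b * f₄ x) μ := h₁₃.add (h₄.const_mul b)
  rw [integral_add h₁₄ (h₅.const_mul c), integral_add h₁₃ (h₄.const_mul b), integral_add h₁₂ h₃,
    integral_add h₁ (h₂.const_mul a), integral_const_mul, integral_const_mul, integral_const_mul]

variable {n : ℕ} [NeZero n] {W : Type*} [TopologicalSpace W]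
  [ChartedSpace (EuclideanHalfSpace n) W] [IsManifold (𝓡∂ n) ∞ W] [CompactSpace W] [T2Space W]
  [MeasurableSpace W] [BorelSpace W]

/-- The Yamabe energy of a normalized solution is the constant in its equation. -/
lemma eq_integral_of_solution {g : RMetric n W} (hg : HasSmoothCoord g) {a p Y : ℝ} {f : W → ℝ}
    (hf : ContMDiff (𝓡∂ n) 𝓘(ℝ, ℝ) ∞ f) (hpos : ∀ x, 0 < f x)
    (heq : ∀ x, -a * laplace g f x + scal g x * f x = Y * f x ^ p)
    (hvol : ∫ x, f x ^ (p + 1) ∂(volumeMeasure g) = 1)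
    (hν : ∀ x ∈ (𝓡∂ n).boundary W, normalDeriv g f x = 0) :
    Y = ∫ x, (a * gradInner g f f x + scal g x * f x ^ 2) ∂(volumeMeasure g) := by
  have hf1 : ContMDiff (𝓡∂ n) 𝓘(ℝ, ℝ) 1 f := hf.of_le (by exact_mod_cast le_top)
  have hpt : ∀ x, a * gradInner g f f x + scal g x * f x ^ 2
      = a * (gradInner g f f x + f x * laplace g f x) + Y * f x ^ (p + 1) := by
    intro x
    rw [Real.rpow_add_one (hpos x).ne', ← mul_assoc, ← heq x]
    ring
  have h1 : Continuous fun x => gradInner g f f x + f x * laplace g f x :=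
    (continuous_gradInner hg hf1 hf1).add (hf.continuous.mul (continuous_laplace hg hf))
  have h2 : Continuous fun x => f x ^ (p + 1) :=
    hf.continuous.rpow_const fun x => Or.inl (hpos x).ne'
  simp only [hpt]
  rw [integral_add ((integrable_of_continuous hg h1).const_mul a)
    ((integrable_of_continuous hg h2).const_mul Y), integral_const_mul, integral_const_mul,
    green hg hf hν hf1, hvol]
  ring

variable {T : ℝ} {g : ℝ → RMetric n W}

/-- The derivative of the constants in the Yamabe equations of a family of normalized solutions along
a Ricci flow. -/
theorem IsBoundaryRicciFlow.hasDerivWithinAt_of_solution (hg : IsBoundaryRicciFlow T g)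
    (hn : (n : ℝ) ≠ 0) {a p : ℝ} (hp : p + 1 ≠ 0) {Y : ℝ → ℝ} {u : ℝ → W → ℝ}
    (hu : IsC1Family (n := n) T u) (hpos : ∀ t ∈ Ico 0 T, ∀ x, 0 < u t x)
    (heq : ∀ t ∈ Ico 0 T, ∀ x,
      -a * laplace (g t) (u t) x + scal (g t) x * u t x = Y t * u t x ^ p)
    (hvol : ∀ t ∈ Ico 0 T, ∫ x, u t x ^ (p + 1) ∂(volumeMeasure (g t)) = 1)
    (hν : ∀ t ∈ Ico 0 T, ∀ x ∈ (𝓡∂ n).boundary W, normalDeriv (g t) (u t) x = 0)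
    {t : ℝ} (ht : t ∈ Ico 0 T) :
    HasDerivWithinAt Y
      ((∫ x, (2 * a * ric0 (g t) x (grad (g t) (u t) x) (grad (g t) (u t) x)
            + 2 * ric0NormSq (g t) x * u t x ^ 2) ∂(volumeMeasure (g t)))
        + (2 / (n : ℝ) - (p - 1) / (p + 1)) *
          (∫ x, (a * scal (g t) x * gradNormSq (g t) (u t) x
            + scal (g t) x ^ 2 * u t x ^ 2) ∂(volumeMeasure (g t)))
        + ∫ x, (u t x ^ 2 * laplace (g t) (scal (g t)) x
            - a / (p + 1) * scal (g t) x * laplace (g t) (fun y => u t y ^ 2) x)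
              ∂(volumeMeasure (g t)))
      (Ico 0 T) t := by
  have hS := hg.hasSmoothCoord ht
  have huf := hu.smooth t ht
  have hh1 := hu.contMDiff_timeDeriv ht
  have hscal := hg.continuousFamily_scal
  have huc := hu.continuous.continuousFamily
  have hhc := hu.continuous_deriv.continuousFamily
  have hGI := hg.continuousFamily_gradInner one_le_two one_le_two hu.continuous hu.continuous
  have hGIh := hg.continuousFamily_gradInner one_le_two one_le_two hu.continuous_deriv hu.continuous
  have hRG := hg.continuousFamily_ric_grad one_le_two hu.continuous
  have hscal' : ContinuousFamily n T (scalDeriv g) := hg.continuousOn_scalDeriv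
  have hY : ∀ s ∈ Ico 0 T, Y s = ∫ x, (a * gradInner (g s) (u s) (u s) x
      + scal (g s) x * u s x ^ 2) ∂(volumeMeasure (g s)) := fun s hs =>
    eq_integral_of_solution (hg.hasSmoothCoord hs) (hu.smooth s hs) (hpos s hs)
      (heq s hs) (hvol s hs) (hν s hs)
  have hD := hg.hasDerivWithinAt_integral
    (f := fun s x => a * gradInner (g s) (u s) (u s) x + scal (g s) x * u s x ^ 2)
    (f' := fun s x => a * (2 * ric (g s) x (grad (g s) (u s) x) (grad (g s) (u s) x)
      + 2 * gradInner (g s) (timeDeriv T u s) (u s) x)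
      + (scalDeriv g s x * u s x ^ 2 + scal (g s) x * (2 * (u s x * timeDeriv T u s x))))
    ((hGI.const_mul a).add (hscal.mul (huc.pow 2)))
    ((((hRG.const_mul 2).add (hGIh.const_mul 2)).const_mul a).add
      ((hscal'.mul (huc.pow 2)).add (hscal.mul ((huc.mul hhc).const_mul 2))))
    (fun s hs x => by
      have h1 := ((hg.hasDerivWithinAt_gradInner hu hs x).const_mul a).add
        ((hg.hasDerivWithinAt_scal hs x).mul ((hu.hasDerivWithinAt hs x).fun_pow 2))
      refine h1.congr_deriv ?_
      simp only [Nat.cast_ofNat, Nat.add_one_sub_one, pow_one]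
      ring) ht
  refine (hD.congr hY (hY t ht)).congr_deriv ?_
  have hV := hg.hasDerivWithinAt_integral (f := fun s x => u s x ^ (p + 1))
    (f' := fun s x => (p + 1) * (u s x ^ p * timeDeriv T u s x))
    (huc.rpow hpos (p + 1)) (((huc.rpow hpos p).mul hhc).const_mul (p + 1))
    (fun s hs x => by
      have h1 := (hu.hasDerivWithinAt hs x).rpow_const (p := p + 1) (Or.inl (hpos s hs x).ne')
      refine h1.congr_deriv ?_
      rw [add_sub_cancel_right]
      ring) ht
  -- The normalization is constant in time, so ∫ ((p+1)uᵖh - R uᵖ⁺¹) = 0; this is what eliminates h.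
  have hV0 := (uniqueDiffOn_Ico 0 T t ht).eq_deriv _ hV
    ((hasDerivWithinAt_const t (Ico 0 T) (1 : ℝ)).congr hvol (hvol t ht))
  have hG0 := green hS huf (hν t ht) hh1
  have c1 := hscal.slice ht
  have c2 := huc.slice ht
  have c3 := hhc.slice ht
  have c4 : Continuous (fun x => gradInner (g t) (u t) (u t) x) := hGI.slice ht
  have c5 : Continuous (fun x => ric (g t) x (grad (g t) (u t) x) (grad (g t) (u t) x)) :=
    hRG.slice ht
  have c6 := hscal'.slice ht
  have c7 := continuous_laplace hS (hg.contMDiff_scal ht)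
  have c8 := continuous_laplace hS huf
  have c9 : Continuous fun x => u t x ^ p := (huc.rpow hpos p).slice ht
  have c10 : Continuous fun x => u t x ^ (p + 1) := (huc.rpow hpos (p + 1)).slice ht
  have c11 : Continuous (laplace (g t) fun y => u t y ^ 2) := continuous_laplace hS (huf.pow 2)
  have c12 : Continuous (fun x => gradInner (g t) (timeDeriv T u t) (u t) x) := hGIh.slice ht
  have hric0 : ∀ x, ric0 (g t) x (grad (g t) (u t) x) (grad (g t) (u t) x)
      = ric (g t) x (grad (g t) (u t) x) (grad (g t) (u t) x)
        - scal (g t) x / n * gradInner (g t) (u t) (u t) x := fun x => by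
    rw [ric0, gradInner, ← innerAt_grad]; rfl
  -- |Ric|² is read off as (∂ₜR - ΔR)/2, both of whose terms are known to be continuous.
  have hnorm : ∀ x, ric0NormSq (g t) x = (scalDeriv g t x - laplace (g t) (scal (g t)) x) / 2
      - scal (g t) x ^ 2 / n := fun x => by
    rw [ric0NormSq_eq hn, scalDeriv]; ring
  have hgn : ∀ x, gradNormSq (g t) (u t) x = gradInner (g t) (u t) (u t) x := fun x =>
    gradNormSq_eq _ _
  have i1 : Integrable (fun x => 2 * a * ric0 (g t) x (grad (g t) (u t) x) (grad (g t) (u t) x)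
      + 2 * ric0NormSq (g t) x * u t x ^ 2) (volumeMeasure (g t)) := by
    simp only [hric0, hnorm]
    exact integrable_of_continuous hS (by fun_prop)
  have i2 : Integrable (fun x => a * scal (g t) x * gradNormSq (g t) (u t) x
      + scal (g t) x ^ 2 * u t x ^ 2) (volumeMeasure (g t)) := by
    simp only [hgn]
    exact integrable_of_continuous hS (by fun_prop)
  have i3 : Integrable (fun x => u t x ^ 2 * laplace (g t) (scal (g t)) x
      - a / (p + 1) * scal (g t) x * laplace (g t) (fun y => u t y ^ 2) x)
      (volumeMeasure (g t)) :=
    integrable_of_continuous hS (by fun_prop)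
  have i4 : Integrable (fun x => gradInner (g t) (timeDeriv T u t) (u t) x
      + timeDeriv T u t x * laplace (g t) (u t) x) (volumeMeasure (g t)) :=
    integrable_of_continuous hS (by fun_prop)
  have i5 : Integrable (fun x => (p + 1) * (u t x ^ p * timeDeriv T u t x)
      - scal (g t) x * u t x ^ (p + 1)) (volumeMeasure (g t)) :=
    integrable_of_continuous hS (by fun_prop)
  -- The differentiated integrand is the desired one plus multiples of the Green integrand and of
  -- the normalization integrand, both of integral zero. In the coefficient of R(a|∇u|² + Ru²), 2/n
  -- is the trace part of Ric, -1 comes from the volume form, and 2/(p+1) from replacing uᵖh by R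
  -- uᵖ⁺¹/(p+1), using the equation and rewriting uΔu through Δu² and |∇u|².
  have hpt : ∀ x, a * (2 * ric (g t) x (grad (g t) (u t) x) (grad (g t) (u t) x)
      + 2 * gradInner (g t) (timeDeriv T u t) (u t) x)
      + (scalDeriv g t x * u t x ^ 2 + scal (g t) x * (2 * (u t x * timeDeriv T u t x)))
      - scal (g t) x * (a * gradInner (g t) (u t) (u t) x + scal (g t) x * u t x ^ 2)
      = (2 * a * ric0 (g t) x (grad (g t) (u t) x) (grad (g t) (u t) x)
          + 2 * ric0NormSq (g t) x * u t x ^ 2)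
        + (2 / (n : ℝ) - (p - 1) / (p + 1)) * (a * scal (g t) x * gradNormSq (g t) (u t) x
          + scal (g t) x ^ 2 * u t x ^ 2)
        + (u t x ^ 2 * laplace (g t) (scal (g t)) x
          - a / (p + 1) * scal (g t) x * laplace (g t) (fun y => u t y ^ 2) x)
        + 2 * a * (gradInner (g t) (timeDeriv T u t) (u t) x
          + timeDeriv T u t x * laplace (g t) (u t) x)
        + 2 * Y t / (p + 1) * ((p + 1) * (u t x ^ p * timeDeriv T u t x)
          - scal (g t) x * u t x ^ (p + 1)) := by
    intro x
    have h1 : 2 * Y t / (p + 1) * ((p + 1) * (u t x ^ p * timeDeriv T u t x)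
        - scal (g t) x * u t x ^ (p + 1))
        = 2 / (p + 1) * ((p + 1) * timeDeriv T u t x - scal (g t) x * u t x)
          * (-a * laplace (g t) (u t) x + scal (g t) x * u t x) := by
      rw [heq t ht x, Real.rpow_add_one (hpos t ht x).ne']
      ring
    rw [h1, hric0, hnorm, hgn, laplace_sq hS huf]
    field_simp
    ring
  simp only [hpt]
  rw [integral_linear_combination i1 i2 i3 i4 i5, hG0, hV0]
  ring

end BoundaryRicci

end

theorem theoremB {n : ℕ} [NeZero n] (hn : 3 ≤ n)
    {W : Type*} [TopologicalSpace W] [ChartedSpace (EuclideanHalfSpace n) W]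
    [IsManifold (𝓡∂ n) ∞ W] [CompactSpace W] [T2Space W] [MeasurableSpace W] [BorelSpace W]
    (T : ℝ) (g : ℝ → RMetric n W) (hg : IsBoundaryRicciFlow T g)
    (p : ℝ) (hp : 1 < p) (hp' : p ≤ ((n : ℝ) + 2) / ((n : ℝ) - 2))
    (u : ℝ → W → ℝ) (hu : IsC1Family (n := n) T u)
    (hpos : ∀ t ∈ Ico 0 T, ∀ x, 0 < u t x)
    (heq : ∀ t ∈ Ico 0 T, ∀ x,
      -(4 * ((n : ℝ) - 1) / ((n : ℝ) - 2)) * laplace (g t) (u t) x + scal (g t) x * u t x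
        = yamabeConst p (g t) * u t x ^ p)
    (hvol : ∀ t ∈ Ico 0 T, ∫ x, u t x ^ (p + 1) ∂(volumeMeasure (g t)) = 1)
    (hbdry : ∀ t ∈ Ico 0 T, ∀ x ∈ (𝓡∂ n).boundary W, normalDeriv (g t) (u t) x = 0) :
    -- the formula for the derivative of `Y_p`
    (∀ t ∈ Ico 0 T,
      HasDerivWithinAt (fun s => yamabeConst p (g s))
        ((∫ x, (8 * ((n : ℝ) - 1) / ((n : ℝ) - 2)
              * ric0 (g t) x (grad (g t) (u t) x) (grad (g t) (u t) x)
            + 2 * ric0NormSq (g t) x * u t x ^ 2) ∂(volumeMeasure (g t)))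
          + (2 / (n : ℝ) - (p - 1) / (p + 1)) *
            (∫ x, (4 * ((n : ℝ) - 1) / ((n : ℝ) - 2)
                * scal (g t) x * gradNormSq (g t) (u t) x
              + scal (g t) x ^ 2 * u t x ^ 2) ∂(volumeMeasure (g t)))
          + (∫ x, (u t x ^ 2 * laplace (g t) (scal (g t)) x
              - 4 * ((n : ℝ) - 1) / ((p + 1) * ((n : ℝ) - 2))
                * scal (g t) x * laplace (g t) (fun y => u t y ^ 2) x) ∂(volumeMeasure (g t)))
          - 8 * ((n : ℝ) - 1) / ((n : ℝ) - 2) *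
            (∫ x, (2 * u t x * ric (g t) x (grad (g t) (u t) x) (outNormal (g t) x)
              + u t x * normalDeriv (g t) (timeDeriv T u t) x) ∂(bdryMeasure (g t))))
        (Ico 0 T) t) ∧
    -- the boundary terms at a boundary point `x`, in coordinates whose coordinate vectors at `x`
    -- are orthonormal, the last one being the outward unit normal
    (∀ t ∈ Ico 0 T, ∀ x ∈ (𝓡∂ n).boundary W, ∀ e : Fin (n - 1) → Coord n,
      (∀ i j, (g t).inner x (e i : TangentSpace (𝓡∂ n) x) (e j : TangentSpace (𝓡∂ n) x)
        = if i = j then 1 else 0) →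
      (∀ i, (g t).inner x (e i : TangentSpace (𝓡∂ n) x)
        (outNormal (g t) x : TangentSpace (𝓡∂ n) x) = 0) →
      HasDerivWithinAt (fun s => outNormal (g s) x)
        ((2 : ℝ) • ∑ i, ric (g t) x (e i) (outNormal (g t) x) • e i
          + ric (g t) x (outNormal (g t) x) (outNormal (g t) x) • outNormal (g t) x)
        (Ico 0 T) t ∧
      normalDeriv (g t) (timeDeriv T u t) x
        = -2 * ∑ i, ric (g t) x (e i) (outNormal (g t) x) * dirDeriv (u t) x (e i) ∧
      ric (g t) x (grad (g t) (u t) x) (outNormal (g t) x)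
        = ∑ i, ric (g t) x (e i) (outNormal (g t) x) * dirDeriv (u t) x (e i)) := by
  have hn0 : (n : ℝ) ≠ 0 := Nat.cast_ne_zero.mpr (NeZero.ne n)
  have hp0 : p + 1 ≠ 0 := by linarith
  refine ⟨fun t ht => ?_, fun t ht x hx e he heν => ?_⟩
  · have h := hg.hasDerivWithinAt_of_solution hn0 hp0 hu hpos heq hvol hbdry ht
    refine h.congr_deriv ?_
    -- On M one has ∂_ν h = -2 Ric(∇u,ν), so this integrand vanishes pointwise there and the
    -- boundary measure sees nothing else; the interior formula is already the full derivative.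
    have hb : ∫ x, (2 * u t x * ric (g t) x (grad (g t) (u t) x) (outNormal (g t) x)
        + u t x * normalDeriv (g t) (timeDeriv T u t) x) ∂(bdryMeasure (g t)) = 0 := by
      refine integral_eq_zero_of_ae ?_
      filter_upwards [mem_ae_iff.mpr (bdryMeasure_compl_boundary (g t))] with x hx
      rw [hg.normalDeriv_timeDeriv hu (fun s hs => hbdry s hs x hx) ht, Pi.zero_apply]
      ring
    have h1 : 2 * (4 * ((n : ℝ) - 1) / ((n : ℝ) - 2)) = 8 * ((n : ℝ) - 1) / ((n : ℝ) - 2) := by ring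
    have h2 : 4 * ((n : ℝ) - 1) / ((n : ℝ) - 2) / (p + 1)
        = 4 * ((n : ℝ) - 1) / ((p + 1) * ((n : ℝ) - 2)) := by rw [div_div, mul_comm (p + 1)]
    rw [hb, mul_zero, sub_zero, h1, h2]
  · have hr := IsBoundaryRicciFlow.ric_grad_outNormal (hbdry t ht x hx) he heν
    refine ⟨hg.hasDerivWithinAt_outNormal_orthonormal ht x he heν, ?_, hr⟩
    rw [hg.normalDeriv_timeDeriv hu (fun s hs => hbdry s hs x hx) ht, hr]
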